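/- Let $\nu>1$, $\alpha>0$, let $K\ge 1$ be an integer with $\sqrt\alpha<K+1$. For $\mathbb K\in\{\mathbb R,\mathbb C\}$ let $\ell^1_\nu$ be the space of sequences $a=(a_k)_{k\ge0}$ in $\mathbb K$ with $|a|_\nu:=|a_0|+2\sum_{k\ge1}|a_k|\nu^k<\infty$, and let $(a*b)_k:=\sum_{k_1+k_2=k,\;k_i\in\mathbb Z}a_{|k_1|}b_{|k_2|}$. Identify $\mathbb K^{K+1}$ with the sequences vanishing at indices $>K$; for a $(K+1)\times(K+1)$ matrix $M$ let $\|M\|$ be the operator norm induced by $|\cdot|_\nu$ on $\mathbb K^{K+1}$. Let $c\in\ell^1_\nu$ be real and write $c=c^K+c^\infty$, where $c^K$ is the truncation of $c$ to the indices $0,\dots,K$. Fisher's equation with Neumann boundary conditions, in cosine coefficients, is $a'=g(a)$ with $$g_k(a)=(\alpha-k^2)a_k-\alpha(c*a*a)_k,\qquad [Dg(a)h]_k=(\alpha-k^2)h_k-2\alpha(c*a*h)_k ,\qquad k\ge 0.$$ Let $\bar a\in\mathbb R^{K+1}$, let $g^K(\bar a)_k=(\alpha-k^2)\bar a_k-\alpha(c^K*\bar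 a*\bar a)_k$ for $0\le k\le K$, and let $Dg^K(\bar a)$ be its Jacobian matrix, $(Dg^K(\bar a)h)_k=(\alpha-k^2)h_k-2\alpha(c^K*\bar a*h)_k$. Let $A^K$ be a real $(K+1)\times(K+1)$ matrix that is diagonalizable over $\mathbb C$, $A^K=Q^K\,\mathrm{diag}(\lambda_0,\dots,\lambda_K)\,Q^{-K}$ with $Q^K$ invertible and $Q^{-K}=(Q^K)^{-1}$, such that $\operatorname{Re}\lambda_j\neq0$ for all $j$ and exactly $m$ of the $\lambda_j$ have positive real part. Put $$Y_0=|A^Kg^K(\bar a)|_\nu+\alpha\|A^K\||\bar a|_\nu^2|c^\infty|_\nu+\alpha\frac{|c^\infty|_\nu|\bar a|_\nu^2}{(K+1)^2-\alpha}+2\sum_{k=K+1}^{3K}\alpha\frac{|(c^K*\bar a*\bar a)_k|}{k^2-\alpha}\nu^k,\qquad Z_0=\|\mathrm{Id}-A^KDg^K(\bar a)\|,$$ $$Z_1=2\alpha\sum_{k=0}^K|A^K_{0k}|\beta_k+4\alpha\sum_{n=1}^K\Big(\sum_{k=0}^K|A^K_{nk}|\beta_k\Big)\nu^n+\frac{2\alpha}{(K+1)^2-\alpha}|c|_\nu|\bar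 a|_\nu,\qquad Z_2=2\alpha\max(\|A^K\|,1)\max(|c|_\nu,1),$$ $$\beta_k=\max_{K+1\le j\le 2K-k}\frac{|(c^K*\bar a)_{j+k}|}{2\nu^j}+\max_{K+1\le j\le 2K+k}\frac{|(c^K*\bar a)_{j-k}|}{2\nu^j}$$ (a maximum over an empty range is $0$), and $$\mu_0=\max_{0\le j\le K}\sqrt{1+\Big(\frac{\operatorname{Im}\lambda_j}{\operatorname{Re}\lambda_j}\Big)^2}.$$ Suppose that $r>0$ satisfies $Z_2r^2-(1-Z_0-Z_1)r+Y_0<0$, put $\epsilon=Z_2r+Z_1+Z_0$, and assume $\|Q^K\|\,\|Q^{-K}\|\,\mu_0\,\epsilon<1$. 1. If $\frac1{(K+1)^2-\alpha}\le\max(\|A^K\|,1)$ (for instance, if $\alpha\le(K+1)^2-1$), then there is exactly one real $\tilde a\in\ell^1_\nu$ with $|\tilde a-\bar a|_\nu<r$ and $g(\tilde a)=0$. 2. In all cases, if $\tilde a$ is the unique real element of $\ell^1_\nu$ with $|\tilde a-\bar a|_\nu<r$ and $g(\tilde a)=0$, then $Dg(\tilde a)$ has exactly $m$ unstable eigenvalues: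 the set of $\lambda\in\mathbb C$ with $\operatorname{Re}\lambda>0$ for which $Dg(\tilde a)\xi=\lambda\xi$ has a nonzero complex solution $\xi\in\ell^1_\nu$ is finite, and the algebraic multiplicities of these $\lambda$ (dimensions of the generalized eigenspaces in $\ell^1_\nu$) are finite and sum to $m$. -/

import Mathlib

namespace Fisher

/-- The weights of the norm `|a|_ν = |a₀| + 2 ∑_{k ≥ 1} |a_k| ν ^ k`. -/
noncomputable def weight (ν : ℝ) (k : ℕ) : ℝ := if k = 0 then 1 else 2 * ν ^ k

/-- The norm `|a|_ν` (meaningful for elements of `ell1 𝕜 ν`). -/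
noncomputable def ell1Norm {𝕜 : Type*} [RCLike 𝕜] (ν : ℝ) (a : ℕ → 𝕜) : ℝ :=
  ∑' k, weight ν k * ‖a k‖

/-- The sequence space `ℓ¹_ν` over `𝕜 = ℝ` or `ℂ`. -/
def ell1 (𝕜 : Type*) [RCLike 𝕜] (ν : ℝ) : Submodule 𝕜 (ℕ → 𝕜) where
  carrier := {a | Summable fun k => ν ^ k * ‖a k‖}
  zero_mem' := by simp [summable_zero]
  add_mem' := by
    intro a b ha hb
    simp only [Set.mem_ofPred_eq] at *
    have ha' : Summable fun k => |ν| ^ k * ‖a k‖ := by simpa [abs_mul] using ha.abs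
    have hb' : Summable fun k => |ν| ^ k * ‖b k‖ := by simpa [abs_mul] using hb.abs
    refine Summable.of_norm_bounded (ha'.add hb') (fun k => ?_)
    rw [norm_mul, norm_norm, norm_pow, Real.norm_eq_abs, ← mul_add]
    exact mul_le_mul_of_nonneg_left (norm_add_le _ _) (by positivity)
  smul_mem' := by
    intro t a ha
    simp only [Set.mem_ofPred_eq] at *
    refine (ha.mul_left ‖t‖).congr (fun k => ?_)
    simp only [Pi.smul_apply, smul_eq_mul, norm_mul]
    ring

/-- The discrete convolution `(a ∗ b)_k = ∑_{k₁ + k₂ = k, kᵢ ∈ ℤ} a_{|k₁|} b_{|k₂|}`. -/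
noncomputable def conv {𝕜 : Type*} [RCLike 𝕜] (a b : ℕ → 𝕜) (k : ℕ) : 𝕜 :=
  ∑' j : ℤ, a j.natAbs * b ((k : ℤ) - j).natAbs

/-- The inclusion of `𝕜^{K+1}` into the space of sequences. -/
def incl {𝕜 : Type*} [RCLike 𝕜] {K : ℕ} (h : Fin (K + 1) → 𝕜) (k : ℕ) : 𝕜 :=
  if hk : k < K + 1 then h ⟨k, hk⟩ else 0

/-- The truncation `c^K` of a sequence: its entries of index at most `K`. -/
def trunc (K : ℕ) (c : ℕ → ℝ) (k : ℕ) : ℝ := if k ≤ K then c k else 0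

/-- The operator norm of a matrix, induced by `|·|_ν` on `𝕜^{K+1} ⊂ ℓ¹_ν`. -/
noncomputable def opNorm {𝕜 : Type*} [RCLike 𝕜] {K : ℕ} (ν : ℝ)
    (M : Matrix (Fin (K + 1)) (Fin (K + 1)) 𝕜) : ℝ :=
  sInf {C : ℝ | 0 ≤ C ∧ ∀ h : Fin (K + 1) → 𝕜,
    ell1Norm ν (incl (M.mulVec h)) ≤ C * ell1Norm ν (incl h)}

/-! ### Fisher's equation in cosine coefficients -/

/-- `g_k(a) = (α - k²) a_k - α (c ∗ a ∗ a)_k`. -/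
noncomputable def g (α : ℝ) (c a : ℕ → ℝ) (k : ℕ) : ℝ :=
  (α - (k : ℝ) ^ 2) * a k - α * conv (conv c a) a k

/-- The finite dimensional projection `g^K`. As `c^K` and `a` vanish beyond index `K`, the
convolution is the sum over `k₁ + k₂ + k₃ = k`, `-K ≤ kᵢ ≤ K`. -/
noncomputable def gK {K : ℕ} (α : ℝ) (c : ℕ → ℝ) (a : Fin (K + 1) → ℝ) (k : Fin (K + 1)) : ℝ :=
  (α - (k : ℝ) ^ 2) * a k - α * conv (conv (trunc K c) (incl a)) (incl a) k

/-- The Jacobian matrix `Dg^K(a)`: its action on `h` is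
`(α - k²) h_k - 2 α (c^K ∗ a ∗ h)_k`, `0 ≤ k ≤ K`; column `j` is the image of the `j`-th basis
vector. -/
noncomputable def DgK {K : ℕ} (α : ℝ) (c : ℕ → ℝ) (a : Fin (K + 1) → ℝ) :
    Matrix (Fin (K + 1)) (Fin (K + 1)) ℝ :=
  Matrix.of fun k j =>
    (α - (k : ℝ) ^ 2) * (Pi.single j 1 : Fin (K + 1) → ℝ) k
      - 2 * α * conv (conv (trunc K c) (incl a)) (incl (Pi.single j 1 : Fin (K + 1) → ℝ)) k

/-! ### The constants of the radii polynomial -/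

noncomputable def Y₀ {K : ℕ} (ν α : ℝ) (c : ℕ → ℝ) (abar : Fin (K + 1) → ℝ)
    (AK : Matrix (Fin (K + 1)) (Fin (K + 1)) ℝ) : ℝ :=
  ell1Norm ν (incl (AK.mulVec (gK α c abar)))
    + α * opNorm ν AK * ell1Norm ν (incl abar) ^ 2 * ell1Norm ν (c - trunc K c)
    + α * (ell1Norm ν (c - trunc K c) * ell1Norm ν (incl abar) ^ 2 / (((K : ℝ) + 1) ^ 2 - α))
    + 2 * ∑ k ∈ Finset.Icc (K + 1) (3 * K),
        α * (|conv (conv (trunc K c) (incl abar)) (incl abar) k| / ((k : ℝ) ^ 2 - α)) * ν ^ k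

noncomputable def Z₀ {K : ℕ} (ν α : ℝ) (c : ℕ → ℝ) (abar : Fin (K + 1) → ℝ)
    (AK : Matrix (Fin (K + 1)) (Fin (K + 1)) ℝ) : ℝ :=
  opNorm ν (1 - AK * DgK α c abar)

/-- The numbers `β_k`, `0 ≤ k ≤ K`. A maximum over an empty range of `j` is `0`. -/
noncomputable def β {K : ℕ} (ν : ℝ) (c : ℕ → ℝ) (abar : Fin (K + 1) → ℝ) (k : ℕ) : ℝ :=
  (⨆ j : {j : ℕ // j ∈ Finset.Icc (K + 1) (2 * K - k)},
      |conv (trunc K c) (incl abar) (j.1 + k)| / (2 * ν ^ j.1))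
    + ⨆ j : {j : ℕ // j ∈ Finset.Icc (K + 1) (2 * K + k)},
      |conv (trunc K c) (incl abar) (j.1 - k)| / (2 * ν ^ j.1)

noncomputable def Z₁ {K : ℕ} (ν α : ℝ) (c : ℕ → ℝ) (abar : Fin (K + 1) → ℝ)
    (AK : Matrix (Fin (K + 1)) (Fin (K + 1)) ℝ) : ℝ :=
  2 * α * ∑ k : Fin (K + 1), |AK 0 k| * β ν c abar k
    + 4 * α * ∑ n : Fin K, (∑ k : Fin (K + 1), |AK n.succ k| * β ν c abar k) * ν ^ ((n : ℕ) + 1)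
    + 2 * α / (((K : ℝ) + 1) ^ 2 - α) * ell1Norm ν c * ell1Norm ν (incl abar)

noncomputable def Z₂ {K : ℕ} (ν α : ℝ) (c : ℕ → ℝ)
    (AK : Matrix (Fin (K + 1)) (Fin (K + 1)) ℝ) : ℝ :=
  2 * α * max (opNorm ν AK) 1 * max (ell1Norm ν c) 1

/-- `μ₀ = max_j √(1 + (Im λ_j / Re λ_j)²)`. -/
noncomputable def μ₀ {K : ℕ} (lam : Fin (K + 1) → ℂ) : ℝ :=
  ⨆ j : Fin (K + 1), Real.sqrt (1 + ((lam j).im / (lam j).re) ^ 2)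

/-- `a` is a zero of `g` in the ball of radius `r` about `abar` in (real) `ℓ¹_ν`. -/
def IsZeroInBall {K : ℕ} (ν α r : ℝ) (c : ℕ → ℝ) (abar : Fin (K + 1) → ℝ)
    (a : ell1 ℝ ν) : Prop :=
  ell1Norm ν ((a : ℕ → ℝ) - incl abar) < r ∧ ∀ k, g α c a k = 0

/-! ### The linearization and its unstable eigenvalues -/

theorem summable_int {𝕜 : Type*} [RCLike 𝕜] {ν : ℝ} (hν : 1 < ν) {a : ℕ → 𝕜}
    (ha : a ∈ ell1 𝕜 ν) : Summable fun j : ℤ => ‖a j.natAbs‖ := by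
  have h : Summable fun k : ℕ => ‖a k‖ := by
    refine Summable.of_nonneg_of_le (fun _ => norm_nonneg _) (fun k => ?_) (show Summable _ from ha)
    exact le_mul_of_one_le_left (norm_nonneg _) (one_le_pow₀ hν.le)
  refine Summable.of_nat_of_neg ?_ ?_
  · simpa using h
  · simpa using h

theorem summable_conv {𝕜 : Type*} [RCLike 𝕜] {ν : ℝ} (hν : 1 < ν) {b h : ℕ → 𝕜} {C : ℝ}
    (hb : ∀ k, ‖b k‖ ≤ C) (hh : h ∈ ell1 𝕜 ν) (k : ℕ) :
    Summable fun j : ℤ => ‖b j.natAbs * h ((k : ℤ) - j).natAbs‖ := by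
  have h1 : Summable fun j : ℤ => ‖h ((k : ℤ) - j).natAbs‖ :=
    (Equiv.subLeft (k : ℤ)).summable_iff.mpr (summable_int hν hh)
  refine Summable.of_nonneg_of_le (fun _ => norm_nonneg _) (fun j => ?_) (h1.mul_left C)
  rw [norm_mul]
  exact mul_le_mul_of_nonneg_right (hb _) (norm_nonneg _)

theorem exists_bound {𝕜 : Type*} [RCLike 𝕜] {ν : ℝ} (hν : 1 < ν) {a : ℕ → 𝕜}
    (ha : a ∈ ell1 𝕜 ν) : ∃ C, ∀ k, ‖a k‖ ≤ C := by
  refine ⟨∑' j : ℤ, ‖a j.natAbs‖, fun k => ?_⟩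
  simpa using (summable_int hν ha).le_tsum (k : ℤ) (fun _ _ => norm_nonneg _)

theorem exists_bound_conv {𝕜 : Type*} [RCLike 𝕜] {ν : ℝ} (hν : 1 < ν) {a b : ℕ → 𝕜}
    (ha : a ∈ ell1 𝕜 ν) (hb : b ∈ ell1 𝕜 ν) : ∃ C, ∀ k, ‖conv a b k‖ ≤ C := by
  obtain ⟨C, hC⟩ := exists_bound hν hb
  refine ⟨∑' j : ℤ, ‖a j.natAbs‖ * C, fun k => ?_⟩
  refine tsum_of_norm_bounded ((summable_int hν ha).mul_right C).hasSum (fun j => ?_)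
  rw [norm_mul]
  exact mul_le_mul_of_nonneg_left (hC _) (norm_nonneg _)

theorem conv_add {𝕜 : Type*} [RCLike 𝕜] {ν : ℝ} (hν : 1 < ν) {b x y : ℕ → 𝕜} {C : ℝ}
    (hb : ∀ k, ‖b k‖ ≤ C) (hx : x ∈ ell1 𝕜 ν) (hy : y ∈ ell1 𝕜 ν) (k : ℕ) :
    conv b (x + y) k = conv b x k + conv b y k := by
  unfold conv
  rw [← (summable_conv hν hb hx k).of_norm.tsum_add (summable_conv hν hb hy k).of_norm]
  simp only [Pi.add_apply, mul_add]

theorem conv_smul {𝕜 : Type*} [RCLike 𝕜] (b x : ℕ → 𝕜) (t : 𝕜) (k : ℕ) :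
    conv b (t • x) k = t * conv b x k := by
  unfold conv
  rw [← tsum_mul_left]
  refine tsum_congr (fun j => ?_)
  simp only [Pi.smul_apply, smul_eq_mul]
  ring

/-- The linearization `[Dg(a) h]_k = (α - k²) h_k - 2 α (c ∗ a ∗ h)_k`, defined for all `h` in
the complex space `ℓ¹_ν`, with values in the space of all sequences (the factor `k²` makes it
unbounded as an operator in `ℓ¹_ν`). -/
noncomputable def Dg {ν : ℝ} (hν : 1 < ν) (α : ℝ) (c a : ell1 ℝ ν) :
    ell1 ℂ ν →ₗ[ℂ] (ℕ → ℂ) where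
  toFun h k := ((α : ℂ) - (k : ℂ) ^ 2) * (h : ℕ → ℂ) k
    - 2 * (α : ℂ) * conv (fun n => ((conv (c : ℕ → ℝ) a n : ℝ) : ℂ)) h k
  map_add' := by
    intro x y
    obtain ⟨C, hC⟩ := exists_bound_conv hν c.2 a.2
    funext k
    have e := conv_add hν (b := fun n => ((conv (c : ℕ → ℝ) a n : ℝ) : ℂ)) (C := C)
      (fun n => by simpa using hC n) x.2 y.2 k
    simp only [Submodule.coe_add, Pi.add_apply] at e ⊢
    rw [e]
    ring
  map_smul' := by
    intro t x
    funext k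
    have e := conv_smul (fun n => ((conv (c : ℕ → ℝ) a n : ℝ) : ℂ)) x t k
    simp only [Submodule.coe_smul, Pi.smul_apply, smul_eq_mul, RingHom.id_apply] at e ⊢
    rw [e]
    ring

/-- `z` is an eigenvalue of `L`, with eigenvector in `ℓ¹_ν`. -/
def IsEigenvalue {ν : ℝ} (L : ell1 ℂ ν →ₗ[ℂ] (ℕ → ℂ)) (z : ℂ) : Prop :=
  ∃ ξ : ell1 ℂ ν, ξ ≠ 0 ∧ L ξ = z • (ξ : ℕ → ℂ)

/-- The kernels of the powers of `L - z`: `ξ` belongs to the one of order `n + 1` if `(L - z) ξ`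
lies in `ℓ¹_ν` and belongs to the one of order `n`. -/
noncomputable def kerPow {ν : ℝ} (L : ell1 ℂ ν →ₗ[ℂ] (ℕ → ℂ)) (z : ℂ) :
    ℕ → Submodule ℂ (ell1 ℂ ν)
  | 0 => ⊥
  | n + 1 => ((kerPow L z n).map (ell1 ℂ ν).subtype).comap (L - z • (ell1 ℂ ν).subtype)

/-- The generalized eigenspace; its dimension is the algebraic multiplicity of `z`. -/
noncomputable def genEigenspace {ν : ℝ} (L : ell1 ℂ ν →ₗ[ℂ] (ℕ → ℂ)) (z : ℂ) :
    Submodule ℂ (ell1 ℂ ν) := ⨆ n, kerPow L z n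

/-- The eigenvalues with positive real part. -/
def unstableEigenvalues {ν : ℝ} (L : ell1 ℂ ν →ₗ[ℂ] (ℕ → ℂ)) : Set ℂ :=
  {z | 0 < z.re ∧ IsEigenvalue L z}

/-- `L` has exactly `m` unstable eigenvalues, counted with algebraic multiplicity. -/
def HasExactlyUnstable {ν : ℝ} (L : ell1 ℂ ν →ₗ[ℂ] (ℕ → ℂ)) (m : ℕ) : Prop :=
  (unstableEigenvalues L).Finite ∧
  (∀ z ∈ unstableEigenvalues L, FiniteDimensional ℂ (genEigenspace L z)) ∧
  ∑ᶠ z ∈ unstableEigenvalues L, Module.finrank ℂ (genEigenspace L z) = m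

end Fisher

/-!
The zeros of `g` near `ā` are the fixed points of the Newton-like operator `T x = x - A g(x)`, where
`A` is `A^K` on the modes up to `K` and `1 / (α - k²)` on the others. Since `g` is quadratic,
`T x - T y = E((x + y) / 2) (x - y)` exactly, with the defect `E(x) = 1 - A Dg(x)`, which is a
bounded operator on the Banach algebra `ℓ¹_ν` (`newton_sub`). Everything rests on the size of
`E(x)`.

The constants `Z₀`, `Z₁`, `Z₂` do not bound `E(x)` by themselves: the product of `c^∞` with `ā`,
multiplied by `A^K` on the modes up to `K`, is missing from `Z₁`. However, as `c^∞` vanishes up to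
index `K`, at most half of the mass of `c^∞ ∗ y` falls on the modes up to `K` (`conv_low_le`). Thus
the missing term is at most `τ |x|` with `τ = α (‖A^K‖ - 1 / ((K + 1)² - α))⁺ |c^∞|` (`excess`), and
`|E(x)| ≤ Z₀ + Z₁ + (Z₂ - 2 τ) |x - ā| + τ |x|` (`norm_defect_le`), provided that
`1 / ((K + 1)² - α) ≤ max (‖A^K‖, 1)`. On the other hand `Y₀` has room to spare: `τ |ā|² ≤ Y₀`
(`Y₀_ge`) and `|T ā - ā| ≤ Y₀ - τ |ā|² / 2` (`norm_newton_sub_le`). This makes `T` a contraction of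
the ball, with exactly one fixed point (`exists_unique_zero`).

At the zero `ã` itself the bound `|E(ã)| ≤ ε = Z₂ r + Z₁ + Z₀` holds. Either `|ã - ā| ≥ |ā|`, so
that the gain `2 τ |ã - ā|` outweighs `τ |ã|`, or `|ã - ā| < |ā|`; then `ã ≠ 0` and `0` are both
fixed points, whence `1 ≤ |E(ã / 2)|`, and this inequality together with the one for `T ã - T ā`
suffices (`radii_aux`). If `1 / ((K + 1)² - α)` exceeds `max (‖A^K‖, 1)`, then `0` lies in the
ball, so that uniqueness gives `ã = 0` and `E(ã)` is explicit (`norm_defect_le_of_unique_zero`).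

For the count of eigenvalues, `Dg(ã)` is joined to `A⁻¹` by a segment of operators `L_s`, each of
them the diagonal operator `α - k²` minus a bounded one (`pathOp`). If `L_s ξ = z ξ` with `z`
imaginary, then `(1 - z A) ξ = s E(ã) ξ`; the diagonalization of `A^K` bounds `(1 - z A)⁻¹` by
`‖Q‖ ‖Q⁻¹‖ μ₀`, and `ξ = 0` (`eq_zero_of_pathOp`). So no eigenvalue crosses the imaginary axis. To
avoid spectral projections of unbounded operators, `L_s` is reduced to a matrix: for large `n`, the
gaps `k² - j²`, `j ≤ n < k`, are so large that the Riccati equation for an `L_s`-invariant graph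
over the modes up to `n` is solved by a contraction (`exists_isInvGraph`). The generalized
eigenspaces in the closed right half-plane lie in that graph and are those of the matrix of `L_s` on it
(`IsInvGraph.hasExactlyUnstable`). This matrix depends continuously on `s`, and the number of roots
of its characteristic polynomial in the right half-plane is constant as no root meets the axis
(`unstableCount_eq_of_path`). At `s = 0` it is block diagonal with the eigenvalues `1 / λ_j` and
`α - k² < 0`, `K < k ≤ n` (`unstableCount_start`).
-/

namespace Fisher

/-! ### Estimates for convolutions in `ℓ¹_ν` -/

theorem weight_pos {ν : ℝ} (hν : 1 < ν) (k : ℕ) : 0 < weight ν k := by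
  unfold weight; split_ifs <;> positivity

theorem summable_weight {𝕜 : Type*} [RCLike 𝕜] {ν : ℝ} (hν : 1 < ν) {a : ℕ → 𝕜} :
    a ∈ ell1 𝕜 ν ↔ Summable fun k => weight ν k * ‖a k‖ := by
  have h0 : ∀ k, 0 ≤ ν ^ k := fun k => by positivity
  constructor
  · intro (h : Summable fun k => ν ^ k * ‖a k‖)
    refine Summable.of_nonneg_of_le (fun k => mul_nonneg (weight_pos hν k).le (norm_nonneg _))
      (fun k => ?_) (h.mul_left 2)
    rw [← mul_assoc]
    refine mul_le_mul_of_nonneg_right ?_ (norm_nonneg _)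
    unfold weight; split_ifs with hk
    · simp [hk]
    · rfl
  · intro h
    refine Summable.of_nonneg_of_le (fun k => mul_nonneg (h0 k) (norm_nonneg _)) (fun k => ?_) h
    refine mul_le_mul_of_nonneg_right ?_ (norm_nonneg _)
    unfold weight; split_ifs with hk
    · simp [hk]
    · nlinarith [h0 k]

/-- The norm `|a|_ν` as a sum over `ℤ` of the even extension of `a`. -/
theorem hasSum_int {𝕜 : Type*} [RCLike 𝕜] {ν : ℝ} {a : ℕ → 𝕜}
    (ha : a ∈ ell1 𝕜 ν) :
    HasSum (fun j : ℤ => ν ^ j.natAbs * ‖a j.natAbs‖) (ell1Norm ν a) := by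
  have h : Summable fun k => ν ^ k * ‖a k‖ := ha
  have h1 := HasSum.of_nat_of_neg (f := fun j : ℤ => ν ^ j.natAbs * ‖a j.natAbs‖)
    (by simpa using h.hasSum) (by simpa using h.hasSum)
  have h2 : ∀ k, weight ν k * ‖a k‖
      = 2 * (ν ^ k * ‖a k‖) - (if k = 0 then ‖a 0‖ else 0) := by
    intro k
    unfold weight; split_ifs with hk
    · simp [hk]; ring
    · ring
  refine (?_ : ell1Norm ν a = _) ▸ h1
  rw [ell1Norm, tsum_congr h2, Summable.tsum_sub (h.mul_left 2)
    (summable_of_ne_finset_zero (s := {0}) (fun b hb => by simp at hb; simp [hb])), tsum_mul_left, tsum_ite_eq]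
  simp; ring

theorem conv_natAbs {𝕜 : Type*} [RCLike 𝕜] (a b : ℕ → 𝕜) (k : ℤ) :
    conv a b k.natAbs = ∑' j : ℤ, a j.natAbs * b (k - j).natAbs := by
  unfold conv
  rcases Int.natAbs_eq k with h | h
  · rw [← h]
  · rw [← (Equiv.neg ℤ).tsum_eq]
    refine tsum_congr (fun j => ?_)
    have : ((k.natAbs : ℤ) - (Equiv.neg ℤ) j) = -(k - j) := by rw [Equiv.neg_apply]; omega
    rw [this, Int.natAbs_neg, Equiv.neg_apply, Int.natAbs_neg]

theorem summable_conv_int {𝕜 : Type*} [RCLike 𝕜] {ν : ℝ} (hν : 1 < ν) {a b : ℕ → 𝕜}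
    (ha : a ∈ ell1 𝕜 ν) (hb : b ∈ ell1 𝕜 ν) :
    Summable fun p : ℤ × ℤ => (ν ^ p.1.natAbs * ‖a p.1.natAbs‖) *
      (ν ^ p.2.natAbs * ‖b p.2.natAbs‖) :=
  (hasSum_int ha).summable.mul_of_nonneg (hasSum_int hb).summable
    (fun _ => by positivity) (fun _ => by positivity)

/-- The shear `(i, k) ↦ (i, k - i)` of `ℤ × ℤ`, which turns a sum over the plane into a sum of
convolutions. -/
def shear : ℤ × ℤ ≃ ℤ × ℤ where
  toFun p := (p.1, p.2 - p.1)
  invFun p := (p.1, p.1 + p.2)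
  left_inv p := by simp
  right_inv p := by simp

/-- Weighted sums of a convolution are dominated by sums over the plane: `G (i, j)` majorizes the
contribution of `a_i b_j` to the index `i + j`. -/
theorem conv_weighted_le {𝕜 : Type*} [RCLike 𝕜] (a b : ℕ → 𝕜)
    (θ : ℤ → ℝ) (hθ : ∀ k, 0 ≤ θ k) (G : ℤ × ℤ → ℝ) (hG : Summable G)
    (h : ∀ i j, θ (i + j) * (‖a i.natAbs‖ * ‖b j.natAbs‖) ≤ G (i, j)) :
    Summable (fun k : ℤ => θ k * ‖conv a b k.natAbs‖) ∧
      ∑' k : ℤ, θ k * ‖conv a b k.natAbs‖ ≤ ∑' p, G p := by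
  have hG' : Summable fun p : ℤ × ℤ => G (p.2, p.1 - p.2) :=
    (((Equiv.prodComm ℤ ℤ).trans shear).summable_iff (f := G)).mpr hG
  have hsum : ∑' p : ℤ × ℤ, G (p.2, p.1 - p.2) = ∑' p, G p :=
    ((Equiv.prodComm ℤ ℤ).trans shear).tsum_eq G
  have hf : ∀ k, Summable fun i : ℤ => G (i, k - i) := fun k => hG'.prod_factor k
  have hle : ∀ k, θ k * ‖conv a b k.natAbs‖ ≤ ∑' i : ℤ, G (i, k - i) := by
    intro k
    have e : θ k * ‖conv a b k.natAbs‖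
        = ‖∑' i : ℤ, ((θ k : ℝ) : 𝕜) * (a i.natAbs * b (k - i).natAbs)‖ := by
      rw [conv_natAbs, tsum_mul_left, norm_mul, RCLike.norm_ofReal, abs_of_nonneg (hθ k)]
    rw [e]
    refine tsum_of_norm_bounded (hf k).hasSum (fun i => ?_)
    have := h i (k - i)
    rw [norm_mul, norm_mul, RCLike.norm_ofReal, abs_of_nonneg (hθ k)]
    simpa using this
  have hs : Summable fun k => ∑' i : ℤ, G (i, k - i) := hG'.prod
  have h1 := Summable.of_nonneg_of_le (fun k => mul_nonneg (hθ k) (norm_nonneg _)) hle hs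
  refine ⟨h1, (h1.tsum_le_tsum hle hs).trans ?_⟩
  rw [← hsum, hG'.tsum_prod]

theorem pow_natAbs_add_le {ν : ℝ} (hν : 1 < ν) (i j : ℤ) :
    ν ^ (i + j).natAbs ≤ ν ^ i.natAbs * ν ^ j.natAbs := by
  rw [← pow_add]
  exact pow_le_pow_right₀ hν.le (Int.natAbs_add_le i j)

theorem conv_mem_and_norm_le {𝕜 : Type*} [RCLike 𝕜] {ν : ℝ} (hν : 1 < ν) {a b : ℕ → 𝕜}
    (ha : a ∈ ell1 𝕜 ν) (hb : b ∈ ell1 𝕜 ν) :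
    conv a b ∈ ell1 𝕜 ν ∧ ell1Norm ν (conv a b) ≤ ell1Norm ν a * ell1Norm ν b := by
  have h := conv_weighted_le a b (fun k => ν ^ k.natAbs) (fun k => by positivity) _
    (summable_conv_int hν ha hb) (fun i j => by
      have := mul_le_mul_of_nonneg_right (pow_natAbs_add_le hν i j)
        (by positivity : 0 ≤ ‖a i.natAbs‖ * ‖b j.natAbs‖)
      dsimp only
      linarith)
  have hm : conv a b ∈ ell1 𝕜 ν := by
    have := h.1.comp_injective (i := ((↑) : ℕ → ℤ)) Nat.cast_injective
    simp only [Function.comp_def, Int.natAbs_natCast] at this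
    exact this
  refine ⟨hm, ?_⟩
  rw [← (hasSum_int hm).tsum_eq, ← (hasSum_int ha).tsum_eq, ← (hasSum_int hb).tsum_eq]
  refine h.2.trans (le_of_eq ?_)
  exact ((hasSum_int ha).summable.tsum_mul_tsum (hasSum_int hb).summable
    (summable_conv_int hν ha hb)).symm

/-- If `c` vanishes up to index `K`, only half of the mass of `c ∗ b` can fall on the indices up
to `K`: the pairs `(n, m)` that contribute to an index `|n + m| ≤ K` have opposite signs, and by
the symmetry `m ↦ -m` these carry at most half of the total mass. -/
theorem conv_low_le {𝕜 : Type*} [RCLike 𝕜] {ν : ℝ} (hν : 1 < ν) {c b : ℕ → 𝕜} (K : ℕ)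
    (hc : c ∈ ell1 𝕜 ν) (hb : b ∈ ell1 𝕜 ν) (hcK : ∀ k ≤ K, c k = 0) :
    ell1Norm ν (fun k => if k ≤ K then conv c b k else 0)
      ≤ 1 / 2 * (ell1Norm ν c * ell1Norm ν b) := by
  have hS := summable_conv_int hν hc hb
  set F : ℤ × ℤ → ℝ := fun p => (ν ^ p.1.natAbs * ‖c p.1.natAbs‖) *
      (ν ^ p.2.natAbs * ‖b p.2.natAbs‖) with hF
  have hF0 : ∀ p, 0 ≤ F p := fun p => by positivity
  set G : ℤ × ℤ → ℝ := Set.indicator {p | p.1 * p.2 < 0} F with hG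
  have hGs : Summable G := hS.indicator _
  have h := conv_weighted_le c b (fun k => if k.natAbs ≤ K then ν ^ k.natAbs else 0)
    (fun k => by split_ifs <;> positivity) G hGs (fun i j => by
      by_cases hij : i * j < 0
      · rw [hG, Set.indicator_of_mem (by exact hij)]
        have := mul_le_mul_of_nonneg_right (pow_natAbs_add_le hν i j)
          (by positivity : 0 ≤ ‖c i.natAbs‖ * ‖b j.natAbs‖)
        split_ifs
        · simp only [hF]; linarith
        · rw [zero_mul]; exact hF0 _
      · rw [hG, Set.indicator_of_notMem (by exact hij)]
        split_ifs with hk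
        · have hi : i.natAbs ≤ K := by
            rcases lt_trichotomy i 0 with h1 | h1 | h1
            · have : j ≤ 0 := by by_contra! h2; exact hij (mul_neg_of_neg_of_pos h1 h2)
              omega
            · omega
            · have : 0 ≤ j := by by_contra! h2; exact hij (mul_neg_of_pos_of_neg h1 h2)
              omega
          simp [hcK _ hi]
        · simp)
  have hlow : (fun k => if k ≤ K then conv c b k else 0) ∈ ell1 𝕜 ν := by
    refine summable_of_ne_finset_zero (s := Finset.range (K + 1)) (fun k hk => ?_)
    simp only [Finset.mem_range, not_lt] at hk
    simp [show ¬ k ≤ K by omega]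
  have hsymm : ∑' p, G p = ∑' p, Set.indicator {p : ℤ × ℤ | 0 < p.1 * p.2} F p := by
    rw [← ((Equiv.refl ℤ).prodCongr (Equiv.neg ℤ)).tsum_eq]
    refine tsum_congr (fun p => ?_)
    simp [hG, hF, Set.indicator]
  have hsum : ∑' p, G p + ∑' p, Set.indicator {p : ℤ × ℤ | 0 < p.1 * p.2} F p ≤ ∑' p, F p := by
    rw [← hGs.tsum_add (hS.indicator _)]
    refine Summable.tsum_le_tsum (fun p => ?_) (hGs.add (hS.indicator _)) hS
    have := hF0 p
    simp only [hG, Set.indicator, Set.mem_ofPred_eq]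
    split_ifs <;> linarith
  rw [← (hasSum_int hlow).tsum_eq]
  have e : ∀ j : ℤ, ν ^ j.natAbs * ‖(if j.natAbs ≤ K then conv c b j.natAbs else 0 : 𝕜)‖
      = (if j.natAbs ≤ K then ν ^ j.natAbs else 0) * ‖conv c b j.natAbs‖ := by
    intro j; split_ifs <;> simp
  rw [tsum_congr e]
  refine h.2.trans ?_
  rw [← (hasSum_int hc).tsum_eq, ← (hasSum_int hb).tsum_eq,
    (hasSum_int hc).summable.tsum_mul_tsum (hasSum_int hb).summable hS]
  linarith

theorem conv_comm {𝕜 : Type*} [RCLike 𝕜] (a b : ℕ → 𝕜) : conv a b = conv b a := by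
  funext k
  unfold conv
  rw [← (Equiv.subLeft (k : ℤ)).tsum_eq]
  refine tsum_congr (fun j => ?_)
  simp [mul_comm]

theorem conv_assoc {𝕜 : Type*} [RCLike 𝕜] {ν : ℝ} (hν : 1 < ν) {a b c : ℕ → 𝕜}
    (ha : a ∈ ell1 𝕜 ν) (hb : b ∈ ell1 𝕜 ν) (hc : c ∈ ell1 𝕜 ν) :
    conv (conv a b) c = conv a (conv b c) := by
  funext k
  obtain ⟨C, hC⟩ := exists_bound hν hc
  have hs : Summable fun p : ℤ × ℤ =>
      a p.1.natAbs * b (p.2 - p.1).natAbs * c ((k : ℤ) - p.2).natAbs := by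
    have h1 : Summable fun p : ℤ × ℤ => ‖a p.1.natAbs‖ * ‖b p.2.natAbs‖ :=
      (summable_int hν ha).mul_of_nonneg (summable_int hν hb)
        (fun _ => norm_nonneg _) (fun _ => norm_nonneg _)
    have h2 : Summable fun p : ℤ × ℤ => ‖a p.1.natAbs‖ * ‖b (p.2 - p.1).natAbs‖ :=
      (shear.summable_iff (f := fun p : ℤ × ℤ => ‖a p.1.natAbs‖ * ‖b p.2.natAbs‖)).mpr h1
    refine Summable.of_norm_bounded (h2.mul_right C) (fun p => ?_)
    rw [norm_mul, norm_mul]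
    exact mul_le_mul_of_nonneg_left (hC _) (by positivity)
  have e1 : conv (conv a b) c k
      = ∑' (j : ℤ) (i : ℤ), a i.natAbs * b (j - i).natAbs * c ((k : ℤ) - j).natAbs := by
    rw [conv]
    refine tsum_congr (fun j => ?_)
    rw [conv_natAbs, tsum_mul_right]
  have e2 : conv a (conv b c) k
      = ∑' (i : ℤ) (j : ℤ), a i.natAbs * b (j - i).natAbs * c ((k : ℤ) - j).natAbs := by
    rw [conv]
    refine tsum_congr (fun i => ?_)
    rw [conv_natAbs, ← tsum_mul_left, ← (Equiv.subRight i).tsum_eq]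
    refine tsum_congr (fun j => ?_)
    simp [mul_assoc]
  rw [e1, e2]
  exact Summable.tsum_comm (f := fun (i j : ℤ) =>
    a i.natAbs * b (j - i).natAbs * c ((k : ℤ) - j).natAbs) hs

end Fisher

namespace Fisher

/-! ### The Banach algebra structure -/

/-- The space `ℓ¹_ν` as a Banach algebra: a synonym of `ell1 𝕜 ν`, with the norm `ell1Norm ν` and
with the convolution as multiplication. (The submodule itself carries the topology of pointwise
convergence.) -/
def Ell (𝕜 : Type*) [RCLike 𝕜] (ν : ℝ) : Type _ := ell1 𝕜 ν

namespace Ell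

variable {𝕜 : Type*} [RCLike 𝕜] {ν : ℝ}

instance : AddCommGroup (Ell 𝕜 ν) := inferInstanceAs (AddCommGroup (ell1 𝕜 ν))
instance : Module 𝕜 (Ell 𝕜 ν) := inferInstanceAs (Module 𝕜 (ell1 𝕜 ν))

instance : CoeFun (Ell 𝕜 ν) (fun _ => ℕ → 𝕜) := ⟨fun a => a.1⟩

/-- An element of `ℓ¹_ν` from a sequence. -/
def mk (a : ℕ → 𝕜) (ha : a ∈ ell1 𝕜 ν) : Ell 𝕜 ν := ⟨a, ha⟩

@[simp] theorem mk_apply (a : ℕ → 𝕜) (ha : a ∈ ell1 𝕜 ν) (k : ℕ) : (mk a ha) k = a k := rfl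

theorem mem (a : Ell 𝕜 ν) : (a : ℕ → 𝕜) ∈ ell1 𝕜 ν := a.2

@[ext] theorem ext {a b : Ell 𝕜 ν} (h : ∀ k, a k = b k) : a = b := Subtype.ext (funext h)

@[simp] theorem add_apply (a b : Ell 𝕜 ν) (k : ℕ) : (a + b) k = a k + b k := rfl
@[simp] theorem sub_apply (a b : Ell 𝕜 ν) (k : ℕ) : (a - b) k = a k - b k := rfl
@[simp] theorem neg_apply (a : Ell 𝕜 ν) (k : ℕ) : (-a) k = -a k := rfl
@[simp] theorem zero_apply (k : ℕ) : (0 : Ell 𝕜 ν) k = 0 := rfl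
@[simp] theorem smul_apply (t : 𝕜) (a : Ell 𝕜 ν) (k : ℕ) : (t • a) k = t * a k := rfl

theorem sum_apply {ι : Type*} (s : Finset ι) (f : ι → Ell 𝕜 ν) (k : ℕ) :
    (∑ i ∈ s, f i) k = ∑ i ∈ s, f i k := by
  classical
  induction s using Finset.induction_on with
  | empty => simp
  | insert i s hi ih => rw [Finset.sum_insert hi, Finset.sum_insert hi, add_apply, ih]

variable [hν : Fact (1 < ν)]

theorem hasSum_weight (a : Ell 𝕜 ν) : HasSum (fun k => weight ν k * ‖a k‖) (ell1Norm ν a) :=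
  ((summable_weight hν.out).mp a.mem).hasSum

noncomputable instance : NormedAddCommGroup (Ell 𝕜 ν) :=
  AddGroupNorm.toNormedAddCommGroup
    { toFun := fun a => ell1Norm ν a
      map_zero' := by simp [ell1Norm]
      add_le' := by
        intro a b
        have h := (hasSum_weight a).add (hasSum_weight b)
        refine hasSum_le (fun k => ?_) (hasSum_weight (a + b)) h
        rw [← mul_add]
        exact mul_le_mul_of_nonneg_left (norm_add_le _ _) (weight_pos hν.out k).le
      neg' := by intro a; simp [ell1Norm]
      eq_zero_of_map_eq_zero' := by
        intro a ha
        have h := hasSum_weight a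
        rw [show ell1Norm ν (a : ℕ → 𝕜) = 0 from ha, hasSum_zero_iff_of_nonneg
          (fun k => mul_nonneg (weight_pos hν.out k).le (norm_nonneg _))] at h
        ext k
        have := congrFun h k
        simpa [(weight_pos hν.out k).ne'] using this }

theorem norm_def (a : Ell 𝕜 ν) : ‖a‖ = ell1Norm ν a := rfl

theorem hasSum_norm (a : Ell 𝕜 ν) : HasSum (fun k => weight ν k * ‖a k‖) ‖a‖ := hasSum_weight a

theorem weight_mul_norm_le (a : Ell 𝕜 ν) (k : ℕ) : weight ν k * ‖a k‖ ≤ ‖a‖ :=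
  le_hasSum (hasSum_norm a) k
    (fun j _ => mul_nonneg (weight_pos hν.out j).le (norm_nonneg _))

theorem norm_le_mul_of_forall_le {a b : Ell 𝕜 ν} {C : ℝ} (h : ∀ k, ‖a k‖ ≤ C * ‖b k‖) :
    ‖a‖ ≤ C * ‖b‖ := by
  refine hasSum_le (fun k => ?_) (hasSum_norm a) ((hasSum_norm b).mul_left C)
  have := mul_le_mul_of_nonneg_left (h k) (weight_pos hν.out k).le
  linarith

noncomputable instance : NormedCommRing (Ell 𝕜 ν) where
  mul a b := mk (conv a b) (conv_mem_and_norm_le hν.out a.mem b.mem).1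
  one := mk (Pi.single 0 1) (summable_of_ne_finset_zero (s := {0})
    (fun k hk => by simp at hk; simp [hk]))
  left_distrib a b c := by
    obtain ⟨C, hC⟩ := exists_bound hν.out a.mem
    exact ext (conv_add hν.out hC b.mem c.mem)
  right_distrib a b c := by
    obtain ⟨C, hC⟩ := exists_bound hν.out c.mem
    refine ext fun k => ?_
    have := conv_add hν.out hC a.mem b.mem k
    rw [conv_comm, conv_comm (c : ℕ → 𝕜), conv_comm (c : ℕ → 𝕜)] at this
    exact this
  zero_mul a := ext fun k => show conv _ _ k = 0 by simp [conv]
  mul_zero a := ext fun k => show conv _ _ k = 0 by simp [conv]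
  mul_assoc a b c := ext (congrFun (conv_assoc hν.out a.mem b.mem c.mem))
  mul_comm a b := ext (congrFun (conv_comm _ _))
  one_mul a := ext fun k => by
    change conv (Pi.single 0 1) _ k = _
    rw [conv, tsum_eq_single 0]
    · simp
    · intro j hj; simp [hj]
  mul_one a := ext fun k => by
    change conv _ (Pi.single 0 1) k = _
    rw [conv_comm, conv, tsum_eq_single 0]
    · simp
    · intro j hj; simp [hj]
  dist_eq := fun a b => dist_eq_norm_neg_add a b
  norm_mul_le a b := (conv_mem_and_norm_le hν.out a.mem b.mem).2

@[simp] theorem mul_apply (a b : Ell 𝕜 ν) (k : ℕ) : (a * b) k = conv a b k := rfl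

theorem norm_smul' (t : 𝕜) (a : Ell 𝕜 ν) : ‖t • a‖ = ‖t‖ * ‖a‖ := by
  rw [norm_def, norm_def, ell1Norm, ell1Norm, ← tsum_mul_left]
  refine tsum_congr fun k => ?_
  rw [smul_apply, norm_mul]; ring

instance : NormedSpace 𝕜 (Ell 𝕜 ν) := ⟨fun t a => (norm_smul' t a).le⟩

instance : SMulCommClass 𝕜 (Ell 𝕜 ν) (Ell 𝕜 ν) :=
  ⟨fun t a b => ext fun k => (conv_smul a b t k).symm⟩

instance : IsScalarTower 𝕜 (Ell 𝕜 ν) (Ell 𝕜 ν) :=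
  ⟨fun t a b => by
    have h := smul_comm t b a
    simp only [smul_eq_mul] at h ⊢
    rw [mul_comm, ← h, mul_comm]⟩

/-- Rescaling by the weights identifies `ℓ¹_ν` with the unweighted `ℓ¹`. -/
noncomputable def toLp : Ell 𝕜 ν ≃ₗᵢ[𝕜] lp (fun _ : ℕ => 𝕜) 1 where
  toFun a := ⟨fun k => (weight ν k : 𝕜) * a k, memℓp_gen (by
    simpa [abs_of_pos (weight_pos hν.out _)] using (hasSum_norm a).summable)⟩
  map_add' a b := by ext k; exact mul_add _ _ _
  map_smul' t a := by ext k; exact mul_left_comm _ _ _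
  invFun x := mk (fun k => ((weight ν k)⁻¹ : 𝕜) * x k) ((summable_weight hν.out).mpr (by
    have h := (lp.memℓp x).summable (by simp)
    refine h.congr fun k => ?_
    have := weight_pos hν.out k
    simp [abs_of_pos this, this.ne']))
  left_inv a := by
    ext k
    have : (weight ν k : 𝕜) ≠ 0 := by exact_mod_cast (weight_pos hν.out k).ne'
    simp [this]
  right_inv x := by
    ext k
    have : (weight ν k : 𝕜) ≠ 0 := by exact_mod_cast (weight_pos hν.out k).ne'
    simp [this]
  norm_map' a := by
    rw [lp.norm_eq_tsum_rpow (by simp)]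
    simp [abs_of_pos (weight_pos hν.out _), norm_def, ell1Norm]

instance : CompleteSpace (Ell 𝕜 ν) :=
  (toLp (𝕜 := 𝕜) (ν := ν)).toIsometryEquiv.completeSpace

end Ell
end Fisher

namespace Fisher

namespace Ell

/-! ### Real elements, truncations and finite matrices -/

variable {𝕜 : Type*} [RCLike 𝕜] {ν : ℝ}

theorem mem_of_finite {a : ℕ → 𝕜} (K : ℕ) (h : ∀ k, K < k → a k = 0) : a ∈ ell1 𝕜 ν :=
  summable_of_ne_finset_zero (s := Finset.range (K + 1)) (fun k hk => by
    simp only [Finset.mem_range, not_lt] at hk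
    simp [h k hk])

theorem opNorm_nonneg {K : ℕ} (M : Matrix (Fin (K + 1)) (Fin (K + 1)) 𝕜) : 0 ≤ opNorm ν M :=
  Real.sInf_nonneg fun _ h => h.1

variable [hν : Fact (1 < ν)]

/-- The inclusion of real sequences into `ℓ¹_ν` over `𝕜`. -/
noncomputable def cast (𝕜 : Type*) [RCLike 𝕜] : Ell ℝ ν →+* Ell 𝕜 ν where
  toFun a := mk (fun k => (a k : 𝕜)) ((summable_weight hν.out).mpr (by
    simpa only [RCLike.norm_ofReal, Real.norm_eq_abs] using (hasSum_norm a).summable))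
  map_one' := ext fun k => by
    change ((Pi.single 0 1 : ℕ → ℝ) k : 𝕜) = (Pi.single 0 1 : ℕ → 𝕜) k
    rcases eq_or_ne k 0 with rfl | hk
    · simp
    · simp [hk]
  map_mul' a b := ext fun k => by
    change ((conv a b k : ℝ) : 𝕜) = conv _ _ k
    simp [conv, RCLike.ofReal_tsum]
  map_zero' := ext fun k => RCLike.ofReal_zero
  map_add' a b := ext fun k => RCLike.ofReal_add _ _

@[simp] theorem cast_apply (a : Ell ℝ ν) (k : ℕ) : cast 𝕜 a k = (a k : 𝕜) := rfl

@[simp] theorem norm_cast_eq (a : Ell ℝ ν) : ‖cast 𝕜 a‖ = ‖a‖ := by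
  simp [norm_def, ell1Norm]

/-- The truncation of a sequence to the indices up to `K`. -/
noncomputable def low (K : ℕ) : Ell 𝕜 ν →ₗ[𝕜] Ell 𝕜 ν where
  toFun a := mk (fun k => if k ≤ K then a k else 0) (mem_of_finite K fun k hk => by simp [hk])
  map_add' a b := ext fun k => by simp only [mk_apply, add_apply]; split_ifs <;> simp
  map_smul' t a := ext fun k => by
    simp only [mk_apply, smul_apply, RingHom.id_apply]; split_ifs <;> simp

theorem low_apply (K : ℕ) (a : Ell 𝕜 ν) (k : ℕ) : low K a k = if k ≤ K then a k else 0 := rfl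

theorem norm_low_add (K : ℕ) (a : Ell 𝕜 ν) : ‖low K a‖ + ‖a - low K a‖ = ‖a‖ := by
  refine ((hasSum_norm (low K a)).add (hasSum_norm (a - low K a))).unique ?_
  convert hasSum_norm a using 2 with k
  rw [sub_apply, low_apply]; split_ifs <;> simp

theorem norm_low_le (K : ℕ) (a : Ell 𝕜 ν) : ‖low K a‖ ≤ ‖a‖ := by
  have := norm_low_add K a; have := norm_nonneg (a - low K a); linarith

theorem cast_low (K : ℕ) (a : Ell ℝ ν) : cast 𝕜 (low K a) = low K (cast 𝕜 a) := by
  ext k; simp only [cast_apply, low_apply]; split_ifs <;> simp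

theorem norm_low_mul_le (K : ℕ) (c b : Ell 𝕜 ν) (hc : low K c = 0) :
    ‖low K (c * b)‖ ≤ 1 / 2 * (‖c‖ * ‖b‖) :=
  conv_low_le hν.out K c.mem b.mem (fun k hk => by
    have := congrArg (fun x : Ell 𝕜 ν => x k) hc
    simpa [low_apply, hk] using this)

/-- Vectors in `𝕜^{K+1}` as elements of `ℓ¹_ν`. -/
noncomputable def ofFin {K : ℕ} : (Fin (K + 1) → 𝕜) →ₗ[𝕜] Ell 𝕜 ν where
  toFun v := mk (incl v) (mem_of_finite K fun k hk => by simp [incl, show ¬ k < K + 1 by omega])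
  map_add' a b := ext fun k => by simp only [mk_apply, add_apply, incl]; split_ifs <;> simp
  map_smul' t a := ext fun k => by
    simp only [mk_apply, smul_apply, RingHom.id_apply, incl]; split_ifs <;> simp

theorem ofFin_apply {K : ℕ} (v : Fin (K + 1) → 𝕜) (k : ℕ) :
    (ofFin v : Ell 𝕜 ν) k = if hk : k < K + 1 then v ⟨k, hk⟩ else 0 := rfl

@[simp] theorem ofFin_apply_fin {K : ℕ} (v : Fin (K + 1) → 𝕜) (k : Fin (K + 1)) :
    (ofFin v : Ell 𝕜 ν) k = v k := by rw [ofFin_apply, dif_pos k.2]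

theorem ofFin_apply_of_lt {K : ℕ} (v : Fin (K + 1) → 𝕜) {k : ℕ} (hk : K < k) :
    (ofFin v : Ell 𝕜 ν) k = 0 := by simp [ofFin_apply, show ¬ k < K + 1 by omega]

theorem norm_ofFin {K : ℕ} (v : Fin (K + 1) → 𝕜) :
    ‖(ofFin v : Ell 𝕜 ν)‖ = ∑ j : Fin (K + 1), weight ν j * ‖v j‖ := by
  refine (hasSum_norm (ofFin v : Ell 𝕜 ν)).unique ?_
  have h : HasSum (fun k => weight ν k * ‖(ofFin v : Ell 𝕜 ν) k‖)
      (∑ k ∈ Finset.range (K + 1), weight ν k * ‖(ofFin v : Ell 𝕜 ν) k‖) :=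
    hasSum_sum_of_ne_finset_zero (fun k hk => by
      simp only [Finset.mem_range, not_lt] at hk
      simp [ofFin_apply_of_lt v hk])
  rw [Finset.sum_range] at h
  simpa using h

/-- The first `K + 1` entries of a sequence. -/
def res (K : ℕ) : Ell 𝕜 ν →ₗ[𝕜] (Fin (K + 1) → 𝕜) where
  toFun a j := a j
  map_add' _ _ := rfl
  map_smul' _ _ := rfl

@[simp] theorem res_apply {K : ℕ} (a : Ell 𝕜 ν) (j : Fin (K + 1)) : res K a j = a j := rfl

theorem ofFin_res (K : ℕ) (a : Ell 𝕜 ν) : ofFin (res K a) = low K a := by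
  ext k
  simp only [ofFin_apply, low_apply, res_apply, dite_eq_ite]
  simp

theorem res_ofFin {K : ℕ} (v : Fin (K + 1) → 𝕜) : res K (ofFin v : Ell 𝕜 ν) = v := by
  ext j; simp

theorem low_ofFin {K : ℕ} (v : Fin (K + 1) → 𝕜) : low K (ofFin v : Ell 𝕜 ν) = ofFin v := by
  rw [← ofFin_res, res_ofFin]

theorem res_low (K : ℕ) (a : Ell 𝕜 ν) : res K (low K a) = res K a := by
  rw [← ofFin_res, res_ofFin]

/-- The matrix `M` acting on the entries of index at most `K`; the other entries are dropped. -/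
noncomputable def matOp {K : ℕ} (M : Matrix (Fin (K + 1)) (Fin (K + 1)) 𝕜) :
    Ell 𝕜 ν →ₗ[𝕜] Ell 𝕜 ν := ofFin ∘ₗ M.mulVecLin ∘ₗ res K

theorem matOp_def {K : ℕ} (M : Matrix (Fin (K + 1)) (Fin (K + 1)) 𝕜) (a : Ell 𝕜 ν) :
    matOp M a = ofFin (M.mulVec (res K a)) := rfl

theorem matOp_low {K : ℕ} (M : Matrix (Fin (K + 1)) (Fin (K + 1)) 𝕜) (a : Ell 𝕜 ν) :
    matOp M (low K a) = matOp M a := by rw [matOp_def, res_low, ← matOp_def]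

theorem low_matOp {K : ℕ} (M : Matrix (Fin (K + 1)) (Fin (K + 1)) 𝕜) (a : Ell 𝕜 ν) :
    low K (matOp M a) = matOp M a := by rw [matOp_def, low_ofFin]

theorem matOp_mul {K : ℕ} (M M' : Matrix (Fin (K + 1)) (Fin (K + 1)) 𝕜) (a : Ell 𝕜 ν) :
    matOp (M * M') a = matOp M (matOp M' a) := by
  simp only [matOp_def, res_ofFin, Matrix.mulVec_mulVec]

theorem norm_mulVec_le {K : ℕ} {M : Matrix (Fin (K + 1)) (Fin (K + 1)) 𝕜} {C : ℝ}
    (h : ∀ j, ∑ i, weight ν (i : Fin (K + 1)) * ‖M i j‖ ≤ C * weight ν (j : Fin (K + 1)))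
    (v : Fin (K + 1) → 𝕜) :
    ‖(ofFin (M.mulVec v) : Ell 𝕜 ν)‖ ≤ C * ‖(ofFin v : Ell 𝕜 ν)‖ := by
  rw [norm_ofFin, norm_ofFin]
  calc ∑ i : Fin (K + 1), weight ν i * ‖M.mulVec v i‖
      ≤ ∑ i : Fin (K + 1), ∑ j, weight ν i * (‖M i j‖ * ‖v j‖) := by
        refine Finset.sum_le_sum fun i _ => ?_
        rw [← Finset.mul_sum]
        refine mul_le_mul_of_nonneg_left ?_ (weight_pos hν.out _).le
        refine (norm_sum_le Finset.univ fun j => M i j * v j).trans (le_of_eq ?_)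
        simp
    _ = ∑ j, (∑ i : Fin (K + 1), weight ν i * ‖M i j‖) * ‖v j‖ := by
        rw [Finset.sum_comm]
        refine Finset.sum_congr rfl fun j _ => ?_
        rw [Finset.sum_mul]
        exact Finset.sum_congr rfl fun i _ => by ring
    _ ≤ ∑ j, (C * weight ν (j : Fin (K + 1))) * ‖v j‖ :=
        Finset.sum_le_sum fun j _ => mul_le_mul_of_nonneg_right (h j) (norm_nonneg _)
    _ = _ := by rw [Finset.mul_sum]; exact Finset.sum_congr rfl fun j _ => by ring

/-- The set over which the operator norm of a matrix is an infimum is not empty. -/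
theorem opNorm_set_nonempty {K : ℕ} (M : Matrix (Fin (K + 1)) (Fin (K + 1)) 𝕜) :
    {C : ℝ | 0 ≤ C ∧ ∀ h : Fin (K + 1) → 𝕜,
      ell1Norm ν (incl (M.mulVec h)) ≤ C * ell1Norm ν (incl h)}.Nonempty := by
  have hw := fun k => weight_pos hν.out k
  have h0 : ∀ j, 0 ≤ (∑ i, weight ν (i : Fin (K + 1)) * ‖M i j‖) / weight ν (j : Fin (K + 1)) :=
    fun j => div_nonneg (Finset.sum_nonneg fun i _ => mul_nonneg (hw _).le (norm_nonneg _))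
      (hw _).le
  refine ⟨∑ j, (∑ i, weight ν (i : Fin (K + 1)) * ‖M i j‖) / weight ν (j : Fin (K + 1)),
    Finset.sum_nonneg fun j _ => h0 j, fun v => ?_⟩
  refine norm_mulVec_le (M := M) (fun j => ?_) v
  rw [← div_le_iff₀ (hw _)]
  exact Finset.single_le_sum (f := fun j => (∑ i, weight ν (i : Fin (K + 1)) * ‖M i j‖)
    / weight ν (j : Fin (K + 1))) (fun j _ => h0 j) (Finset.mem_univ j)

theorem col_le_opNorm {K : ℕ} (M : Matrix (Fin (K + 1)) (Fin (K + 1)) 𝕜) (j : Fin (K + 1)) :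
    ∑ i, weight ν (i : Fin (K + 1)) * ‖M i j‖ ≤ opNorm ν M * weight ν j := by
  have hw := weight_pos hν.out j
  rw [← div_le_iff₀ hw]
  refine le_csInf (opNorm_set_nonempty M) fun C hC => ?_
  rw [div_le_iff₀ hw]
  have h : ‖(ofFin (M.mulVec (Pi.single j 1)) : Ell 𝕜 ν)‖
      ≤ C * ‖(ofFin (Pi.single j 1) : Ell 𝕜 ν)‖ :=
    hC.2 (Pi.single j 1)
  have e : ∑ i : Fin (K + 1), weight ν i * ‖(Pi.single j 1 : Fin (K + 1) → 𝕜) i‖ = weight ν j := by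
    rw [Finset.sum_eq_single j (fun i _ hi => by simp [hi]) (by simp)]
    simp
  rw [norm_ofFin, norm_ofFin, e] at h
  simpa using h

theorem norm_matOp_le {K : ℕ} (M : Matrix (Fin (K + 1)) (Fin (K + 1)) 𝕜) (a : Ell 𝕜 ν) :
    ‖matOp M a‖ ≤ opNorm ν M * ‖low K a‖ := by
  rw [matOp_def, ← ofFin_res]
  exact norm_mulVec_le (col_le_opNorm M) _

/-- The weighted operator norm is a maximal column sum, hence the same over `ℝ` and over `ℂ`. -/
theorem norm_matOp_map_le {K : ℕ} (M : Matrix (Fin (K + 1)) (Fin (K + 1)) ℝ) (a : Ell 𝕜 ν) :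
    ‖matOp (M.map ((↑) : ℝ → 𝕜)) a‖ ≤ opNorm ν M * ‖low K a‖ := by
  rw [matOp_def, ← ofFin_res]
  exact norm_mulVec_le (fun j => by simpa using col_le_opNorm M j) _

/-- A bounded real multiplier acting on the entries of index larger than `K`. -/
noncomputable def tailOp (K : ℕ) {d : ℕ → ℝ} {b : ℝ} (hd : ∀ k, K < k → |d k| ≤ b) :
    Ell 𝕜 ν →ₗ[𝕜] Ell 𝕜 ν where
  toFun a := mk (fun k => if k ≤ K then 0 else (d k : 𝕜) * a k)
    ((summable_weight hν.out).mpr (by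
      refine Summable.of_nonneg_of_le (fun k => mul_nonneg (weight_pos hν.out k).le (norm_nonneg _))
        (fun k => ?_) ((hasSum_norm a).summable.mul_left |b|)
      rw [mul_left_comm]
      refine mul_le_mul_of_nonneg_left ?_ (weight_pos hν.out k).le
      split_ifs with hk
      · rw [norm_zero]; positivity
      · rw [norm_mul, RCLike.norm_ofReal]
        exact mul_le_mul_of_nonneg_right ((hd k (by omega)).trans (le_abs_self b))
          (norm_nonneg _)))
  map_add' a b := ext fun k => by simp only [mk_apply, add_apply]; split_ifs <;> simp [mul_add]
  map_smul' t a := ext fun k => by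
    simp only [mk_apply, smul_apply, RingHom.id_apply]; split_ifs <;> simp [mul_left_comm]

theorem tailOp_apply (K : ℕ) {d : ℕ → ℝ} {b : ℝ} (hd : ∀ k, K < k → |d k| ≤ b)
    (a : Ell 𝕜 ν) (k : ℕ) : tailOp K hd a k = if k ≤ K then 0 else (d k : 𝕜) * a k := rfl

theorem norm_tailOp_le (K : ℕ) {d : ℕ → ℝ} {b : ℝ} (hd : ∀ k, K < k → |d k| ≤ b)
    (a : Ell 𝕜 ν) : ‖tailOp K hd a‖ ≤ b * ‖a - low K a‖ := by
  refine norm_le_mul_of_forall_le fun k => ?_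
  rw [tailOp_apply, sub_apply, low_apply]
  split_ifs with hk
  · simp
  · rw [norm_mul, RCLike.norm_ofReal, sub_zero]
    exact mul_le_mul_of_nonneg_right (hd k (by omega)) (norm_nonneg _)

theorem low_tailOp (K : ℕ) {d : ℕ → ℝ} {b : ℝ} (hd : ∀ k, K < k → |d k| ≤ b)
    (a : Ell 𝕜 ν) : low K (tailOp K hd a) = 0 := by
  ext k
  rw [low_apply, tailOp_apply]; split_ifs <;> simp

end Ell
end Fisher

namespace Fisher

namespace Ell

variable {𝕜 : Type*} [RCLike 𝕜] {ν : ℝ} [hν : Fact (1 < ν)]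

/-! ### The approximate inverse and its defect -/

theorem abs_inv_tail_le {α : ℝ} {K : ℕ} (hαK : α < ((K : ℝ) + 1) ^ 2) (k : ℕ) (hk : K < k) :
    |(α - (k : ℝ) ^ 2)⁻¹| ≤ 1 / (((K : ℝ) + 1) ^ 2 - α) := by
  have h1 : (K : ℝ) + 1 ≤ k := by exact_mod_cast hk
  have h2 : ((K : ℝ) + 1) ^ 2 ≤ (k : ℝ) ^ 2 := pow_le_pow_left₀ (by positivity) h1 2
  rw [abs_inv, abs_of_neg (by linarith), ← one_div]
  exact one_div_le_one_div_of_le (by linarith) (by linarith)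

/-- The linear part of `g`, restricted to the modes up to `K`. -/
def lamMat (α : ℝ) (K : ℕ) : Matrix (Fin (K + 1)) (Fin (K + 1)) ℝ :=
  Matrix.diagonal fun k => α - (k : ℝ) ^ 2

/-- The approximate inverse `A` of the linearization at `ā`: the matrix `A^K` on the modes up to
`K`, and the inverse of the linear part of `g` on the others. -/
noncomputable def approxInv {α : ℝ} {K : ℕ} (hαK : α < ((K : ℝ) + 1) ^ 2)
    (AK : Matrix (Fin (K + 1)) (Fin (K + 1)) ℝ) : Ell 𝕜 ν →ₗ[𝕜] Ell 𝕜 ν :=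
  matOp (AK.map ((↑) : ℝ → 𝕜)) + tailOp K (abs_inv_tail_le hαK)

/-- The defect `1 - A Dg(x)`, written without the unbounded operator `Dg(x)`. -/
noncomputable def defect {α : ℝ} {K : ℕ} (hαK : α < ((K : ℝ) + 1) ^ 2)
    (AK : Matrix (Fin (K + 1)) (Fin (K + 1)) ℝ) (c x : Ell ℝ ν) (h : Ell 𝕜 ν) : Ell 𝕜 ν :=
  matOp ((1 - AK * lamMat α K).map ((↑) : ℝ → 𝕜)) h
    + ((2 * α : ℝ) : 𝕜) • approxInv hαK AK (cast 𝕜 (c * x) * h)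

theorem low_approxInv {α : ℝ} {K : ℕ} (hαK : α < ((K : ℝ) + 1) ^ 2)
    (AK : Matrix (Fin (K + 1)) (Fin (K + 1)) ℝ) (h : Ell 𝕜 ν) :
    low K (approxInv hαK AK h) = matOp (AK.map ((↑) : ℝ → 𝕜)) h := by
  rw [approxInv, LinearMap.add_apply, map_add, low_matOp, low_tailOp, add_zero]

theorem cast_ofFin {K : ℕ} (v : Fin (K + 1) → ℝ) :
    cast 𝕜 (ofFin v : Ell ℝ ν) = ofFin fun j => (v j : 𝕜) := by
  ext k; simp only [cast_apply, ofFin_apply]; split_ifs <;> simp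

theorem mul_ofFin_apply {K : ℕ} (b : Ell 𝕜 ν) (v : Fin (K + 1) → 𝕜) (k : ℕ) :
    (b * ofFin v : Ell 𝕜 ν) k
      = ∑ j, (b * ofFin (Pi.single j 1 : Fin (K + 1) → 𝕜) : Ell 𝕜 ν) k * v j := by
  have e : v = ∑ j, v j • (Pi.single j 1 : Fin (K + 1) → 𝕜) := by
    ext i; simp [Finset.sum_apply, Pi.single_apply]
  conv_lhs => rw [e, map_sum, Finset.mul_sum, sum_apply]
  refine Finset.sum_congr rfl fun j _ => ?_
  rw [map_smul, mul_smul_comm, smul_apply, mul_comm]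

theorem matOp_DgK {K : ℕ} (α : ℝ) (c : Ell ℝ ν) (abar : Fin (K + 1) → ℝ) (h : Ell 𝕜 ν) :
    matOp ((DgK α c abar).map ((↑) : ℝ → 𝕜)) h
      = matOp ((lamMat α K).map ((↑) : ℝ → 𝕜)) h
        - ((2 * α : ℝ) : 𝕜) • low K (cast 𝕜 (low K c * ofFin abar) * low K h) := by
  rw [matOp_def, matOp_def, ← ofFin_res K (_ * _), ← map_smul, ← map_sub]
  congr 1
  ext k
  set b : Ell ℝ ν := low K c * ofFin abar with hb
  have e : ∀ j : Fin (K + 1), DgK α c abar k j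
      = lamMat α K k j - 2 * α * (b * ofFin (Pi.single j 1 : Fin (K + 1) → ℝ) : Ell ℝ ν) k := by
    intro j
    change (α - (k : ℝ) ^ 2) * (Pi.single j 1 : Fin (K + 1) → ℝ) k - _ = _
    rw [lamMat, Matrix.diagonal_apply, Pi.single_apply, mul_ite, mul_one, mul_zero]
    rfl
  have e2 : ∀ j : Fin (K + 1), (((b * ofFin (Pi.single j 1 : Fin (K + 1) → ℝ) : Ell ℝ ν) k : ℝ) : 𝕜)
      = (cast 𝕜 b * ofFin (Pi.single j 1 : Fin (K + 1) → 𝕜) : Ell 𝕜 ν) k := by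
    intro j
    have h1 : (fun i => (((Pi.single j 1 : Fin (K + 1) → ℝ) i : ℝ) : 𝕜)) = Pi.single j 1 := by
      ext i
      by_cases hi : i = j
      · subst hi; simp
      · simp [hi]
    rw [← cast_apply (𝕜 := 𝕜), map_mul, cast_ofFin, h1]
  rw [← ofFin_res K h]
  change ∑ j, ((DgK α c abar k j : ℝ) : 𝕜) * res K h j
    = ∑ j, ((lamMat α K k j : ℝ) : 𝕜) * res K h j
      - ((2 * α : ℝ) : 𝕜) * (cast 𝕜 b * ofFin (res K h) : Ell 𝕜 ν) k
  rw [mul_ofFin_apply, Finset.mul_sum, ← Finset.sum_sub_distrib]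
  refine Finset.sum_congr rfl fun j _ => ?_
  rw [e, RCLike.ofReal_sub, RCLike.ofReal_mul, e2]
  ring

/-- The defect on the modes up to `K` with `Dg^K(ā)` in place of the linear part of `g`, as `Z₀`
needs it. -/
theorem matOp_one_sub {K : ℕ} (α : ℝ) (AK : Matrix (Fin (K + 1)) (Fin (K + 1)) ℝ)
    (c : Ell ℝ ν) (abar : Fin (K + 1) → ℝ) (h : Ell 𝕜 ν) :
    matOp ((1 - AK * lamMat α K).map ((↑) : ℝ → 𝕜)) h
      = matOp ((1 - AK * DgK α c abar).map ((↑) : ℝ → 𝕜)) h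
        - ((2 * α : ℝ) : 𝕜) • matOp (AK.map ((↑) : ℝ → 𝕜))
          (cast 𝕜 (low K c * ofFin abar) * low K h) := by
  have e : ∀ M : Matrix (Fin (K + 1)) (Fin (K + 1)) ℝ,
      matOp ((1 - AK * M).map ((↑) : ℝ → 𝕜)) h
      = low K h - matOp (AK.map ((↑) : ℝ → 𝕜)) (matOp (M.map ((↑) : ℝ → 𝕜)) h) := by
    intro M
    have : (1 - AK * M).map ((↑) : ℝ → 𝕜)
        = 1 - AK.map ((↑) : ℝ → 𝕜) * M.map ((↑) : ℝ → 𝕜) := by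
      have h1 := Matrix.map_mul (L := AK) (M := M) (f := (algebraMap ℝ 𝕜))
      ext i j
      have h2 := congrFun (congrFun h1 i) j
      simp only [Matrix.map_apply, RCLike.algebraMap_eq_ofReal] at h2
      rw [Matrix.map_apply, Matrix.sub_apply, RCLike.ofReal_sub, Matrix.sub_apply, h2]
      congr 1
      simp only [Matrix.one_apply]; split_ifs <;> simp
    rw [this, ← matOp_mul, ← ofFin_res]
    simp only [matOp_def, Matrix.sub_mulVec, Matrix.one_mulVec, map_sub]
  rw [e, e, matOp_DgK, map_sub, map_smul, matOp_low]
  abel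

/-- The products of two sequences that are supported on the indices up to `p` and up to `q`. -/
theorem mul_apply_eq_zero {a b : Ell 𝕜 ν} {p q k : ℕ} (ha : ∀ j, p < j → a j = 0)
    (hb : ∀ j, q < j → b j = 0) (hk : p + q < k) : (a * b : Ell 𝕜 ν) k = 0 := by
  rw [mul_apply, conv]
  refine (tsum_congr fun j => ?_).trans tsum_zero
  rcases le_or_gt j.natAbs p with h | h
  · rw [hb _ (by omega), mul_zero]
  · rw [ha _ h, zero_mul]

theorem β_nonneg {K : ℕ} (c : Ell ℝ ν) (abar : Fin (K + 1) → ℝ) (k : ℕ) :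
    0 ≤ β ν c abar k := by
  have h : ∀ j : ℕ, 0 ≤ 2 * ν ^ j := fun j =>
    mul_nonneg zero_le_two (pow_nonneg (zero_lt_one.trans hν.out).le j)
  exact add_nonneg (Real.iSup_nonneg fun _ => div_nonneg (abs_nonneg _) (h _))
    (Real.iSup_nonneg fun _ => div_nonneg (abs_nonneg _) (h _))

/-- The bound that defines `β_k`: it controls the entry of index `k ≤ K` of the product of
`c^K ∗ ā` with a sequence that vanishes up to index `K`. -/
theorem norm_mul_apply_le_β {K : ℕ} (c : Ell ℝ ν) (abar : Fin (K + 1) → ℝ) (y : Ell 𝕜 ν)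
    (hy : ∀ j ≤ K, y j = 0) {k : ℕ} (hk : k ≤ K) :
    ‖(cast 𝕜 (low K c * ofFin abar) * y : Ell 𝕜 ν) k‖ ≤ β ν c abar k * ‖y‖ := by
  set b : Ell ℝ ν := low K c * ofFin abar with hb
  have hb0 : ∀ j, 2 * K < j → b j = 0 := fun j hj => by
    refine mul_apply_eq_zero (p := K) (q := K) (fun i hi => ?_) (fun i hi => ?_) (by omega)
    · rw [low_apply, if_neg (by omega)]
    · rw [ofFin_apply_of_lt _ hi]
  have hν0 : (0 : ℝ) < ν := zero_lt_one.trans hν.out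
  set β₁ : ℝ := ⨆ j : {j : ℕ // j ∈ Finset.Icc (K + 1) (2 * K - k)},
      |b (j.1 + k)| / (2 * ν ^ j.1) with hβ₁
  set β₂ : ℝ := ⨆ j : {j : ℕ // j ∈ Finset.Icc (K + 1) (2 * K + k)},
      |b (j.1 - k)| / (2 * ν ^ j.1) with hβ₂
  have hβ : β ν c abar k = β₁ + β₂ := rfl
  have h₁ : ∀ j, K < j → |b (j + k)| ≤ β₁ * (2 * ν ^ j) := by
    intro j hj
    by_cases hjk : j ∈ Finset.Icc (K + 1) (2 * K - k)
    · rw [← div_le_iff₀ (by positivity)]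
      exact le_ciSup (f := fun j : {j : ℕ // j ∈ Finset.Icc (K + 1) (2 * K - k)} =>
        |b (j.1 + k)| / (2 * ν ^ j.1)) (Set.finite_range _).bddAbove ⟨j, hjk⟩
    · rw [Finset.mem_Icc] at hjk
      rw [hb0 _ (by omega), abs_zero]
      exact mul_nonneg (Real.iSup_nonneg fun _ => by positivity) (by positivity)
  have h₂ : ∀ j, K < j → |b (j - k)| ≤ β₂ * (2 * ν ^ j) := by
    intro j hj
    by_cases hjk : j ∈ Finset.Icc (K + 1) (2 * K + k)
    · rw [← div_le_iff₀ (by positivity)]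
      exact le_ciSup (f := fun j : {j : ℕ // j ∈ Finset.Icc (K + 1) (2 * K + k)} =>
        |b (j.1 - k)| / (2 * ν ^ j.1)) (Set.finite_range _).bddAbove ⟨j, hjk⟩
    · rw [Finset.mem_Icc] at hjk
      rw [hb0 _ (by omega), abs_zero]
      exact mul_nonneg (Real.iSup_nonneg fun _ => by positivity) (by positivity)
  have hF : HasSum (fun j : ℤ => ν ^ j.natAbs * ‖y j.natAbs‖) ‖y‖ := hasSum_int y.mem
  -- the even extension of `y` has half of its mass `‖y‖` on each side of zero; on the positive side
  -- `b` has the index `j - k`, on the negative side `|j| + k`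
  set θ : ℤ → ℝ := fun j => if 0 < j then β₂ else β₁ with hθ
  set F : ℤ → ℝ := fun j => 2 * θ j * (ν ^ j.natAbs * ‖y j.natAbs‖) with hFd
  have hFs : Summable F := by
    refine Summable.of_norm_bounded (hF.summable.mul_left (2 * (|β₁| + |β₂|))) fun j => ?_
    rw [hFd, Real.norm_eq_abs, abs_mul, abs_of_nonneg (a := ν ^ j.natAbs * ‖y j.natAbs‖)
      (by positivity)]
    refine mul_le_mul_of_nonneg_right ?_ (by positivity)
    rw [abs_mul, abs_two, hθ]
    have := abs_nonneg β₁
    have := abs_nonneg β₂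
    dsimp only
    split_ifs <;> linarith
  have hsum : ∑' j, F j = (β₁ + β₂) * ‖y‖ := by
    have h1 : ∑' j, F (-j) = ∑' j, F j := (Equiv.neg ℤ).tsum_eq F
    have hFs' : Summable fun j => F (-j) := (Equiv.neg ℤ).summable_iff.mpr hFs
    have h2 : ∑' j, (F j + F (-j)) = 2 * ((β₁ + β₂) * ‖y‖) := by
      rw [← hF.tsum_eq, ← tsum_mul_left, ← tsum_mul_left]
      refine tsum_congr fun j => ?_
      rcases lt_trichotomy j 0 with hj | hj | hj
      · simp only [hFd, hθ, Int.natAbs_neg, if_neg hj.not_gt, if_pos (neg_pos.mpr hj)]; ring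
      · subst hj; simp [hFd, hy 0 (Nat.zero_le _)]
      · simp only [hFd, hθ, Int.natAbs_neg, if_pos hj, if_neg (neg_neg_of_pos hj).not_gt]; ring
    rw [hFs.tsum_add hFs', h1] at h2
    linarith
  rw [mul_comm, mul_apply, conv, hβ, ← hsum]
  refine tsum_of_norm_bounded hFs.hasSum fun j => ?_
  rw [norm_mul, cast_apply, RCLike.norm_ofReal]
  rcases le_or_gt j.natAbs K with hj | hj
  · simp [hFd, hy _ hj]
  · have h0 := norm_nonneg (y j.natAbs)
    rcases lt_or_ge 0 j with hj0 | hj0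
    · have := mul_le_mul_of_nonneg_left (h₂ _ hj) h0
      rw [show ((k : ℤ) - j).natAbs = j.natAbs - k by omega]
      simp only [hFd, hθ, if_pos hj0]
      linarith
    · have := mul_le_mul_of_nonneg_left (h₁ _ hj) h0
      rw [show ((k : ℤ) - j).natAbs = j.natAbs + k by omega]
      simp only [hFd, hθ, if_neg hj0.not_gt]
      linarith

/-- The part of the defect that the sums with `β_k` in `Z₁` bound. -/
theorem norm_matOp_mul_le {K : ℕ} (AK : Matrix (Fin (K + 1)) (Fin (K + 1)) ℝ) (c : Ell ℝ ν)
    (abar : Fin (K + 1) → ℝ) (y : Ell 𝕜 ν) (hy : ∀ j ≤ K, y j = 0) :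
    ‖matOp (AK.map ((↑) : ℝ → 𝕜)) (cast 𝕜 (low K c * ofFin abar) * y)‖
      ≤ (∑ n : Fin (K + 1), weight ν n * ∑ k : Fin (K + 1), |AK n k| * β ν c abar k) * ‖y‖ := by
  rw [matOp_def, norm_ofFin, Finset.sum_mul]
  refine Finset.sum_le_sum fun n _ => ?_
  rw [mul_assoc]
  refine mul_le_mul_of_nonneg_left ?_ (weight_pos hν.out _).le
  rw [Finset.sum_mul]
  refine (norm_sum_le Finset.univ fun k : Fin (K + 1) => AK.map ((↑) : ℝ → 𝕜) n k *
    (cast 𝕜 (low K c * ofFin abar) * y : Ell 𝕜 ν) k).trans (Finset.sum_le_sum fun k _ => ?_)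
  rw [norm_mul, Matrix.map_apply, RCLike.norm_ofReal, mul_assoc]
  exact mul_le_mul_of_nonneg_left (norm_mul_apply_le_β c abar y hy (Nat.lt_succ_iff.mp k.2))
    (abs_nonneg _)

end Ell
end Fisher

namespace Fisher

namespace Ell

variable {𝕜 : Type*} [RCLike 𝕜] {ν : ℝ} [hν : Fact (1 < ν)]

/-! ### The bounds of the radii polynomial -/

/-- The contribution to the defect of the product of `c^∞` with `ā`, beyond what `Z₁` accounts
for: `Z₁` contains this product with the factor `1 / ((K + 1)² - α)` only, while on the modes up
to `K` it is multiplied by `A^K`. -/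
noncomputable def excess {K : ℕ} (α : ℝ) (AK : Matrix (Fin (K + 1)) (Fin (K + 1)) ℝ)
    (c : Ell ℝ ν) : ℝ :=
  α * max (opNorm ν AK - 1 / (((K : ℝ) + 1) ^ 2 - α)) 0 * ‖c - low K c‖

theorem Z₁_eq {K : ℕ} (α : ℝ) (c : Ell ℝ ν) (abar : Fin (K + 1) → ℝ)
    (AK : Matrix (Fin (K + 1)) (Fin (K + 1)) ℝ) :
    Z₁ ν α c abar AK
      = 2 * α * (∑ n : Fin (K + 1), weight ν n * ∑ k : Fin (K + 1), |AK n k| * β ν c abar k)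
        + 2 * α * (1 / (((K : ℝ) + 1) ^ 2 - α)) * (‖c‖ * ‖(ofFin abar : Ell ℝ ν)‖) := by
  have e : ∀ n : Fin K, weight ν (n.succ : Fin (K + 1)) = 2 * ν ^ ((n : ℕ) + 1) := by
    intro n; simp [weight]
  have e0 : weight ν ((0 : Fin (K + 1)) : ℕ) = 1 := by simp [weight]
  rw [Z₁, Fin.sum_univ_succ (fun n : Fin (K + 1) =>
    weight ν n * ∑ k : Fin (K + 1), |AK n k| * β ν c abar k), e0, norm_def, norm_def]
  simp only [e]
  rw [show ∀ f : Fin K → ℝ, ∑ n : Fin K, 2 * ν ^ ((n : ℕ) + 1) * f n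
    = 2 * ∑ n : Fin K, f n * ν ^ ((n : ℕ) + 1) from fun f => by
      rw [Finset.mul_sum]; exact Finset.sum_congr rfl fun n _ => by ring]
  change _ + _ * ell1Norm ν (ofFin abar : Ell ℝ ν) = _
  ring

theorem rowSum_nonneg {K : ℕ} (AK : Matrix (Fin (K + 1)) (Fin (K + 1)) ℝ) (c : Ell ℝ ν)
    (abar : Fin (K + 1) → ℝ) :
    0 ≤ ∑ n : Fin (K + 1), weight ν n * ∑ k : Fin (K + 1), |AK n k| * β ν c abar k :=
  Finset.sum_nonneg fun _ _ => mul_nonneg (weight_pos hν.out _).le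
    (Finset.sum_nonneg fun k _ => mul_nonneg (abs_nonneg _) (β_nonneg c abar k))

theorem le_Z₁ {K : ℕ} {α : ℝ} (hα : 0 < α) (c : Ell ℝ ν) (abar : Fin (K + 1) → ℝ)
    (AK : Matrix (Fin (K + 1)) (Fin (K + 1)) ℝ) :
    2 * α * (1 / (((K : ℝ) + 1) ^ 2 - α)) * (‖c‖ * ‖(ofFin abar : Ell ℝ ν)‖)
      ≤ Z₁ ν α c abar AK := by
  have h := rowSum_nonneg AK c abar
  rw [Z₁_eq]
  exact le_add_of_nonneg_left (by positivity)

theorem Z₁_nonneg {K : ℕ} {α : ℝ} (hα : 0 < α) (hαK : α < ((K : ℝ) + 1) ^ 2) (c : Ell ℝ ν)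
    (abar : Fin (K + 1) → ℝ) (AK : Matrix (Fin (K + 1)) (Fin (K + 1)) ℝ) :
    0 ≤ Z₁ ν α c abar AK := by
  refine le_trans ?_ (le_Z₁ hα c abar AK)
  have : 0 ≤ 1 / (((K : ℝ) + 1) ^ 2 - α) := one_div_nonneg.mpr (by linarith)
  positivity

theorem low_sub_low (K : ℕ) (c : Ell 𝕜 ν) : low K (c - low K c) = 0 := by
  ext k; rw [low_apply, sub_apply, low_apply]; split_ifs <;> simp

theorem norm_cast_mul_le (u : Ell ℝ ν) (h : Ell 𝕜 ν) : ‖cast 𝕜 u * h‖ ≤ ‖u‖ * ‖h‖ := by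
  simpa using norm_mul_le (cast 𝕜 u) h

/-- The half-mass estimate applied to `c^∞`. -/
theorem norm_low_tail_mul_le (K : ℕ) (c x : Ell ℝ ν) (h : Ell 𝕜 ν) :
    ‖low K (cast 𝕜 ((c - low K c) * x) * h)‖ ≤ 1 / 2 * (‖c - low K c‖ * (‖x‖ * ‖h‖)) := by
  rw [map_mul (cast 𝕜), mul_assoc]
  refine (norm_low_mul_le K _ _ (by rw [← cast_low, low_sub_low, map_zero])).trans ?_
  rw [norm_cast_eq]
  have := mul_le_mul_of_nonneg_left (norm_cast_mul_le x h) (norm_nonneg (c - low K c))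
  linarith

/-- The decomposition of the defect into the parts that the constants control. -/
theorem defect_eq {α : ℝ} {K : ℕ} (hαK : α < ((K : ℝ) + 1) ^ 2)
    (AK : Matrix (Fin (K + 1)) (Fin (K + 1)) ℝ) (c x : Ell ℝ ν) (abar : Fin (K + 1) → ℝ)
    (h : Ell 𝕜 ν) :
    defect hαK AK c x h = matOp ((1 - AK * DgK α c abar).map ((↑) : ℝ → 𝕜)) h
      + ((2 * α : ℝ) : 𝕜) • (matOp (AK.map ((↑) : ℝ → 𝕜))
          (cast 𝕜 (low K c * ofFin abar) * (h - low K h))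
        + matOp (AK.map ((↑) : ℝ → 𝕜)) (cast 𝕜 (low K c * (x - ofFin abar)) * h)
        + matOp (AK.map ((↑) : ℝ → 𝕜)) (cast 𝕜 ((c - low K c) * x) * h)
        + tailOp K (abs_inv_tail_le hαK) (cast 𝕜 (c * x) * h)) := by
  have e : cast 𝕜 (c * x) * h = cast 𝕜 (low K c * ofFin abar) * low K h
      + cast 𝕜 (low K c * ofFin abar) * (h - low K h)
      + cast 𝕜 (low K c * (x - ofFin abar)) * h + cast 𝕜 ((c - low K c) * x) * h := by
    simp only [map_mul, map_sub]; ring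
  rw [defect, matOp_one_sub α AK c abar, approxInv, LinearMap.add_apply]
  conv_lhs => rw [show matOp (AK.map ((↑) : ℝ → 𝕜)) (cast 𝕜 (c * x) * h) = _ from by
    rw [e, map_add, map_add, map_add]]
  simp only [smul_add]
  abel

/-- The basic bound of the defect. On the modes up to `K` the norm of `A^K` is split as
`1 / ((K + 1)² - α)` plus a rest: the first part is what `Z₁` accounts for, and the rest acts on at
most half of the mass of `c^∞ ∗ x ∗ h`, which yields the term with `excess`. -/
theorem norm_defect_le {α : ℝ} (hα : 0 < α) {K : ℕ} (hαK : α < ((K : ℝ) + 1) ^ 2)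
    (AK : Matrix (Fin (K + 1)) (Fin (K + 1)) ℝ) (c x : Ell ℝ ν) (abar : Fin (K + 1) → ℝ)
    (hb : 1 / (((K : ℝ) + 1) ^ 2 - α) ≤ max (opNorm ν AK) 1) (h : Ell 𝕜 ν) :
    ‖defect hαK AK c x h‖ ≤ (Z₀ ν α c abar AK + Z₁ ν α c abar AK
      + (Z₂ ν α c AK - 2 * excess α AK c) * ‖x - ofFin abar‖ + excess α AK c * ‖x‖) * ‖h‖ := by
  rw [defect_eq hαK AK c x abar, Z₁_eq, excess, Z₂]
  set b : ℝ := 1 / (((K : ℝ) + 1) ^ 2 - α) with hbd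
  have hb0 : 0 ≤ b := one_div_nonneg.mpr (by linarith)
  set a : ℝ := opNorm ν AK with ha
  have ha0 : 0 ≤ a := opNorm_nonneg AK
  set s : ℝ := max (a - b) 0 with hs
  have hs0 : 0 ≤ s := le_max_right _ _
  have has : a ≤ b + s := by have := le_max_left (a - b) 0; linarith
  have hbs : b + s ≤ max a 1 := by
    rcases max_cases (a - b) 0 with h1 | h1
    · rw [hs, h1.1]; have := le_max_left a 1; linarith
    · rw [hs, h1.1]; linarith
  set Bs : ℝ := ∑ n : Fin (K + 1), weight ν n * ∑ k : Fin (K + 1), |AK n k| * β ν c abar k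
  set M : Ell 𝕜 ν →ₗ[𝕜] Ell 𝕜 ν := matOp (AK.map ((↑) : ℝ → 𝕜)) with hM
  set y₁ : Ell 𝕜 ν := cast 𝕜 (low K c * (x - ofFin abar)) * h with hy₁
  set y₂ : Ell 𝕜 ν := cast 𝕜 (low K c * ofFin abar) * h with hy₂
  set y₃ : Ell 𝕜 ν := cast 𝕜 ((c - low K c) * x) * h with hy₃
  set N := ‖(ofFin abar : Ell ℝ ν)‖
  set δ := ‖x - ofFin abar‖ with hδ
  set κ := ‖low K c‖
  set γ := ‖c - low K c‖
  have hκ0 : 0 ≤ κ := norm_nonneg _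
  have hγ0 : 0 ≤ γ := norm_nonneg _
  have hδ0 : 0 ≤ δ := norm_nonneg _
  have hH0 : 0 ≤ ‖h‖ := norm_nonneg _
  have hc : κ + γ = ‖c‖ := norm_low_add K c
  have hX : ‖x‖ ≤ N + δ := by
    have := norm_add_le (ofFin abar : Ell ℝ ν) (x - ofFin abar)
    rwa [add_sub_cancel] at this
  have n1 : ‖matOp ((1 - AK * DgK α c abar).map ((↑) : ℝ → 𝕜)) h‖
      ≤ Z₀ ν α c abar AK * ‖low K h‖ := norm_matOp_map_le _ h
  have n2 : ‖M (cast 𝕜 (low K c * ofFin abar) * (h - low K h))‖ ≤ Bs * ‖h - low K h‖ :=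
    norm_matOp_mul_le AK c abar _ fun j hj => by rw [sub_apply, low_apply, if_pos hj, sub_self]
  have n3 : ‖M y₁‖ ≤ a * ‖low K y₁‖ := norm_matOp_map_le _ _
  have n4 : ‖M y₃‖ ≤ a * ‖low K y₃‖ := norm_matOp_map_le _ _
  have n5 : ‖tailOp K (abs_inv_tail_le hαK) (cast 𝕜 (c * x) * h)‖
      ≤ b * (‖y₁ - low K y₁‖ + ‖y₂ - low K y₂‖ + ‖y₃ - low K y₃‖) := by
    refine (norm_tailOp_le K (abs_inv_tail_le hαK) _).trans (mul_le_mul_of_nonneg_left ?_ hb0)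
    have e : cast 𝕜 (c * x) * h = y₁ + y₂ + y₃ := by
      simp only [hy₁, hy₂, hy₃, map_mul, map_sub]; ring
    rw [e, show y₁ + y₂ + y₃ - low K (y₁ + y₂ + y₃)
      = (y₁ - low K y₁) + (y₂ - low K y₂) + (y₃ - low K y₃) by rw [map_add, map_add]; abel]
    exact norm_add₃_le
  have q1 : ‖low K y₁‖ + ‖y₁ - low K y₁‖ ≤ κ * δ * ‖h‖ := by
    rw [norm_low_add]
    exact (norm_cast_mul_le _ h).trans (mul_le_mul_of_nonneg_right (norm_mul_le _ _) hH0)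
  have q2 : ‖y₂ - low K y₂‖ ≤ κ * N * ‖h‖ := by
    have h1 := norm_low_add K y₂
    have h2 := norm_nonneg (low K y₂)
    have h3 : ‖y₂‖ ≤ κ * N * ‖h‖ :=
      (norm_cast_mul_le _ h).trans (mul_le_mul_of_nonneg_right (norm_mul_le _ _) hH0)
    linarith
  have q3 : ‖low K y₃‖ + ‖y₃ - low K y₃‖ ≤ γ * (N + δ) * ‖h‖ := by
    rw [norm_low_add]
    refine (norm_cast_mul_le _ h).trans (mul_le_mul_of_nonneg_right ?_ hH0)
    exact (norm_mul_le _ _).trans (mul_le_mul_of_nonneg_left hX hγ0)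
  have q4 : ‖low K y₃‖ ≤ 1 / 2 * (γ * (‖x‖ * ‖h‖)) := norm_low_tail_mul_le K c x h
  have hnorm : ‖matOp ((1 - AK * DgK α c abar).map ((↑) : ℝ → 𝕜)) h
      + ((2 * α : ℝ) : 𝕜) • (M (cast 𝕜 (low K c * ofFin abar) * (h - low K h)) + M y₁ + M y₃
        + tailOp K (abs_inv_tail_le hαK) (cast 𝕜 (c * x) * h))‖
      ≤ Z₀ ν α c abar AK * ‖low K h‖ + 2 * α * (Bs * ‖h - low K h‖ + a * ‖low K y₁‖
        + a * ‖low K y₃‖ + b * (‖y₁ - low K y₁‖ + ‖y₂ - low K y₂‖ + ‖y₃ - low K y₃‖)) := by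
    refine (norm_add_le _ _).trans (add_le_add n1 ?_)
    rw [norm_smul, RCLike.norm_ofReal, abs_of_pos (by positivity)]
    refine mul_le_mul_of_nonneg_left ?_ (by positivity)
    exact (norm_add_le _ _).trans (add_le_add ((norm_add₃_le).trans
      (add_le_add (add_le_add n2 n3) n4)) n5)
  refine hnorm.trans ?_
  have hZ0 : 0 ≤ Z₀ ν α c abar AK := opNorm_nonneg _
  have hBs : 0 ≤ Bs := rowSum_nonneg AK c abar
  have t1 : Z₀ ν α c abar AK * ‖low K h‖ ≤ Z₀ ν α c abar AK * ‖h‖ :=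
    mul_le_mul_of_nonneg_left (norm_low_le K h) hZ0
  have t2 : Bs * ‖h - low K h‖ ≤ Bs * ‖h‖ := by
    refine mul_le_mul_of_nonneg_left ?_ hBs
    have h1 := norm_low_add K h
    have h2 := norm_nonneg (low K h)
    linarith
  have t3 : a * ‖low K y₁‖ + b * ‖y₁ - low K y₁‖ ≤ (b + s) * (κ * δ * ‖h‖) := by
    have h1 := mul_le_mul_of_nonneg_right has (norm_nonneg (low K y₁))
    have h2 := mul_nonneg hs0 (norm_nonneg (y₁ - low K y₁))
    have h3 := mul_le_mul_of_nonneg_left q1 (add_nonneg hb0 hs0)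
    linarith
  have t4 : a * ‖low K y₃‖ + b * ‖y₃ - low K y₃‖
      ≤ s * (1 / 2 * (γ * (‖x‖ * ‖h‖))) + b * (γ * (N + δ) * ‖h‖) := by
    have h1 := mul_le_mul_of_nonneg_right has (norm_nonneg (low K y₃))
    have h2 := mul_le_mul_of_nonneg_left q4 hs0
    have h3 := mul_le_mul_of_nonneg_left q3 hb0
    linarith
  have t5 := mul_le_mul_of_nonneg_left q2 hb0
  have t6 : (b + s) * (κ + γ) ≤ max a 1 * max ‖c‖ 1 := by
    rw [hc]
    exact mul_le_mul hbs (le_max_left _ _) (norm_nonneg _) (ha0.trans (le_max_left _ _))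
  have t7 := mul_le_mul_of_nonneg_right t6 (mul_nonneg hδ0 hH0)
  have hαc : ∀ {u v : ℝ}, u ≤ v → 2 * α * u ≤ 2 * α * v := fun h =>
    mul_le_mul_of_nonneg_left h (by positivity)
  have u2 := hαc t2
  have u3 := hαc t3
  have u4 := hαc t4
  have u5 := hαc t5
  have u7 := hαc t7
  change _ ≤ (_ + _ + (2 * α * max a 1 * max ‖c‖ 1 - _) * δ + _) * ‖h‖
  rw [← hc] at u7 ⊢
  linarith

end Ell
end Fisher

namespace Fisher

namespace Ell

variable {ν : ℝ} [hν : Fact (1 < ν)]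

/-! ### The Newton-like operator -/

/-- The Newton-like operator `x ↦ x - A g(x)`, written without the unbounded linear part of `g`. -/
noncomputable def newton {α : ℝ} {K : ℕ} (hαK : α < ((K : ℝ) + 1) ^ 2)
    (AK : Matrix (Fin (K + 1)) (Fin (K + 1)) ℝ) (c x : Ell ℝ ν) : Ell ℝ ν :=
  matOp (1 - AK * lamMat α K) x + α • approxInv hαK AK (c * x * x)

theorem cast_real (u : Ell ℝ ν) : cast ℝ u = u := ext fun _ => rfl

theorem map_real {K : ℕ} (M : Matrix (Fin (K + 1)) (Fin (K + 1)) ℝ) :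
    M.map (RCLike.ofReal : ℝ → ℝ) = M := by
  rw [RCLike.ofReal_real_eq_id, Matrix.map_id]

/-- As `g` is quadratic, a difference of values of the Newton-like operator is the defect at the
midpoint. -/
theorem newton_sub {α : ℝ} {K : ℕ} (hαK : α < ((K : ℝ) + 1) ^ 2)
    (AK : Matrix (Fin (K + 1)) (Fin (K + 1)) ℝ) (c x y : Ell ℝ ν) :
    newton hαK AK c x - newton hαK AK c y
      = defect hαK AK c ((1 / 2 : ℝ) • (x + y)) (x - y) := by
  have e : cast ℝ (c * ((1 / 2 : ℝ) • (x + y))) * (x - y)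
      = (1 / 2 : ℝ) • (c * x * x - c * y * y) := by
    rw [cast_real, mul_smul_comm, smul_mul_assoc]
    congr 1; ring
  rw [newton, newton, defect, e, map_smul, smul_smul, map_sub, map_sub, map_real,
    RCLike.ofReal_real_eq_id, id, show (2 * α) * (1 / 2) = α by ring, smul_sub]
  abel

theorem matOp_one_sub_lam {α : ℝ} {K : ℕ} (AK : Matrix (Fin (K + 1)) (Fin (K + 1)) ℝ)
    (x : Ell ℝ ν) : matOp (1 - AK * lamMat α K) x
      = low K x - ofFin (AK.mulVec fun k => (α - (k : ℝ) ^ 2) * x k) := by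
  rw [← ofFin_res, matOp_def, Matrix.sub_mulVec, Matrix.one_mulVec, map_sub,
    ← Matrix.mulVec_mulVec]
  congr 3
  ext k
  rw [lamMat, Matrix.mulVec_diagonal]; rfl

theorem low_newton {α : ℝ} {K : ℕ} (hαK : α < ((K : ℝ) + 1) ^ 2)
    (AK : Matrix (Fin (K + 1)) (Fin (K + 1)) ℝ) (c x : Ell ℝ ν) :
    low K (newton hαK AK c x)
      = low K x - ofFin (AK.mulVec fun k : Fin (K + 1) => g α c x k) := by
  have e : (fun k : Fin (K + 1) => g α c x k)
      = (fun k : Fin (K + 1) => (α - (k : ℝ) ^ 2) * x k) - α • res K (c * x * x) := rfl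
  rw [newton, map_add, map_smul, low_approxInv, low_matOp, matOp_one_sub_lam, e,
    Matrix.mulVec_sub, Matrix.mulVec_smul, map_sub, map_smul, map_real, matOp_def]
  abel

theorem newton_eq_iff {α : ℝ} {K : ℕ} (hαK : α < ((K : ℝ) + 1) ^ 2)
    {AK : Matrix (Fin (K + 1)) (Fin (K + 1)) ℝ} (hAK : IsUnit AK) (c x : Ell ℝ ν) :
    newton hαK AK c x = x ↔ ∀ k, g α c x k = 0 := by
  have hne : ∀ k, K < k → α - (k : ℝ) ^ 2 ≠ 0 := fun k hk => by
    have h1 : (K : ℝ) + 1 ≤ k := by exact_mod_cast hk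
    have h2 : ((K : ℝ) + 1) ^ 2 ≤ (k : ℝ) ^ 2 := pow_le_pow_left₀ (by positivity) h1 2
    linarith
  have htail : ∀ k, K < k → newton hαK AK c x k
      = x k - (α - (k : ℝ) ^ 2)⁻¹ * g α c x k := by
    intro k hk
    have h1 : newton hαK AK c x k
        = 0 + α * (0 + (α - (k : ℝ) ^ 2)⁻¹ * (c * x * x : Ell ℝ ν) k) := by
      rw [newton, add_apply, smul_apply, approxInv, LinearMap.add_apply, add_apply, tailOp_apply,
        if_neg (by omega), matOp_def, matOp_def, ofFin_apply_of_lt _ hk, ofFin_apply_of_lt _ hk]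
      rfl
    rw [h1, g, mul_sub, ← mul_assoc _ _ (x k), inv_mul_cancel₀ (hne k hk)]
    change _ = x k - (1 * x k - (α - (k : ℝ) ^ 2)⁻¹ * (α * (c * x * x : Ell ℝ ν) k))
    ring
  constructor
  · intro h k
    rcases le_or_gt k K with hk | hk
    · have h1 := low_newton hαK AK c x
      rw [h, eq_comm, sub_eq_self] at h1
      have h2 : AK.mulVec (fun k : Fin (K + 1) => g α c x k) = 0 := by
        rw [← res_ofFin (ν := ν) (AK.mulVec _), h1, map_zero]
      have h3 := (Matrix.mulVec_injective_iff_isUnit.mpr hAK) (h2.trans (Matrix.mulVec_zero _).symm)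
      exact congrFun h3 ⟨k, Nat.lt_succ_iff.mpr hk⟩
    · have h1 := htail k hk
      rw [h, eq_comm, sub_eq_self, mul_eq_zero] at h1
      exact h1.resolve_left (inv_ne_zero (hne k hk))
  · intro h
    ext k
    rcases le_or_gt k K with hk | hk
    · have h1 := low_newton hαK AK c x
      simp only [h] at h1
      rw [show (fun _ : Fin (K + 1) => (0 : ℝ)) = 0 from rfl, Matrix.mulVec_zero, map_zero,
        sub_zero] at h1
      have h2 := congrArg (fun u : Ell ℝ ν => u k) h1
      simpa [low_apply, hk] using h2
    · rw [htail k hk, h, mul_zero, sub_zero]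

/-- As only half of the mass of `c^∞ ∗ ā ∗ ā` falls on the modes up to `K`, the constant `Y₀`
overestimates the residual. -/
theorem norm_newton_sub_le {α : ℝ} (hα : 0 < α) {K : ℕ} (hαK : α < ((K : ℝ) + 1) ^ 2)
    (AK : Matrix (Fin (K + 1)) (Fin (K + 1)) ℝ) (c : Ell ℝ ν) (abar : Fin (K + 1) → ℝ) :
    ‖newton hαK AK c (ofFin abar) - ofFin abar‖
      ≤ Y₀ ν α c abar AK - excess α AK c / 2 * ‖(ofFin abar : Ell ℝ ν)‖ ^ 2 := by
  set x : Ell ℝ ν := ofFin abar with hx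
  set b : ℝ := 1 / (((K : ℝ) + 1) ^ 2 - α) with hbd
  have hb0 : 0 ≤ b := one_div_nonneg.mpr (by linarith)
  set T := tailOp (𝕜 := ℝ) (ν := ν) K (abs_inv_tail_le hαK) with hT
  set z : Ell ℝ ν := (c - low K c) * x * x with hz
  have e0 : ofFin (gK α c abar) = ofFin (fun k : Fin (K + 1) => (α - (k : ℝ) ^ 2) * x k)
      - α • low K (low K c * x * x) := by
    rw [← ofFin_res, ← map_smul, ← map_sub]
    congr 1
    ext k
    rw [gK, ← ofFin_apply_fin (ν := ν) abar k]
    rfl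
  have e : newton hαK AK c x - x = -ofFin (AK.mulVec (gK α c abar))
      + α • (matOp AK z + T (low K c * x * x) + T z) := by
    have e1 : c * x * x = low K c * x * x + z := by rw [hz]; ring
    have e2 : ofFin (AK.mulVec (gK α c abar))
        = ofFin (AK.mulVec (fun k : Fin (K + 1) => (α - (k : ℝ) ^ 2) * x k))
          - α • matOp AK (low K c * x * x) := by
      have h1 : ∀ v : Fin (K + 1) → ℝ, ofFin (AK.mulVec v) = matOp AK (ofFin v : Ell ℝ ν) :=
        fun v => by rw [matOp_def, res_ofFin]
      rw [h1, e0, map_sub, map_smul, ← h1, matOp_low]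
    rw [newton, matOp_one_sub_lam, approxInv, e1, e2, map_add, LinearMap.add_apply,
      LinearMap.add_apply, map_real, hx, low_ofFin, ← hx]
    simp only [smul_add]
    abel
  have n1 : ‖matOp AK z‖ ≤ opNorm ν AK * ‖low K z‖ := norm_matOp_le _ _
  have n2 : ‖T z‖ ≤ b * ‖z - low K z‖ := norm_tailOp_le _ _ _
  have n3 : α * ‖T (low K c * x * x)‖ ≤ 2 * ∑ k ∈ Finset.Icc (K + 1) (3 * K),
        α * (|conv (conv (trunc K c) (incl abar)) (incl abar) k| / ((k : ℝ) ^ 2 - α)) * ν ^ k := by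
    have h1 : HasSum (fun k => weight ν k * ‖T (low K c * x * x) k‖)
        (∑ k ∈ Finset.Icc (K + 1) (3 * K), weight ν k * ‖T (low K c * x * x) k‖) := by
      refine hasSum_sum_of_ne_finset_zero fun k hk => ?_
      rw [Finset.mem_Icc] at hk
      rw [hT, tailOp_apply]
      split_ifs with h
      · simp
      · rw [mul_apply_eq_zero (p := 2 * K) (q := K) (fun j hj => mul_apply_eq_zero (p := K) (q := K)
          (fun i hi => by rw [low_apply, if_neg (by omega)])
          (fun i hi => by rw [hx, ofFin_apply_of_lt _ hi]) (by omega))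
          (fun i hi => by rw [hx, ofFin_apply_of_lt _ hi]) (by omega)]
        simp
    rw [(hasSum_norm _).unique h1, Finset.mul_sum, Finset.mul_sum]
    refine Finset.sum_le_sum fun k hk => le_of_eq ?_
    rw [Finset.mem_Icc] at hk
    have h1 : (K : ℝ) + 1 ≤ k := by exact_mod_cast hk.1
    have h2 : ((K : ℝ) + 1) ^ 2 ≤ (k : ℝ) ^ 2 := pow_le_pow_left₀ (by positivity) h1 2
    rw [hT, tailOp_apply, if_neg (by omega), weight, if_neg (by omega), norm_mul,
      RCLike.norm_ofReal, abs_inv, abs_of_neg (show α - (k : ℝ) ^ 2 < 0 by linarith), neg_sub,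
      Real.norm_eq_abs]
    change α * (2 * ν ^ k * (((k : ℝ) ^ 2 - α)⁻¹ *
      |conv (conv (trunc K c) (incl abar)) (incl abar) k|)) = _
    ring
  set N := ‖x‖ with hN
  set γ := ‖c - low K c‖
  have hγ0 : 0 ≤ γ := norm_nonneg _
  have p1 : ‖low K z‖ ≤ 1 / 2 * (γ * (N * N)) := by
    have h1 := norm_low_tail_mul_le (𝕜 := ℝ) K c x x
    rwa [cast_real] at h1
  have p2 : ‖low K z‖ + ‖z - low K z‖ ≤ γ * (N * N) := by
    rw [norm_low_add, hz, mul_assoc]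
    exact (norm_mul_le _ _).trans (mul_le_mul_of_nonneg_left (norm_mul_le _ _) hγ0)
  set a := opNorm ν AK
  set s : ℝ := max (a - b) 0 with hs
  have hs0 : 0 ≤ s := le_max_right _ _
  have has : a ≤ b + s := by have := le_max_left (a - b) 0; linarith
  have hs2 : s ≤ a := max_le (by linarith) (opNorm_nonneg AK)
  have hnorm : ‖newton hαK AK c x - x‖ ≤ ‖(ofFin (AK.mulVec (gK α c abar)) : Ell ℝ ν)‖
      + (α * (a * ‖low K z‖) + α * ‖T (low K c * x * x)‖ + α * (b * ‖z - low K z‖)) := by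
    rw [e]
    refine (norm_add_le _ _).trans (add_le_add (by rw [norm_neg]) ?_)
    rw [norm_smul, Real.norm_eq_abs, abs_of_pos hα, ← mul_add, ← mul_add]
    exact mul_le_mul_of_nonneg_left (norm_add₃_le.trans (add_le_add (add_le_add n1 le_rfl) n2))
      hα.le
  have t1 : a * ‖low K z‖ + b * ‖z - low K z‖ ≤ (a - s / 2 + b) * (γ * (N * N)) := by
    have h1 := mul_le_mul_of_nonneg_right has (norm_nonneg (low K z))
    have h2 := mul_le_mul_of_nonneg_left p1 hs0
    have h3 := mul_le_mul_of_nonneg_left p2 hb0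
    have h4 := mul_le_mul_of_nonneg_right hs2 (mul_nonneg hγ0 (mul_self_nonneg N))
    linarith
  have t2 := mul_le_mul_of_nonneg_left t1 hα.le
  refine hnorm.trans ?_
  have hY : Y₀ ν α c abar AK = ‖(ofFin (AK.mulVec (gK α c abar)) : Ell ℝ ν)‖
      + α * a * N ^ 2 * γ + α * (γ * N ^ 2 * b)
      + 2 * ∑ k ∈ Finset.Icc (K + 1) (3 * K),
        α * (|conv (conv (trunc K c) (incl abar)) (incl abar) k| / ((k : ℝ) ^ 2 - α)) * ν ^ k := by
    rw [hbd, mul_one_div]; rfl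
  rw [hY, excess]
  linarith

/-- The terms of `Y₀` with `c^∞` dominate `τ |ā|²`, where `τ` is the excess. -/
theorem Y₀_ge {α : ℝ} (hα : 0 < α) {K : ℕ} (hαK : α < ((K : ℝ) + 1) ^ 2)
    (AK : Matrix (Fin (K + 1)) (Fin (K + 1)) ℝ) (c : Ell ℝ ν) (abar : Fin (K + 1) → ℝ) :
    ‖(ofFin (AK.mulVec (gK α c abar)) : Ell ℝ ν)‖
      + excess α AK c * ‖(ofFin abar : Ell ℝ ν)‖ ^ 2 ≤ Y₀ ν α c abar AK := by
  set b : ℝ := 1 / (((K : ℝ) + 1) ^ 2 - α) with hbd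
  have hb0 : 0 ≤ b := one_div_nonneg.mpr (by linarith)
  set N := ‖(ofFin abar : Ell ℝ ν)‖
  set γ := ‖c - low K c‖
  have hγ0 : 0 ≤ γ := norm_nonneg _
  have hY : Y₀ ν α c abar AK = ‖(ofFin (AK.mulVec (gK α c abar)) : Ell ℝ ν)‖
      + α * opNorm ν AK * N ^ 2 * γ + α * (γ * N ^ 2 * b)
      + 2 * ∑ k ∈ Finset.Icc (K + 1) (3 * K),
        α * (|conv (conv (trunc K c) (incl abar)) (incl abar) k| / ((k : ℝ) ^ 2 - α)) * ν ^ k := by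
    rw [hbd, mul_one_div]; rfl
  have h1 : max (opNorm ν AK - b) 0 ≤ opNorm ν AK := max_le (by linarith) (opNorm_nonneg AK)
  have h2 := mul_le_mul_of_nonneg_left (mul_le_mul_of_nonneg_right h1
    (mul_nonneg hγ0 (sq_nonneg N))) hα.le
  have h3 : 0 ≤ ∑ k ∈ Finset.Icc (K + 1) (3 * K),
        α * (|conv (conv (trunc K c) (incl abar)) (incl abar) k| / ((k : ℝ) ^ 2 - α)) * ν ^ k := by
    refine Finset.sum_nonneg fun k hk => ?_
    rw [Finset.mem_Icc] at hk
    have h1 : (K : ℝ) + 1 ≤ k := by exact_mod_cast hk.1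
    have h2 : ((K : ℝ) + 1) ^ 2 ≤ (k : ℝ) ^ 2 := pow_le_pow_left₀ (by positivity) h1 2
    have h3 : 0 ≤ (k : ℝ) ^ 2 - α := by linarith
    have h4 := zero_lt_one.trans hν.out
    positivity
  have h4 : 0 ≤ α * (γ * N ^ 2 * b) := by positivity
  rw [hY, excess]
  linarith

end Ell
end Fisher

namespace Fisher

namespace Ell

/-! ### Zeros of `g` near `ā`, and the defect at a zero -/

/-- The arithmetic behind the bound of the defect at a zero `x`, with `δ = |x - ā|` and
`N = |ā|`: `h₂` comes from the Newton-like operator being quadratic, `h₃` from the fact that the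
zero sequence is a second zero of `g`. -/
theorem radii_aux {Z η Y τ N δ r : ℝ} (hZ : 0 < Z) (hη : 0 < η) (hτ : 0 ≤ τ)
    (hδ : 0 ≤ δ) (hδr : δ < r) (h₁ : Z * r ^ 2 - η * r + Y < 0)
    (h₂ : η * δ ≤ Y - τ / 2 * N ^ 2 + Z * δ ^ 2 / 2 - τ * δ ^ 2 / 2 + τ * N * δ)
    (h₃ : δ = N ∨ η ≤ (Z - τ) * ((N + δ) / 2)) :
    Z * δ + τ * (N - δ) ≤ Z * r := by
  rcases le_or_gt N δ with hN | hN
  · have := mul_nonneg hτ (sub_nonneg.mpr hN)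
    have := mul_lt_mul_of_pos_left hδr hZ
    linarith
  · have h₃ := h₃.resolve_left hN.ne
    have hτX : 0 ≤ τ * (N - δ) := mul_nonneg hτ (sub_nonneg.mpr hN.le)
    have k1 : Z * r ^ 2 - Z * δ ^ 2 / 2 + τ * (N - δ) ^ 2 / 2 ≤ η * (r - δ) := by linarith
    have k2 : Z * δ ^ 2 / 2 + τ * (N - δ) ^ 2 / 2 ≤ η * (r - δ) := by
      have : δ ^ 2 ≤ r ^ 2 := pow_le_pow_left₀ hδ hδr.le 2
      have := mul_le_mul_of_nonneg_left this hZ.le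
      linarith
    have k3 := mul_le_mul_of_nonneg_left k2 hZ.le
    have k4 := mul_le_mul_of_nonneg_left h₃ hτX
    -- what is left over is half of this square plus the nonnegative term of `k6`
    have k5 := sq_nonneg (Z * δ - τ * (N - δ))
    have k6 := mul_nonneg (mul_nonneg hτ hτX) hδ
    have k7 : η * (τ * (N - δ)) ≤ η * (Z * (r - δ)) := by linarith
    have := le_of_mul_le_mul_left k7 hη
    linarith

theorem Z₂_pos {ν α : ℝ} {K : ℕ} {AK : Matrix (Fin (K + 1)) (Fin (K + 1)) ℝ} {c : ℕ → ℝ}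
    (hα : 0 < α) : 0 < Z₂ ν α c AK := by
  rw [Z₂]
  have := (lt_max_iff (a := (0 : ℝ)) (b := opNorm ν AK) (c := 1)).mpr (Or.inr zero_lt_one)
  have := (lt_max_iff (a := (0 : ℝ)) (b := ell1Norm ν c) (c := 1)).mpr (Or.inr zero_lt_one)
  positivity

variable {𝕜 : Type*} [RCLike 𝕜] {ν : ℝ} [hν : Fact (1 < ν)]
variable {α : ℝ} {K : ℕ} {AK : Matrix (Fin (K + 1)) (Fin (K + 1)) ℝ} {c : Ell ℝ ν}
  {abar : Fin (K + 1) → ℝ} {r : ℝ}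

theorem excess_nonneg (hα : 0 < α) : 0 ≤ excess α AK c :=
  mul_nonneg (mul_nonneg hα.le (le_max_right _ _)) (norm_nonneg _)

theorem two_mul_excess_le (hα : 0 < α) (hαK : α < ((K : ℝ) + 1) ^ 2) :
    2 * excess α AK c ≤ Z₂ ν α c AK := by
  have hb0 : 0 ≤ 1 / (((K : ℝ) + 1) ^ 2 - α) := one_div_nonneg.mpr (by linarith)
  have h1 : max (opNorm ν AK - 1 / (((K : ℝ) + 1) ^ 2 - α)) 0 ≤ max (opNorm ν AK) 1 :=
    max_le_max (by linarith) zero_le_one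
  have h2 : ‖c - low K c‖ ≤ max (ell1Norm ν c) 1 := by
    refine le_trans ?_ (le_max_left _ _)
    have h3 := norm_low_add K c
    have h4 := norm_nonneg (low K c)
    rw [norm_def c] at h3
    linarith
  have h3 := mul_le_mul h1 h2 (norm_nonneg _) (zero_le_one.trans (le_max_right _ _))
  have h4 := mul_le_mul_of_nonneg_left h3 hα.le
  rw [excess, Z₂]
  linarith

theorem Y₀_nonneg (hα : 0 < α) (hαK : α < ((K : ℝ) + 1) ^ 2) : 0 ≤ Y₀ ν α c abar AK := by
  refine le_trans ?_ (Y₀_ge hα hαK AK c abar)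
  have := excess_nonneg (AK := AK) (c := c) hα
  positivity

/-- The Newton-like operator is a contraction of the closed ball of radius `r`, and maps it into the
open ball. The excess terms are absorbed by means of `τ N² ≤ Y₀`, with `N = |ā|`. -/
theorem exists_unique_zero (hα : 0 < α) (hαK : α < ((K : ℝ) + 1) ^ 2) (hr : 0 < r)
    (hAK : IsUnit AK)
    (hrad : Z₂ ν α c AK * r ^ 2 - (1 - Z₀ ν α c abar AK - Z₁ ν α c abar AK) * r
      + Y₀ ν α c abar AK < 0)
    (hb : 1 / (((K : ℝ) + 1) ^ 2 - α) ≤ max (opNorm ν AK) 1) :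
    ∃! x : Ell ℝ ν, ‖x - ofFin abar‖ < r ∧ ∀ k, g α c x k = 0 := by
  set Z := Z₂ ν α c AK
  set S := Z₀ ν α c abar AK + Z₁ ν α c abar AK
  set Y := Y₀ ν α c abar AK
  set τ := excess α AK c
  set a₀ : Ell ℝ ν := ofFin abar with ha₀
  set N := ‖a₀‖
  have hτ : 0 ≤ τ := excess_nonneg hα
  have hZ : 0 < Z := Z₂_pos hα
  have hZτ : 2 * τ ≤ Z := two_mul_excess_le hα hαK
  have hY : τ * N ^ 2 ≤ Y := by
    have h1 := Y₀_ge hα hαK AK c abar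
    have h2 := norm_nonneg (ofFin (AK.mulVec (gK α c abar)) : Ell ℝ ν)
    linarith
  have hrad' : Z * r ^ 2 - (1 - S) * r + Y < 0 := by linarith
  have hE : ∀ x y : Ell ℝ ν, ‖newton hαK AK c x - newton hαK AK c y‖
      ≤ (S + Z * ‖(1 / 2 : ℝ) • (x + y) - a₀‖ + τ * (N - ‖(1 / 2 : ℝ) • (x + y) - a₀‖))
        * ‖x - y‖ := by
    intro x y
    rw [newton_sub]
    refine (norm_defect_le hα hαK AK c _ abar hb _).trans
      (mul_le_mul_of_nonneg_right ?_ (norm_nonneg _))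
    have h1 : ‖(1 / 2 : ℝ) • (x + y)‖ ≤ N + ‖(1 / 2 : ℝ) • (x + y) - a₀‖ := by
      have := norm_add_le a₀ ((1 / 2 : ℝ) • (x + y) - a₀)
      rwa [add_sub_cancel] at this
    have h2 := mul_le_mul_of_nonneg_left h1 hτ
    linarith
  have hmono : ∀ {δ ρ : ℝ}, δ ≤ ρ → Z * δ + τ * (N - δ) ≤ Z * ρ + τ * (N - ρ) := by
    intro δ ρ h
    have := mul_le_mul_of_nonneg_left h (show 0 ≤ Z - τ by linarith)
    linarith
  set q : ℝ := S + Z * r + τ * (N - r) with hq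
  have hq1 : q < 1 := by
    have h1 : τ * (N - r) * r ≤ Y := by
      have := mul_nonneg hτ (sq_nonneg (N - r / 2))
      have := mul_nonneg hτ (sq_nonneg r)
      linarith
    have h2 : q * r < 1 * r := by rw [hq]; linarith
    exact lt_of_mul_lt_mul_right h2 hr.le
  have hmid : ∀ x y : Ell ℝ ν, ‖(1 / 2 : ℝ) • (x + y) - a₀‖
      ≤ (‖x - a₀‖ + ‖y - a₀‖) / 2 := by
    intro x y
    have e : (1 / 2 : ℝ) • (x + y) - a₀ = (1 / 2 : ℝ) • ((x - a₀) + (y - a₀)) := by module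
    rw [e, norm_smul, Real.norm_eq_abs, abs_of_pos (by norm_num)]
    have := norm_add_le (x - a₀) (y - a₀)
    linarith
  have hLip : ∀ x y : Ell ℝ ν, ‖x - a₀‖ ≤ r → ‖y - a₀‖ ≤ r →
      ‖newton hαK AK c x - newton hαK AK c y‖ ≤ q * ‖x - y‖ := by
    intro x y hx hy
    refine (hE x y).trans (mul_le_mul_of_nonneg_right ?_ (norm_nonneg _))
    have := hmono ((hmid x y).trans (show _ ≤ r by linarith))
    linarith
  have hself : ∀ x : Ell ℝ ν, ‖x - a₀‖ ≤ r → ‖newton hαK AK c x - a₀‖ < r := by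
    intro x hx
    have h1 : ‖newton hαK AK c x - newton hαK AK c a₀‖
        ≤ (S + Z * (r / 2) + τ * (N - r / 2)) * r := by
      have h2 : ‖(1 / 2 : ℝ) • (x + a₀) - a₀‖ ≤ r / 2 := by
        refine (hmid x a₀).trans ?_
        rw [sub_self, norm_zero]; linarith
      have h3 := hmono h2
      have h4 : 0 ≤ S + Z * (r / 2) + τ * (N - r / 2) := by
        have hS : 0 ≤ S := by
          have h5 : 0 ≤ Z₀ ν α c abar AK := opNorm_nonneg _
          have h6 := Z₁_nonneg hα hαK c abar AK
          exact add_nonneg h5 h6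
        have h5 := mul_nonneg (show 0 ≤ Z - τ by linarith) hr.le
        have h6 := mul_nonneg hτ (norm_nonneg a₀)
        linarith
      refine (hE x a₀).trans ?_
      calc _ ≤ (S + Z * (r / 2) + τ * (N - r / 2)) * ‖x - a₀‖ :=
            mul_le_mul_of_nonneg_right (by linarith) (norm_nonneg _)
        _ ≤ _ := mul_le_mul_of_nonneg_left hx h4
    have h2 := norm_newton_sub_le hα hαK AK c abar
    have h3 := norm_add_le (newton hαK AK c x - newton hαK AK c a₀) (newton hαK AK c a₀ - a₀)
    rw [sub_add_sub_cancel] at h3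
    have h4 := mul_nonneg hτ (sq_nonneg (N - r))
    have h5 := mul_nonneg hZ.le (sq_nonneg r)
    linarith
  have hmaps : Set.MapsTo (newton hαK AK c) (Metric.closedBall a₀ r) (Metric.closedBall a₀ r) := by
    intro x hx
    rw [mem_closedBall_iff_norm] at hx ⊢
    exact (hself x hx).le
  have hcontr : ContractingWith q.toNNReal (hmaps.restrict _ _ _) := by
    refine ⟨?_, LipschitzWith.of_dist_le_mul fun x y => ?_⟩
    · exact Real.toNNReal_lt_one.mpr hq1
    · rw [Subtype.dist_eq, Subtype.dist_eq, dist_eq_norm, dist_eq_norm]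
      refine (hLip x y (mem_closedBall_iff_norm.mp x.2) (mem_closedBall_iff_norm.mp y.2)).trans ?_
      exact mul_le_mul_of_nonneg_right (Real.le_coe_toNNReal q) (norm_nonneg _)
  obtain ⟨x, hx, hfix, -⟩ := hcontr.exists_fixedPoint' Metric.isClosed_closedBall.isComplete hmaps
    (Metric.mem_closedBall_self hr.le) (edist_ne_top _ _)
  rw [mem_closedBall_iff_norm] at hx
  have hfix : newton hαK AK c x = x := hfix
  refine ⟨x, ⟨by simpa only [hfix] using hself x hx, (newton_eq_iff hαK hAK c x).mp hfix⟩, ?_⟩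
  rintro y ⟨hy, hgy⟩
  have h1 := hLip y x hy.le hx
  rw [hfix, (newton_eq_iff hαK hAK c y).mpr hgy] at h1
  by_contra hne
  have h2 := norm_pos_iff.mpr (sub_ne_zero.mpr hne)
  have h3 := mul_lt_mul_of_pos_right hq1 h2
  linarith

theorem newton_zero (hαK : α < ((K : ℝ) + 1) ^ 2) : newton hαK AK c 0 = 0 := by
  rw [newton, mul_zero, map_zero, map_zero, smul_zero, add_zero]

/-- The bound of the defect at a zero in the case in which `A` has the norm `max (‖A^K‖, 1)` that
`Z₂` assumes. -/
theorem norm_defect_le_of_zero (hα : 0 < α) (hαK : α < ((K : ℝ) + 1) ^ 2) (hr : 0 < r)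
    (hAK : IsUnit AK)
    (hrad : Z₂ ν α c AK * r ^ 2 - (1 - Z₀ ν α c abar AK - Z₁ ν α c abar AK) * r
      + Y₀ ν α c abar AK < 0)
    (hb : 1 / (((K : ℝ) + 1) ^ 2 - α) ≤ max (opNorm ν AK) 1) {x : Ell ℝ ν}
    (hxr : ‖x - ofFin abar‖ < r) (hx : ∀ k, g α c x k = 0) (h : Ell 𝕜 ν) :
    ‖defect hαK AK c x h‖
      ≤ (Z₂ ν α c AK * r + Z₁ ν α c abar AK + Z₀ ν α c abar AK) * ‖h‖ := by
  refine (norm_defect_le hα hαK AK c x abar hb h).trans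
    (mul_le_mul_of_nonneg_right ?_ (norm_nonneg _))
  rw [← newton_eq_iff hαK hAK] at hx
  have hY := norm_newton_sub_le hα hαK AK c abar
  have hY0 := Y₀_nonneg (AK := AK) (c := c) (abar := abar) hα hαK
  set Z := Z₂ ν α c AK
  set S₀ := Z₀ ν α c abar AK
  set S₁ := Z₁ ν α c abar AK
  set Y := Y₀ ν α c abar AK
  set τ := excess α AK c
  set a₀ : Ell ℝ ν := ofFin abar with ha₀
  set N := ‖a₀‖
  set δ := ‖x - a₀‖ with hδ
  have hτ : 0 ≤ τ := excess_nonneg hα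
  have hZ : 0 < Z := Z₂_pos hα
  have hZτ : 2 * τ ≤ Z := two_mul_excess_le hα hαK
  have hδ0 : 0 ≤ δ := norm_nonneg _
  have hη : 0 < 1 - S₀ - S₁ := by
    have h1 := mul_nonneg hZ.le (sq_nonneg r)
    exact pos_of_mul_pos_left (b := r) (by linarith) hr.le
  have hX : ‖x‖ ≤ N + δ := by
    have := norm_add_le a₀ (x - a₀)
    rwa [add_sub_cancel] at this
  have key : Z * δ + τ * (N - δ) ≤ Z * r := by
    refine radii_aux hZ hη hτ hδ0 hxr hrad ?_ ?_
    · have h1 : ‖newton hαK AK c x - newton hαK AK c a₀‖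
          ≤ (S₀ + S₁ + (Z - 2 * τ) * (δ / 2) + τ * (N + δ / 2)) * δ := by
        rw [newton_sub]
        refine (norm_defect_le hα hαK AK c _ abar hb _).trans
          (mul_le_mul_of_nonneg_right ?_ (norm_nonneg _))
        have e : (1 / 2 : ℝ) • (x + a₀) - a₀ = (1 / 2 : ℝ) • (x - a₀) := by module
        have h2 : ‖(1 / 2 : ℝ) • (x + a₀) - a₀‖ = δ / 2 := by
          rw [e, norm_smul, Real.norm_eq_abs, abs_of_pos (by norm_num)]; ring
        have h3 : ‖(1 / 2 : ℝ) • (x + a₀)‖ ≤ N + δ / 2 := by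
          have := norm_add_le a₀ ((1 / 2 : ℝ) • (x + a₀) - a₀)
          rwa [add_sub_cancel, h2] at this
        rw [h2]
        have := mul_le_mul_of_nonneg_left h3 hτ
        linarith
      rw [hx] at h1
      have h2 := norm_add_le (x - newton hαK AK c a₀) (newton hαK AK c a₀ - a₀)
      rw [sub_add_sub_cancel, ← hδ] at h2
      linarith
    · rcases eq_or_ne x 0 with h0 | h0
      · left; rw [hδ, h0, zero_sub, norm_neg]
      · right
        -- `x` and `0` are both fixed points, so the defect at `x / 2` has norm at least one
        have h1 : ‖newton hαK AK c x - newton hαK AK c 0‖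
            ≤ (S₀ + S₁ + (Z - 2 * τ) * ((N + δ) / 2) + τ * ((N + δ) / 2)) * ‖x‖ := by
          rw [newton_sub, sub_zero, add_zero]
          refine (norm_defect_le hα hαK AK c _ abar hb _).trans
            (mul_le_mul_of_nonneg_right ?_ (norm_nonneg _))
          have e : (1 / 2 : ℝ) • x - a₀ = (1 / 2 : ℝ) • ((x - a₀) - a₀) := by module
          have h2 : ‖(1 / 2 : ℝ) • x - a₀‖ ≤ (N + δ) / 2 := by
            rw [e, norm_smul, Real.norm_eq_abs, abs_of_pos (by norm_num)]
            have := norm_sub_le (x - a₀) a₀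
            linarith
          have h3 : ‖(1 / 2 : ℝ) • x‖ ≤ (N + δ) / 2 := by
            rw [norm_smul, Real.norm_eq_abs, abs_of_pos (by norm_num)]
            linarith
          have h4 := mul_le_mul_of_nonneg_left h3 hτ
          have h5 := mul_le_mul_of_nonneg_left h2 (show 0 ≤ Z - 2 * τ by linarith)
          linarith
        rw [hx, newton_zero, sub_zero] at h1
        have h2 := le_of_mul_le_mul_right ((one_mul ‖x‖).le.trans h1) (norm_pos_iff.mpr h0)
        linarith
  have := mul_le_mul_of_nonneg_left hX hτ
  linarith

/-- If `1 / ((K + 1)² - α)` exceeds the norm that `Z₂` assumes for `A`, then `Z₁ < 1` forces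
`|c| |ā|` to be so small that the zero sequence lies in the ball. -/
theorem norm_ofFin_lt (hα : 0 < α) (hαK : α < ((K : ℝ) + 1) ^ 2) (hr : 0 < r)
    (hrad : Z₂ ν α c AK * r ^ 2 - (1 - Z₀ ν α c abar AK - Z₁ ν α c abar AK) * r
      + Y₀ ν α c abar AK < 0)
    (hb : max (opNorm ν AK) 1 < 1 / (((K : ℝ) + 1) ^ 2 - α)) :
    ‖(ofFin abar : Ell ℝ ν)‖ < r := by
  set a₀ : Ell ℝ ν := ofFin abar with ha₀
  set N := ‖a₀‖
  set b : ℝ := 1 / (((K : ℝ) + 1) ^ 2 - α) with hbd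
  have hab : opNorm ν AK ≤ b := (le_max_left _ _).trans hb.le
  have hb0 : 0 ≤ b := (opNorm_nonneg AK).trans hab
  have hN0 : 0 ≤ N := norm_nonneg _
  have hZ : 0 < Z₂ ν α c AK := Z₂_pos hα
  have hY0 := Y₀_nonneg (AK := AK) (c := c) (abar := abar) hα hαK
  have hη : 0 < 1 - Z₀ ν α c abar AK - Z₁ ν α c abar AK := by
    have h1 := mul_nonneg hZ.le (sq_nonneg r)
    exact pos_of_mul_pos_left (b := r) (by linarith) hr.le
  have hκ : ‖low K c‖ ≤ ‖c‖ := norm_low_le K c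
  have hZ1 : 2 * α * b * (‖c‖ * N) ≤ Z₁ ν α c abar AK := le_Z₁ hα c abar AK
  -- `A^K g^K(ā)` is close to `ā`, since `g^K(ā) = Dg^K(ā) ā + α (c^K ∗ ā ∗ ā)`
  have e : ofFin (AK.mulVec (gK α c abar)) = a₀ - (matOp (1 - AK * DgK α c abar) a₀
      - α • matOp AK (low K c * a₀ * a₀)) := by
    have h0 : ofFin (gK α c abar) = matOp (lamMat α K) a₀ - α • low K (low K c * a₀ * a₀) := by
      rw [← ofFin_res, ← map_smul, matOp_def, ← map_sub]
      congr 1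
      ext k
      rw [gK, ha₀, res_ofFin, lamMat, Pi.sub_apply, Matrix.mulVec_diagonal]
      rfl
    have h1 := matOp_one_sub (𝕜 := ℝ) α AK c abar a₀
    rw [map_real, map_real, cast_real, map_real, ← ha₀, RCLike.ofReal_real_eq_id, id] at h1
    have h2 : low K a₀ = a₀ := low_ofFin abar
    have h3 : matOp (1 - AK * lamMat α K) a₀ = a₀ - matOp AK (matOp (lamMat α K) a₀) := by
      rw [← matOp_mul, matOp_def, Matrix.sub_mulVec, Matrix.one_mulVec, map_sub, ofFin_res, h2,
        ← matOp_def]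
    have h4 : ofFin (AK.mulVec (gK α c abar)) = matOp AK (ofFin (gK α c abar) : Ell ℝ ν) := by
      rw [matOp_def, res_ofFin]
    rw [h4, h0, map_sub, map_smul, matOp_low]
    rw [h3, h2] at h1
    rw [← sub_sub_cancel a₀ (matOp AK (matOp (lamMat α K) a₀)), h1]
    module
  have h1 : ‖matOp (1 - AK * DgK α c abar) a₀‖ ≤ Z₀ ν α c abar AK * N :=
    (norm_matOp_le _ _).trans (mul_le_mul_of_nonneg_left (norm_low_le K a₀) (opNorm_nonneg _))
  have h2 : ‖matOp AK (low K c * a₀ * a₀)‖ ≤ b * (‖c‖ * N * N) := by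
    refine (norm_matOp_le _ _).trans (mul_le_mul hab ?_ (norm_nonneg _) hb0)
    refine (norm_low_le K _).trans ((norm_mul_le _ _).trans ?_)
    refine mul_le_mul_of_nonneg_right ((norm_mul_le _ _).trans ?_) hN0
    exact mul_le_mul_of_nonneg_right hκ hN0
  have h3 : ‖α • matOp AK (low K c * a₀ * a₀)‖ ≤ α * (b * (‖c‖ * N * N)) := by
    rw [norm_smul, Real.norm_eq_abs, abs_of_pos hα]
    exact mul_le_mul_of_nonneg_left h2 hα.le
  have h4 := norm_sub_norm_le a₀ (matOp (1 - AK * DgK α c abar) a₀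
      - α • matOp AK (low K c * a₀ * a₀))
  rw [← e] at h4
  have h5 := norm_sub_le (matOp (1 - AK * DgK α c abar) a₀) (α • matOp AK (low K c * a₀ * a₀))
  have h6 := Y₀_ge hα hαK AK c abar
  have h7 := mul_nonneg (excess_nonneg (AK := AK) (c := c) hα) (sq_nonneg N)
  have h8 := mul_le_mul_of_nonneg_right hZ1 hN0
  have h9 : 0 ≤ Z₁ ν α c abar AK * N := by
    refine mul_nonneg (le_trans ?_ hZ1) hN0
    positivity
  have h10 := mul_nonneg hZ.le (sq_nonneg r)
  have h11 : (1 - Z₀ ν α c abar AK - Z₁ ν α c abar AK) * N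
      < (1 - Z₀ ν α c abar AK - Z₁ ν α c abar AK) * r := by linarith
  exact lt_of_mul_lt_mul_left h11 hη.le

/-- If `|ā| < r`, the defect at zero is bounded without `Z₁`: it differs from the defect at `ā`,
which `Z₀` bounds, by a product with `ā`. -/
theorem norm_defect_zero_le (hα : 0 < α) (hαK : α < ((K : ℝ) + 1) ^ 2)
    (hN : ‖(ofFin abar : Ell ℝ ν)‖ < r) (h : Ell 𝕜 ν) :
    ‖defect hαK AK c 0 h‖ ≤ (Z₂ ν α c AK * r + Z₀ ν α c abar AK) * ‖h‖ := by
  rw [defect, mul_zero, map_zero, zero_mul, map_zero, smul_zero, add_zero,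
    matOp_one_sub α AK c abar]
  set N := ‖(ofFin abar : Ell ℝ ν)‖
  have hH := norm_nonneg h
  have h1 : ‖matOp ((1 - AK * DgK α c abar).map ((↑) : ℝ → 𝕜)) h‖ ≤ Z₀ ν α c abar AK * ‖h‖ :=
    (norm_matOp_map_le _ _).trans (mul_le_mul_of_nonneg_left (norm_low_le K h) (opNorm_nonneg _))
  have h2 : ‖matOp (AK.map ((↑) : ℝ → 𝕜)) (cast 𝕜 (low K c * ofFin abar) * low K h)‖
      ≤ max (opNorm ν AK) 1 * (max ‖c‖ 1 * r * ‖h‖) := by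
    refine (norm_matOp_map_le _ _).trans (mul_le_mul (le_max_left _ _) ?_ (norm_nonneg _)
      (zero_le_one.trans (le_max_right _ _)))
    refine (norm_low_le K _).trans ((norm_cast_mul_le _ _).trans ?_)
    have hr0 : 0 ≤ r := (norm_nonneg _).trans hN.le
    have hc0 : 0 ≤ max ‖c‖ 1 := zero_le_one.trans (le_max_right _ _)
    refine mul_le_mul ((norm_mul_le _ _).trans ?_) (norm_low_le K h) (norm_nonneg _)
      (mul_nonneg hc0 hr0)
    exact mul_le_mul ((norm_low_le K c).trans (le_max_left _ _)) hN.le (norm_nonneg _) hc0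
  refine (norm_sub_le _ _).trans ?_
  rw [norm_smul, RCLike.norm_ofReal, abs_of_pos (by positivity)]
  have h3 := mul_le_mul_of_nonneg_left h2 (show 0 ≤ 2 * α by positivity)
  have e : Z₂ ν α c AK = 2 * α * max (opNorm ν AK) 1 * max ‖c‖ 1 := rfl
  rw [e]
  linarith

/-- At the unique zero in the ball, the defect is bounded by `ε = Z₂ r + Z₁ + Z₀`. -/
theorem norm_defect_le_of_unique_zero (hα : 0 < α) (hαK : α < ((K : ℝ) + 1) ^ 2) (hr : 0 < r)
    (hAK : IsUnit AK)
    (hrad : Z₂ ν α c AK * r ^ 2 - (1 - Z₀ ν α c abar AK - Z₁ ν α c abar AK) * r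
      + Y₀ ν α c abar AK < 0) {x : Ell ℝ ν}
    (hxr : ‖x - ofFin abar‖ < r) (hx : ∀ k, g α c x k = 0)
    (huniq : ∀ y : Ell ℝ ν, ‖y - ofFin abar‖ < r → (∀ k, g α c y k = 0) → y = x) (h : Ell 𝕜 ν) :
    ‖defect hαK AK c x h‖
      ≤ (Z₂ ν α c AK * r + Z₁ ν α c abar AK + Z₀ ν α c abar AK) * ‖h‖ := by
  rcases le_or_gt (1 / (((K : ℝ) + 1) ^ 2 - α)) (max (opNorm ν AK) 1) with hb | hb
  · exact norm_defect_le_of_zero hα hαK hr hAK hrad hb hxr hx h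
  · have hN := norm_ofFin_lt hα hαK hr hrad hb
    have h0 : x = 0 := (huniq 0 (by rwa [zero_sub, norm_neg])
      ((newton_eq_iff hαK hAK c 0).mp (newton_zero hαK))).symm
    rw [h0]
    refine (norm_defect_zero_le (c := c) hα hαK hN h).trans
      (mul_le_mul_of_nonneg_right ?_ (norm_nonneg _))
    have := Z₁_nonneg hα hαK c abar AK
    linarith

end Ell
end Fisher

namespace Fisher

/-! ### Continuity of the number of unstable roots of a matrix -/

open Polynomial Filter Topology

/-- The number of roots of the characteristic polynomial with positive real part, counted with
multiplicity. -/
noncomputable def unstableCount {n : Type*} [Fintype n] [DecidableEq n] (B : Matrix n n ℂ) : ℕ :=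
  (B.charpoly.roots.countP fun z => 0 < z.re)

theorem exists_charpoly_eq_prod {N : ℕ} (B : Matrix (Fin N) (Fin N) ℂ) :
    ∃ z : Fin N → ℂ, B.charpoly = ∏ i, (X - C (z i)) := by
  have hs : B.charpoly.Splits := IsAlgClosed.splits _
  have hcard : Multiset.card B.charpoly.roots = N := by
    rw [← hs.natDegree_eq_card_roots, Matrix.charpoly_natDegree_eq_dim, Fintype.card_fin]
  have e : Fin N ≃ B.charpoly.roots := (Fintype.equivFinOfCardEq (by simpa using hcard)).symm
  refine ⟨fun i => (e i).1, ?_⟩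
  rw [e.prod_comp (fun x : B.charpoly.roots => X - C (x.1 : ℂ))]
  conv_lhs => rw [hs.eq_prod_roots_of_monic B.charpoly_monic]
  conv_lhs => rw [← Multiset.map_univ_coe B.charpoly.roots, Multiset.map_map]
  rfl

theorem unstableCount_of_charpoly_eq {n ι : Type*} [Fintype n] [DecidableEq n] [Fintype ι]
    {B : Matrix n n ℂ} {z : ι → ℂ} (h : B.charpoly = ∏ i, (X - C (z i))) :
    unstableCount B = (Finset.univ.filter fun i => 0 < (z i).re).card := by
  have e : ∏ i, (X - C (z i))
      = ((Finset.univ.val.map z).map fun a => X - C a).prod := by rw [Multiset.map_map]; rfl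
  rw [unstableCount, h, e, roots_multiset_prod_X_sub_C, Multiset.countP_map]
  rfl

theorem norm_root_charpoly_le {N : ℕ} {B : Matrix (Fin N) (Fin N) ℂ} {z : ℂ}
    (hz : B.charpoly.IsRoot z) : ‖z‖ ≤ ∑ i, ∑ j, ‖B i j‖ := by
  rw [IsRoot, Matrix.eval_charpoly] at hz
  obtain ⟨v, hv0, hv⟩ := Matrix.exists_mulVec_eq_zero_iff.mpr hz
  have hv' : ∀ i, z * v i = ∑ j, B i j * v j := by
    intro i
    have := congrFun hv i
    rw [Matrix.sub_mulVec, Matrix.scalar_apply, Pi.sub_apply, Matrix.mulVec_diagonal,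
      Pi.zero_apply, sub_eq_zero] at this
    exact this
  obtain ⟨i₀, hi₀⟩ := Function.ne_iff.mp hv0
  have hpos : 0 < ∑ i, ‖v i‖ :=
    Finset.sum_pos' (fun _ _ => norm_nonneg _) ⟨i₀, Finset.mem_univ _, norm_pos_iff.mpr hi₀⟩
  refine le_of_mul_le_mul_right ?_ hpos
  calc ‖z‖ * ∑ i, ‖v i‖ = ∑ i, ‖∑ j, B i j * v j‖ := by
        rw [Finset.mul_sum]; exact Finset.sum_congr rfl fun i _ => by rw [← norm_mul, hv']
    _ ≤ ∑ i, ∑ j, ‖B i j‖ * ∑ l, ‖v l‖ := Finset.sum_le_sum fun i _ =>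
        (norm_sum_le _ _).trans (Finset.sum_le_sum fun j _ => by
          rw [norm_mul]
          exact mul_le_mul_of_nonneg_left (Finset.single_le_sum (f := fun l => ‖v l‖)
            (fun _ _ => norm_nonneg _) (Finset.mem_univ j)) (norm_nonneg _))
    _ = _ := by simp only [Finset.sum_mul]

/-- The number of unstable roots is locally constant at a matrix without purely imaginary
eigenvalues: the root vectors of nearby matrices stay in a compact set, and their limits are the
root vectors of the limit matrix. -/
theorem eventually_unstableCount_eq {N : ℕ} {B : Matrix (Fin N) (Fin N) ℂ}
    (hB : ∀ z, B.charpoly.IsRoot z → z.re ≠ 0) :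
    ∀ᶠ B' in 𝓝 B, unstableCount B' = unstableCount B := by
  have : FirstCountableTopology (Matrix (Fin N) (Fin N) ℂ) :=
    inferInstanceAs (FirstCountableTopology (Fin N → Fin N → ℂ))
  by_contra hcon
  obtain ⟨u, hu, hne⟩ := exists_seq_forall_of_frequently (not_eventually.mp hcon)
  choose z hz using fun n => exists_charpoly_eq_prod (u n)
  have hentry : Tendsto (fun n => ∑ i, ∑ j, ‖u n i j‖) atTop (𝓝 (∑ i, ∑ j, ‖B i j‖)) := by
    refine tendsto_finsetSum _ fun i _ => tendsto_finsetSum _ fun j _ => Tendsto.norm ?_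
    exact ((continuous_apply j).comp (continuous_apply i)).continuousAt.tendsto.comp hu
  obtain ⟨R, hR⟩ := hentry.bddAbove_range
  have hbound : ∀ n, z n ∈ Metric.closedBall (0 : Fin N → ℂ) (max R 0) := by
    intro n
    rw [mem_closedBall_zero_iff, pi_norm_le_iff_of_nonneg (le_max_right _ _)]
    intro i
    refine ((norm_root_charpoly_le ?_).trans (hR ⟨n, rfl⟩)).trans (le_max_left _ _)
    rw [IsRoot, hz n, eval_prod]
    exact Finset.prod_eq_zero (Finset.mem_univ i) (by simp)
  obtain ⟨w, -, φ, hφ, hw⟩ := tendsto_subseq_of_bounded Metric.isBounded_closedBall hbound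
  have hwi : ∀ i, Tendsto (fun n => z (φ n) i) atTop (𝓝 (w i)) := fun i =>
    ((continuous_apply i).continuousAt.tendsto.comp hw)
  have hchar : B.charpoly = ∏ i, (X - C (w i)) := by
    refine Polynomial.funext fun x => ?_
    have h1 : Tendsto (fun n => (u (φ n)).charpoly.eval x) atTop (𝓝 (B.charpoly.eval x)) := by
      simp only [Matrix.eval_charpoly]
      have hc : Continuous fun M : Matrix (Fin N) (Fin N) ℂ => (Matrix.scalar (Fin N) x - M).det :=
        (continuous_const.sub continuous_id).matrix_det
      exact (hc.tendsto B).comp (hu.comp hφ.tendsto_atTop)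
    have h2 : Tendsto (fun n => (u (φ n)).charpoly.eval x) atTop
        (𝓝 ((∏ i, (X - C (w i))).eval x)) := by
      simp only [hz, eval_prod, eval_sub, eval_X, eval_C]
      exact tendsto_finsetProd _ fun i _ => (hwi i).const_sub x
    exact tendsto_nhds_unique h1 h2
  have hre : ∀ i, (w i).re ≠ 0 := fun i => hB _ (by
    rw [IsRoot, hchar, eval_prod]
    exact Finset.prod_eq_zero (Finset.mem_univ i) (by simp))
  have hev : ∀ᶠ n in atTop, ∀ i, (0 < (z (φ n) i).re ↔ 0 < (w i).re) := by
    refine eventually_all.mpr fun i => ?_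
    have hre' : Tendsto (fun n => (z (φ n) i).re) atTop (𝓝 (w i).re) :=
      (Complex.continuous_re.tendsto _).comp (hwi i)
    rcases (hre i).lt_or_gt with h | h
    · filter_upwards [hre'.eventually_lt_const h] with n hn
      exact ⟨fun h' => absurd hn h'.not_gt, fun h' => absurd h h'.not_gt⟩
    · filter_upwards [hre'.eventually_const_lt h] with n hn
      exact ⟨fun _ => h, fun _ => hn⟩
  obtain ⟨n, hn⟩ := hev.exists
  refine hne (φ n) ?_
  rw [unstableCount_of_charpoly_eq (hz (φ n)), unstableCount_of_charpoly_eq hchar]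
  simp only [hn]

/-- Homotopy invariance of the number of unstable roots, as long as no root meets the imaginary
axis. -/
theorem unstableCount_eq_of_path {N : ℕ} (B : ℝ → Matrix (Fin N) (Fin N) ℂ)
    (hB : ContinuousOn B (Set.Icc 0 1))
    (hre : ∀ s ∈ Set.Icc (0 : ℝ) 1, ∀ z, (B s).charpoly.IsRoot z → z.re ≠ 0) :
    unstableCount (B 0) = unstableCount (B 1) := by
  have hloc : ContinuousOn (fun s => unstableCount (B s)) (Set.Icc 0 1) := by
    intro s hs
    have h := (hB s hs).eventually (eventually_unstableCount_eq (hre s hs))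
    exact (tendsto_pure.mpr h).mono_right (pure_le_nhds _)
  exact isPreconnected_Icc.constant hloc (by simp) (by simp)

end Fisher

namespace Fisher

namespace Ell

variable {ν : ℝ}

/-! ### An invariant graph over finitely many modes -/

/-- The normalized basis vectors of `ℓ¹_ν`. -/
noncomputable def unit (j : ℕ) : Ell ℂ ν :=
  mk (Pi.single j ((weight ν j : ℂ)⁻¹)) (mem_of_finite j fun k hk => by simp [hk.ne'])

theorem unit_apply (j k : ℕ) :
    (unit j : Ell ℂ ν) k = if k = j then (weight ν j : ℂ)⁻¹ else 0 := by
  rw [unit, mk_apply, Pi.single_apply]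

variable [hν : Fact (1 < ν)]

/-- The coordinates with respect to the normalized basis vectors. -/
noncomputable def coef (i : ℕ) : Ell ℂ ν →ₗ[ℂ] ℂ where
  toFun x := weight ν i * x i
  map_add' x y := by simp [mul_add]
  map_smul' t x := by simp [mul_left_comm]

theorem coef_apply (i : ℕ) (x : Ell ℂ ν) : coef i x = weight ν i * x i := rfl

theorem weight_ne (k : ℕ) : (weight ν k : ℂ) ≠ 0 := by
  exact_mod_cast (weight_pos hν.out k).ne'

theorem coef_unit (i j : ℕ) : coef i (unit j : Ell ℂ ν) = if i = j then 1 else 0 := by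
  rw [coef_apply, unit_apply]
  split_ifs with h
  · rw [h, mul_inv_cancel₀ (weight_ne j)]
  · rw [mul_zero]

theorem norm_coef (i : ℕ) (x : Ell ℂ ν) : ‖coef i x‖ = weight ν i * ‖x i‖ := by
  rw [coef_apply, norm_mul, Complex.norm_real, Real.norm_of_nonneg (weight_pos hν.out i).le]

theorem norm_unit (j : ℕ) : ‖(unit j : Ell ℂ ν)‖ = 1 := by
  refine (hasSum_norm _).unique ?_
  simp only [← norm_coef, coef_unit]
  convert hasSum_ite_eq j (1 : ℝ) using 2 with i
  split_ifs <;> simp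

theorem sum_norm_coef_le (n : ℕ) (x : Ell ℂ ν) : ∑ i : Fin (n + 1), ‖coef i x‖ ≤ ‖x‖ := by
  simp only [norm_coef]
  rw [Finset.sum_range (fun i => weight ν i * ‖x i‖) |>.symm]
  exact sum_le_hasSum _ (fun i _ => mul_nonneg (weight_pos hν.out i).le (norm_nonneg _))
    (hasSum_norm x)

theorem norm_sum_coef_smul_le {n : ℕ} (x : Ell ℂ ν) {G : Fin (n + 1) → Ell ℂ ν} {C : ℝ}
    (hG : ‖G‖ ≤ C) : ‖∑ i : Fin (n + 1), coef i x • G i‖ ≤ ‖x‖ * C := by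
  have hC : 0 ≤ C := (norm_nonneg _).trans hG
  refine (norm_sum_le _ _).trans ?_
  calc ∑ i : Fin (n + 1), ‖coef i x • G i‖ ≤ ∑ i : Fin (n + 1), ‖coef i x‖ * C :=
        Finset.sum_le_sum fun i _ => by
          rw [norm_smul]
          exact mul_le_mul_of_nonneg_left ((norm_le_pi_norm G i).trans hG) (norm_nonneg _)
    _ ≤ _ := by
        rw [← Finset.sum_mul]
        exact mul_le_mul_of_nonneg_right (sum_norm_coef_le n x) hC

theorem abs_inv_gap_le {n : ℕ} (j : Fin (n + 1)) (k : ℕ) (hk : n < k) :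
    |((j : ℝ) ^ 2 - (k : ℝ) ^ 2)⁻¹| ≤ 1 / (2 * n + 1) := by
  have h1 : (n : ℝ) + 1 ≤ k := by exact_mod_cast hk
  have h2 : (j : ℝ) ≤ n := by exact_mod_cast Nat.lt_succ_iff.mp j.2
  have h3 : ((n : ℝ) + 1) ^ 2 ≤ (k : ℝ) ^ 2 := pow_le_pow_left₀ (by positivity) h1 2
  have h4 : (j : ℝ) ^ 2 ≤ (n : ℝ) ^ 2 := pow_le_pow_left₀ (by positivity) h2 2
  have h5 : 2 * (n : ℝ) + 1 ≤ (k : ℝ) ^ 2 - (j : ℝ) ^ 2 := by linarith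
  have h6 : (0 : ℝ) < 2 * n + 1 := by positivity
  rw [abs_inv, abs_of_neg (by linarith), ← one_div]
  exact one_div_le_one_div_of_le h6 (by linarith)

/-- The fixed points `G` of this map are the columns of the linear maps, from the modes up to `n`
to the others, whose graph is invariant under the operator `x ↦ (α - k²) x_k - (M x)_k`. This is
the Riccati equation of the graph, divided by the spectral gaps `j² - k²`. -/
noncomputable def riccati (n : ℕ) (M : Ell ℂ ν →L[ℂ] Ell ℂ ν) (G : Fin (n + 1) → Ell ℂ ν) :
    Fin (n + 1) → Ell ℂ ν := fun j =>
  tailOp n (abs_inv_gap_le j)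
    (M (unit j + G j) - ∑ i : Fin (n + 1), coef i (M (unit j + G j)) • G i)

/-- The contraction property in `G`, and the dependence on `M`. As `‖unit j + G j‖ ≤ 2`, the bracket
in `riccati` has the Lipschitz constant `4 μ`, and the gap is at least `2 n + 1 ≥ 8 μ`. -/
theorem norm_riccati_sub_le {n : ℕ} {M M' : Ell ℂ ν →L[ℂ] Ell ℂ ν} {μ : ℝ}
    (hM' : ‖M'‖ ≤ μ) (hn : 8 * μ ≤ 2 * n + 1) {G G' : Fin (n + 1) → Ell ℂ ν}
    (hG : ‖G‖ ≤ 1) (hG' : ‖G'‖ ≤ 1) :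
    ‖riccati n M G - riccati n M' G'‖ ≤ 1 / 2 * ‖G - G'‖ + 4 * ‖M - M'‖ := by
  rw [pi_norm_le_iff_of_nonneg (by positivity)]
  intro j
  have hn0 : (0 : ℝ) < 2 * n + 1 := by positivity
  have hμ : 0 ≤ μ := (norm_nonneg _).trans hM'
  set y := M (unit j + G j) with hy
  set y' := M' (unit j + G' j) with hy'
  have hv : ∀ {H : Fin (n + 1) → Ell ℂ ν}, ‖H‖ ≤ 1 → ‖unit j + H j‖ ≤ 2 := fun {H} h => by
    have h1 := norm_add_le (unit j) (H j)
    have h2 := norm_le_pi_norm H j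
    rw [norm_unit] at h1
    linarith
  have hGj : ‖G j - G' j‖ ≤ ‖G - G'‖ := norm_le_pi_norm (G - G') j
  have h1 : ‖y - y'‖ ≤ 2 * ‖M - M'‖ + μ * ‖G - G'‖ := by
    have e : y - y' = (M - M') (unit j + G j) + M' (G j - G' j) := by
      rw [hy, hy', _root_.sub_apply, map_add M', map_add M', map_sub M']
      abel
    rw [e]
    refine (norm_add_le _ _).trans (add_le_add ?_ ?_)
    · refine ((M - M').le_opNorm _).trans ?_
      rw [mul_comm 2]
      exact mul_le_mul_of_nonneg_left (hv hG) (norm_nonneg _)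
    · exact (M'.le_opNorm _).trans (mul_le_mul hM' hGj (norm_nonneg _) hμ)
  have h2 : ‖y'‖ ≤ 2 * μ := by
    refine (M'.le_opNorm _).trans ?_
    rw [mul_comm 2]
    exact mul_le_mul hM' (hv hG') (norm_nonneg _) hμ
  have e : riccati n M G j - riccati n M' G' j
      = tailOp n (abs_inv_gap_le j) ((y - y') - ∑ i : Fin (n + 1), coef i (y - y') • G i
        - ∑ i : Fin (n + 1), coef i y' • (G - G') i) := by
    rw [riccati, riccati, ← map_sub]
    congr 1
    simp only [map_sub, sub_smul, Pi.sub_apply, smul_sub, Finset.sum_sub_distrib]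
    abel
  rw [Pi.sub_apply, e]
  set z := (y - y') - ∑ i : Fin (n + 1), coef i (y - y') • G i
        - ∑ i : Fin (n + 1), coef i y' • (G - G') i with hz
  have h3 : ‖z‖ ≤ 4 * ‖M - M'‖ + 4 * μ * ‖G - G'‖ := by
    have k1 := norm_sub_le ((y - y') - ∑ i : Fin (n + 1), coef i (y - y') • G i)
      (∑ i : Fin (n + 1), coef i y' • (G - G') i)
    have k2 := norm_sub_le (y - y') (∑ i : Fin (n + 1), coef i (y - y') • G i)
    have k3 := norm_sum_coef_smul_le (y - y') hG
    have k4 := norm_sum_coef_smul_le y' (le_refl ‖G - G'‖)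
    have k5 := mul_le_mul_of_nonneg_right h2 (norm_nonneg (G - G'))
    linarith
  have h4 : ‖tailOp n (abs_inv_gap_le j) z‖ ≤ 1 / (2 * n + 1) * ‖z‖ := by
    refine (norm_tailOp_le _ _ _).trans (mul_le_mul_of_nonneg_left ?_ (by positivity))
    have := norm_low_add n z
    have := norm_nonneg (low n z)
    linarith
  refine h4.trans ?_
  rw [one_div, inv_mul_le_iff₀ hn0]
  have k1 := mul_le_mul_of_nonneg_right hn (norm_nonneg (G - G'))
  have k2 : 0 ≤ 2 * (n : ℝ) * ‖M - M'‖ := by positivity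
  have k3 := norm_nonneg (M - M')
  nlinarith

theorem norm_riccati_le {n : ℕ} {M : Ell ℂ ν →L[ℂ] Ell ℂ ν} {μ : ℝ}
    (hM : ‖M‖ ≤ μ) (hn : 8 * μ ≤ 2 * n + 1) {G : Fin (n + 1) → Ell ℂ ν} (hG : ‖G‖ ≤ 1) :
    ‖riccati n M G‖ ≤ 1 := by
  rw [pi_norm_le_iff_of_nonneg zero_le_one]
  intro j
  have hn0 : (0 : ℝ) < 2 * n + 1 := by positivity
  have hμ : 0 ≤ μ := (norm_nonneg _).trans hM
  set y := M (unit j + G j) with hy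
  have h2 : ‖y‖ ≤ 2 * μ := by
    refine (M.le_opNorm _).trans ?_
    rw [mul_comm 2]
    have h1 := norm_add_le (unit j) (G j)
    have h2 := norm_le_pi_norm G j
    rw [norm_unit] at h1
    exact mul_le_mul hM (by linarith) (norm_nonneg _) hμ
  set z := y - ∑ i : Fin (n + 1), coef i y • G i with hz
  have h3 : ‖z‖ ≤ 4 * μ := by
    have k1 := norm_sub_le y (∑ i : Fin (n + 1), coef i y • G i)
    have k2 := norm_sum_coef_smul_le y hG
    linarith
  have h4 : ‖tailOp n (abs_inv_gap_le j) z‖ ≤ 1 / (2 * n + 1) * ‖z‖ := by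
    refine (norm_tailOp_le _ _ _).trans (mul_le_mul_of_nonneg_left ?_ (by positivity))
    have := norm_low_add n z
    have := norm_nonneg (low n z)
    linarith
  refine h4.trans ?_
  rw [one_div, inv_mul_le_iff₀ hn0]
  linarith

/-- `G` parametrizes an invariant graph of `x ↦ (α - k²) x_k - (M x)_k` over the modes up to
`n`; the number `α` drops out of the Riccati equation. -/
def IsInvGraph {n : ℕ} (M : Ell ℂ ν →L[ℂ] Ell ℂ ν) (G : Fin (n + 1) → Ell ℂ ν) : Prop :=
  ‖G‖ ≤ 1 ∧ riccati n M G = G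

theorem exists_isInvGraph {n : ℕ} {M : Ell ℂ ν →L[ℂ] Ell ℂ ν} {μ : ℝ}
    (hM : ‖M‖ ≤ μ) (hn : 8 * μ ≤ 2 * n + 1) :
    ∃ G : Fin (n + 1) → Ell ℂ ν, IsInvGraph M G := by
  have hmaps : Set.MapsTo (riccati n M) (Metric.closedBall 0 1) (Metric.closedBall 0 1) := by
    intro G hG
    rw [mem_closedBall_zero_iff] at hG ⊢
    exact norm_riccati_le hM hn hG
  have hcontr : ContractingWith (1 / 2) (hmaps.restrict _ _ _) := by
    refine ⟨by rw [← NNReal.coe_lt_coe]; norm_num, LipschitzWith.of_dist_le_mul fun x y => ?_⟩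
    rw [Subtype.dist_eq, Subtype.dist_eq, dist_eq_norm, dist_eq_norm]
    have := norm_riccati_sub_le (M := M) hM hn (mem_closedBall_zero_iff.mp x.2)
      (mem_closedBall_zero_iff.mp y.2)
    rw [sub_self, norm_zero, mul_zero, add_zero] at this
    simpa using this
  obtain ⟨G, hG, hfix, -⟩ := hcontr.exists_fixedPoint' Metric.isClosed_closedBall.isComplete hmaps
    (Metric.mem_closedBall_self zero_le_one) (edist_ne_top _ _)
  exact ⟨G, mem_closedBall_zero_iff.mp hG, hfix⟩

/-- The invariant graph depends Lipschitz continuously on the operator; in particular it is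
unique. -/
theorem IsInvGraph.norm_sub_le {n : ℕ} {M M' : Ell ℂ ν →L[ℂ] Ell ℂ ν} {μ : ℝ}
    (hM' : ‖M'‖ ≤ μ) (hn : 8 * μ ≤ 2 * n + 1) {G G' : Fin (n + 1) → Ell ℂ ν}
    (hG : IsInvGraph M G) (hG' : IsInvGraph M' G') : ‖G - G'‖ ≤ 8 * ‖M - M'‖ := by
  have := norm_riccati_sub_le (M := M) hM' hn hG.1 hG'.1
  rw [hG.2, hG'.2] at this
  linarith

theorem IsInvGraph.apply_eq_zero {n : ℕ} {M : Ell ℂ ν →L[ℂ] Ell ℂ ν}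
    {G : Fin (n + 1) → Ell ℂ ν} (hG : IsInvGraph M G) (j : Fin (n + 1)) {k : ℕ} (hk : k ≤ n) :
    G j k = 0 := by
  rw [← hG.2, riccati, tailOp_apply, if_pos hk]

/-- The Riccati equation without the division by the gaps. -/
theorem IsInvGraph.gap_mul {n : ℕ} {M : Ell ℂ ν →L[ℂ] Ell ℂ ν}
    {G : Fin (n + 1) → Ell ℂ ν} (hG : IsInvGraph M G) (j : Fin (n + 1)) {k : ℕ} (hk : n < k) :
    ((j : ℂ) ^ 2 - (k : ℂ) ^ 2) * G j k = M (unit j + G j) k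
      - ∑ i : Fin (n + 1), coef i (M (unit j + G j)) * G i k := by
  have h := congrFun hG.2 j
  have hne : ((j : ℂ) ^ 2 - (k : ℂ) ^ 2) ≠ 0 := by
    have h1 : ((j : ℕ) : ℤ) < k := by have := j.2; omega
    have h2 : ((j : ℤ) ^ 2 - (k : ℤ) ^ 2) ≠ 0 := by
      have : (j : ℤ) ^ 2 < (k : ℤ) ^ 2 := pow_lt_pow_left₀ h1 (by positivity) two_ne_zero
      omega
    exact_mod_cast h2
  have h' : G j k = ((j : ℂ) ^ 2 - (k : ℂ) ^ 2)⁻¹ * (M (unit j + G j) k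
      - ∑ i : Fin (n + 1), coef i (M (unit j + G j)) * G i k) := by
    conv_lhs => rw [← h]
    rw [riccati, tailOp_apply, if_neg (by omega), sub_apply, sum_apply]
    simp only [smul_apply]
    congr 1
    push_cast
    rfl
  rw [h', mul_inv_cancel_left₀ hne]

end Ell
end Fisher

namespace Fisher

namespace Ell

variable {ν : ℝ} [hν : Fact (1 < ν)]

/-! ### Reduction of the spectral problem to a matrix -/

/-- The matrix of `x ↦ (α - k²) x_k - (M x)_k` on the invariant graph given by `G`. -/
noncomputable def graphMat {n : ℕ} (α : ℝ) (M : Ell ℂ ν →L[ℂ] Ell ℂ ν)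
    (G : Fin (n + 1) → Ell ℂ ν) : Matrix (Fin (n + 1)) (Fin (n + 1)) ℂ :=
  Matrix.of fun i j => (if i = j then ((α : ℂ) - (j : ℂ) ^ 2) else 0)
    - coef i (M (unit j + G j))

/-- The parametrization of the graph given by `G`. -/
noncomputable def graphMap {n : ℕ} (G : Fin (n + 1) → Ell ℂ ν) :
    (Fin (n + 1) → ℂ) →ₗ[ℂ] Ell ℂ ν :=
  Fintype.linearCombination ℂ fun j => unit j + G j

theorem graphMap_apply {n : ℕ} (G : Fin (n + 1) → Ell ℂ ν) (x : Fin (n + 1) → ℂ) :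
    graphMap G x = ∑ j, x j • (unit j + G j) := Fintype.linearCombination_apply _ _ _

variable {α μ : ℝ} {n : ℕ} {M : Ell ℂ ν →L[ℂ] Ell ℂ ν} {G : Fin (n + 1) → Ell ℂ ν}

theorem IsInvGraph.coef_graphMap (hG : IsInvGraph M G) (x : Fin (n + 1) → ℂ) (i : Fin (n + 1)) :
    coef i (graphMap G x) = x i := by
  rw [graphMap_apply, map_sum, Finset.sum_eq_single i]
  · rw [map_smul, map_add, coef_unit, if_pos rfl, coef_apply,
      hG.apply_eq_zero i (Nat.lt_succ_iff.mp i.2)]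
    simp
  · intro j _ hj
    rw [map_smul, map_add, coef_unit, if_neg (fun h => hj (Fin.ext h.symm)), coef_apply,
      hG.apply_eq_zero j (Nat.lt_succ_iff.mp i.2)]
    simp
  · simp

theorem IsInvGraph.graphMap_injective (hG : IsInvGraph M G) :
    Function.Injective (graphMap G) := fun x y h => funext fun i => by
  rw [← hG.coef_graphMap x, h, hG.coef_graphMap]

theorem IsInvGraph.graphMap_low (hG : IsInvGraph M G) (x : Fin (n + 1) → ℂ) (i : Fin (n + 1)) :
    (weight ν i : ℂ) * graphMap G x i = x i := hG.coef_graphMap x i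

theorem graphMap_high (x : Fin (n + 1) → ℂ) {k : ℕ} (hk : n < k) :
    graphMap G x k = ∑ j, x j * G j k := by
  rw [graphMap_apply, sum_apply]
  refine Finset.sum_congr rfl fun j _ => ?_
  rw [smul_apply, add_apply, unit_apply, if_neg (by have := j.2; omega), zero_add]

theorem graphMat_mulVec (x : Fin (n + 1) → ℂ) (i : Fin (n + 1)) :
    (graphMat α M G).mulVec x i
      = ((α : ℂ) - (i : ℂ) ^ 2) * x i - coef i (M (graphMap G x)) := by
  simp only [Matrix.mulVec, dotProduct, graphMat, Matrix.of_apply, sub_mul,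
    Finset.sum_sub_distrib, ite_mul, zero_mul, Finset.sum_ite_eq, Finset.mem_univ, if_true]
  rw [graphMap_apply, map_sum, map_sum]
  congr 1
  exact Finset.sum_congr rfl fun j _ => by rw [map_smul, map_smul, smul_eq_mul, mul_comm]

/-- Invariance of the graph: the operator acts on it by the matrix `graphMat`. -/
theorem IsInvGraph.apply_graphMap (hG : IsInvGraph M G) (x : Fin (n + 1) → ℂ) (k : ℕ) :
    ((α : ℂ) - (k : ℂ) ^ 2) * graphMap G x k - M (graphMap G x) k
      = graphMap G ((graphMat α M G).mulVec x) k := by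
  rcases le_or_gt k n with hk | hk
  · have h1 := hG.graphMap_low x ⟨k, Nat.lt_succ_iff.mpr hk⟩
    have h2 := hG.graphMap_low ((graphMat α M G).mulVec x) ⟨k, Nat.lt_succ_iff.mpr hk⟩
    rw [graphMat_mulVec, coef_apply] at h2
    simp only at h1 h2
    refine mul_left_cancel₀ (weight_ne (ν := ν) k) ?_
    rw [h2, ← h1]
    ring
  · rw [graphMap_high _ hk, graphMap_high _ hk]
    simp only [graphMat_mulVec, sub_mul, Finset.sum_sub_distrib]
    have h1 : ∀ j : Fin (n + 1), ((α : ℂ) - (j : ℂ) ^ 2) * x j * G j k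
        = ((α : ℂ) - (k : ℂ) ^ 2) * (x j * G j k) - x j * (M (unit j + G j) k
          - ∑ i : Fin (n + 1), coef i (M (unit j + G j)) * G i k) := by
      intro j
      rw [← hG.gap_mul j hk]; ring
    have h2 : M (graphMap G x) k = ∑ j, x j * M (unit j + G j) k := by
      rw [graphMap_apply, map_sum, sum_apply]
      exact Finset.sum_congr rfl fun j _ => by rw [map_smul, smul_apply]
    have h3 : ∑ i : Fin (n + 1), coef i (M (graphMap G x)) * G i k
        = ∑ j, x j * ∑ i : Fin (n + 1), coef i (M (unit j + G j)) * G i k := by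
      simp only [Finset.mul_sum]
      rw [Finset.sum_comm]
      refine Finset.sum_congr rfl fun i _ => ?_
      rw [graphMap_apply, map_sum, map_sum, Finset.sum_mul]
      refine Finset.sum_congr rfl fun j _ => ?_
      rw [map_smul, map_smul, smul_eq_mul, mul_assoc]
    have h4 : ∑ j : Fin (n + 1), ((α : ℂ) * x j * G j k - (j : ℂ) ^ 2 * x j * G j k)
        = ((α : ℂ) - (k : ℂ) ^ 2) * ∑ j, x j * G j k - (∑ j, x j * M (unit j + G j) k
          - ∑ j, x j * ∑ i : Fin (n + 1), coef i (M (unit j + G j)) * G i k) := by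
      rw [Finset.mul_sum, ← Finset.sum_sub_distrib, ← Finset.sum_sub_distrib]
      refine Finset.sum_congr rfl fun j _ => ?_
      rw [← mul_sub, ← h1]; ring
    rw [Finset.sum_sub_distrib] at h4
    rw [h2, h3, h4]
    ring

/-- If `(L - z) ξ` lies in the graph, so does `ξ`, for `z` in the closed right half-plane:
transversally to the graph, `L - z` is injective, as `k² - α` dominates the perturbation for
`k > n`. -/
theorem IsInvGraph.eq_graphMap (hG : IsInvGraph M G) (hM : ‖M‖ ≤ μ)
    (hn : 2 * μ < ((n : ℝ) + 1) ^ 2 - α) {z : ℂ} (hz : 0 ≤ z.re) {ξ : Ell ℂ ν}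
    {x : Fin (n + 1) → ℂ}
    (h : ∀ k : ℕ, ((α : ℂ) - (k : ℂ) ^ 2) * ξ k - M ξ k - z * ξ k = graphMap G x k) :
    ξ = graphMap G fun i => coef i ξ := by
  -- `y` is the deviation of `ξ` from the graph over the same low modes; `(L - z) y` is in the graph
  set t₀ : Fin (n + 1) → ℂ := fun i => coef i ξ with ht₀
  set y : Ell ℂ ν := ξ - graphMap G t₀ with hy
  set t : Fin (n + 1) → ℂ := x - ((graphMat α M G).mulVec t₀ - z • t₀) with ht
  have hylow : ∀ i : Fin (n + 1), coef i y = 0 := fun i => by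
    rw [hy, map_sub, hG.coef_graphMap, ht₀, sub_self]
  have hLy : ∀ k : ℕ, ((α : ℂ) - (k : ℂ) ^ 2) * y k - M y k - z * y k = graphMap G t k := by
    intro k
    have h1 := hG.apply_graphMap (α := α) t₀ k
    have h2 : graphMap G t = graphMap G x
        - (graphMap G ((graphMat α M G).mulVec t₀) - z • graphMap G t₀) := by
      rw [ht, map_sub, map_sub, map_smul]
    have h3 : M y k = M ξ k - M (graphMap G t₀) k := by rw [hy, map_sub, sub_apply]
    have h4 : y k = ξ k - graphMap G t₀ k := by rw [hy, sub_apply]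
    rw [h2, h3, h4, sub_apply (graphMap G x), sub_apply (graphMap G _), smul_apply, ← h1, ← h k]
    ring
  have hti : ∀ i : Fin (n + 1), t i = -coef i (M y) := by
    intro i
    have h1 := hG.coef_graphMap t i
    rw [coef_apply, ← hLy] at h1
    have h2 := hylow i
    rw [coef_apply] at h2
    rw [← h1, coef_apply]
    linear_combination ((α : ℂ) - (i : ℂ) ^ 2 - z) * h2
  have hμ : 0 ≤ μ := (norm_nonneg _).trans hM
  set D : ℝ := ((n : ℝ) + 1) ^ 2 - α with hD
  have hD0 : 0 < D := by linarith
  set u : Ell ℂ ν := M y - ∑ i : Fin (n + 1), coef i (M y) • G i with hu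
  have hu1 : ‖u‖ ≤ 2 * μ * ‖y‖ := by
    have k1 := _root_.norm_sub_le (M y) (∑ i : Fin (n + 1), coef i (M y) • G i)
    have k2 := norm_sum_coef_smul_le (M y) hG.1
    have k3 : ‖M y‖ ≤ μ * ‖y‖ :=
      (M.le_opNorm y).trans (mul_le_mul_of_nonneg_right hM (norm_nonneg _))
    linarith
  have hyu : ‖y‖ ≤ 1 / D * ‖u‖ := by
    refine norm_le_mul_of_forall_le fun k => ?_
    rcases le_or_gt k n with hk | hk
    · have h1 := hylow ⟨k, Nat.lt_succ_iff.mpr hk⟩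
      rw [coef_apply, mul_eq_zero] at h1
      rw [h1.resolve_left (weight_ne k), norm_zero]
      positivity
    · have h1 : u k = ((α : ℂ) - (k : ℂ) ^ 2 - z) * y k := by
        have h2 := hLy k
        rw [graphMap_high _ hk] at h2
        simp only [hti, neg_mul, Finset.sum_neg_distrib] at h2
        rw [hu, sub_apply, sum_apply]
        simp only [smul_apply]
        linear_combination -h2
      have h3 : D ≤ ‖(α : ℂ) - (k : ℂ) ^ 2 - z‖ := by
        have h4 : (n : ℝ) + 1 ≤ k := by exact_mod_cast hk
        have h5 : ((n : ℝ) + 1) ^ 2 ≤ (k : ℝ) ^ 2 := pow_le_pow_left₀ (by positivity) h4 2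
        have h6 := (neg_abs_le _).trans' (neg_le_neg (Complex.abs_re_le_norm
          ((α : ℂ) - (k : ℂ) ^ 2 - z)))
        have h7 : ((α : ℂ) - (k : ℂ) ^ 2 - z).re = α - (k : ℝ) ^ 2 - z.re := by
          simp [← Complex.ofReal_natCast, ← Complex.ofReal_pow]
        rw [h7] at h6
        linarith
      rw [h1, norm_mul, one_div, ← div_eq_inv_mul, le_div_iff₀ hD0, mul_comm]
      exact mul_le_mul_of_nonneg_right h3 (norm_nonneg _)
  have hy0 : ‖y‖ = 0 := by
    rw [one_div, ← div_eq_inv_mul, le_div_iff₀ hD0] at hyu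
    by_contra hne
    have hpos : 0 < ‖y‖ := lt_of_le_of_ne (norm_nonneg _) (Ne.symm hne)
    have := mul_lt_mul_of_pos_right hn hpos
    linarith
  exact sub_eq_zero.mp (norm_eq_zero.mp hy0)

/-- The parametrization of the graph, with values in the submodule of sequences. -/
noncomputable def graphMap' (G : Fin (n + 1) → Ell ℂ ν) : (Fin (n + 1) → ℂ) →ₗ[ℂ] ell1 ℂ ν :=
  graphMap G

variable {L : ell1 ℂ ν →ₗ[ℂ] (ℕ → ℂ)}

/-- The kernels of the powers of `L - z` are those of the matrix, by induction on the power and the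
absence of transversal spectrum. -/
theorem IsInvGraph.kerPow_eq (hG : IsInvGraph M G) (hM : ‖M‖ ≤ μ)
    (hn : 2 * μ < ((n : ℝ) + 1) ^ 2 - α)
    (hL : ∀ (ξ : Ell ℂ ν) (k : ℕ), L ξ k = ((α : ℂ) - (k : ℂ) ^ 2) * ξ k - M ξ k)
    {z : ℂ} (hz : 0 ≤ z.re) (p : ℕ) :
    kerPow L z p = (LinearMap.ker ((Matrix.toLin' (graphMat α M G) - z • 1) ^ p)).map
      (graphMap' G) := by
  have hLg : ∀ (ξ : Ell ℂ ν) (k : ℕ), (L - z • (ell1 ℂ ν).subtype) ξ k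
      = ((α : ℂ) - (k : ℂ) ^ 2) * ξ k - M ξ k - z * ξ k := by
    intro ξ k
    rw [← hL]; rfl
  have hLG : ∀ x, (L - z • (ell1 ℂ ν).subtype) (graphMap' G x)
      = (graphMap' G ((Matrix.toLin' (graphMat α M G) - z • 1) x) : ell1 ℂ ν) := by
    intro x
    funext k
    have h1 := hLg (graphMap G x) k
    rw [hG.apply_graphMap] at h1
    refine h1.trans ?_
    change _ = graphMap G _ k
    rw [LinearMap.sub_apply, map_sub, sub_apply, LinearMap.smul_apply, map_smul, smul_apply,
      Matrix.toLin'_apply]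
    rfl
  induction p with
  | zero =>
    rw [kerPow, pow_zero, Module.End.one_eq_id, LinearMap.ker_id, Submodule.map_bot]
  | succ p ih =>
    ext ξ
    rw [kerPow, ih, Submodule.mem_comap, Submodule.mem_map, Submodule.mem_map]
    constructor
    · rintro ⟨η, hη, hηξ⟩
      obtain ⟨x', hx', rfl⟩ := Submodule.mem_map.mp hη
      have h1 := hG.eq_graphMap hM hn hz (ξ := ξ) (x := x') (fun k =>
        (hLg ξ k).symm.trans (congrFun hηξ k).symm)
      refine ⟨fun i => coef i (ξ : Ell ℂ ν), ?_, h1.symm⟩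
      have h2 : (ξ : ell1 ℂ ν) = graphMap' G fun i => coef i (ξ : Ell ℂ ν) := h1
      rw [h2, hLG] at hηξ
      have h3 := hG.graphMap_injective (Subtype.ext hηξ : graphMap' G _ = graphMap' G _)
      rw [LinearMap.mem_ker, pow_succ, Module.End.mul_apply, ← h3]
      exact hx'
    · rintro ⟨x, hx, rfl⟩
      rw [LinearMap.mem_ker, pow_succ, Module.End.mul_apply] at hx
      exact ⟨_, Submodule.mem_map_of_mem (LinearMap.mem_ker.mpr hx), (hLG x).symm⟩

theorem IsInvGraph.genEigenspace_eq (hG : IsInvGraph M G) (hM : ‖M‖ ≤ μ)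
    (hn : 2 * μ < ((n : ℝ) + 1) ^ 2 - α)
    (hL : ∀ (ξ : Ell ℂ ν) (k : ℕ), L ξ k = ((α : ℂ) - (k : ℂ) ^ 2) * ξ k - M ξ k)
    {z : ℂ} (hz : 0 ≤ z.re) :
    genEigenspace L z = (Module.End.maxGenEigenspace (Matrix.toLin' (graphMat α M G)) z).map
      (graphMap' G) := by
  rw [genEigenspace, ← Module.End.iSup_genEigenspace_eq, Submodule.map_iSup]
  refine iSup_congr fun p => ?_
  rw [hG.kerPow_eq hM hn hL hz, Module.End.genEigenspace_nat]

theorem IsInvGraph.isEigenvalue_iff (hG : IsInvGraph M G) (hM : ‖M‖ ≤ μ)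
    (hn : 2 * μ < ((n : ℝ) + 1) ^ 2 - α)
    (hL : ∀ (ξ : Ell ℂ ν) (k : ℕ), L ξ k = ((α : ℂ) - (k : ℂ) ^ 2) * ξ k - M ξ k)
    {z : ℂ} (hz : 0 ≤ z.re) :
    IsEigenvalue L z ↔ (graphMat α M G).charpoly.IsRoot z := by
  have h1 : IsEigenvalue L z ↔ kerPow L z 1 ≠ ⊥ := by
    rw [Submodule.ne_bot_iff]
    constructor
    · rintro ⟨ξ, hξ, h⟩
      refine ⟨ξ, ?_, hξ⟩
      refine ⟨0, by simp [kerPow], ?_⟩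
      rw [LinearMap.sub_apply, h, LinearMap.smul_apply]
      simp
    · rintro ⟨ξ, ⟨η, hη, h⟩, hξ⟩
      refine ⟨ξ, hξ, ?_⟩
      have : η = 0 := by simpa [kerPow] using hη
      rw [this, map_zero, LinearMap.sub_apply] at h
      exact (sub_eq_zero.mp h.symm)
  have hinj : Function.Injective (graphMap' G) := hG.graphMap_injective
  rw [h1, hG.kerPow_eq hM hn hL hz, pow_one, ne_eq,
    (Submodule.map_injective_of_injective hinj).eq_iff' (Submodule.map_bot _), ← ne_eq,
    ← Module.End.eigenspace_def, ← Matrix.charpoly_toLin',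
    ← Module.End.hasEigenvalue_iff_isRoot_charpoly]
  rfl

/-- The unstable eigenvalues are those of the matrix on the invariant graph. -/
theorem IsInvGraph.hasExactlyUnstable (hG : IsInvGraph M G) (hM : ‖M‖ ≤ μ)
    (hn : 2 * μ < ((n : ℝ) + 1) ^ 2 - α)
    (hL : ∀ (ξ : Ell ℂ ν) (k : ℕ), L ξ k = ((α : ℂ) - (k : ℂ) ^ 2) * ξ k - M ξ k) :
    HasExactlyUnstable L (unstableCount (graphMat α M G)) := by
  classical
  set B := graphMat α M G with hB
  have hinj : Function.Injective (graphMap' G) := hG.graphMap_injective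
  have hset : unstableEigenvalues L
      = ((B.charpoly.roots.filter fun z => 0 < z.re).toFinset : Set ℂ) := by
    ext z
    rw [Finset.mem_coe, Multiset.mem_toFinset, Multiset.mem_filter,
      Polynomial.mem_roots B.charpoly_monic.ne_zero, and_comm]
    exact and_congr_right fun hz => hG.isEigenvalue_iff hM hn hL hz.le
  have hfin : ∀ z ∈ unstableEigenvalues L, FiniteDimensional ℂ (genEigenspace L z) := by
    intro z hz
    rw [hG.genEigenspace_eq hM hn hL hz.1.le]
    infer_instance
  have hrank : ∀ z ∈ unstableEigenvalues L, Module.finrank ℂ (genEigenspace L z)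
      = B.charpoly.rootMultiplicity z := by
    intro z hz
    rw [hG.genEigenspace_eq hM hn hL hz.1.le, ← Matrix.charpoly_toLin',
      ← LinearMap.finrank_maxGenEigenspace_eq]
    exact (Submodule.equivMapOfInjective _ hinj _).finrank_eq.symm
  refine ⟨by rw [hset]; exact Finset.finite_toSet _, hfin, ?_⟩
  rw [finsum_mem_congr rfl hrank, hset, finsum_mem_coe_finset, unstableCount,
    Multiset.countP_eq_card_filter, ← Multiset.toFinset_sum_count_eq]
  refine Finset.sum_congr rfl fun z hz => ?_
  rw [Multiset.mem_toFinset, Multiset.mem_filter] at hz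
  rw [Multiset.count_filter_of_pos (p := fun z : ℂ => 0 < z.re) hz.2, Polynomial.count_roots]

end Ell
end Fisher

namespace Fisher

namespace Ell

variable {ν : ℝ} [hν : Fact (1 < ν)] {K : ℕ}

/-! ### Homotopy to the block diagonal operator -/

theorem norm_matOp_diagonal_le {d : Fin (K + 1) → ℂ} {D : ℝ} (hd : ∀ j, ‖d j‖ ≤ D)
    (a : Ell ℂ ν) : ‖matOp (Matrix.diagonal d) a‖ ≤ D * ‖a‖ := by
  have hD : 0 ≤ D := (norm_nonneg _).trans (hd 0)
  refine norm_le_mul_of_forall_le fun k => ?_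
  rw [matOp_def, ofFin_apply]
  split_ifs with hk
  · rw [Matrix.mulVec_diagonal, res_apply, norm_mul]
    exact mul_le_mul_of_nonneg_right (hd _) (norm_nonneg _)
  · rw [norm_zero]; positivity

theorem matOp_one (a : Ell ℂ ν) : matOp (1 : Matrix (Fin (K + 1)) (Fin (K + 1)) ℂ) a = low K a := by
  rw [matOp_def, Matrix.one_mulVec, ofFin_res]

theorem matOp_sub (R R' : Matrix (Fin (K + 1)) (Fin (K + 1)) ℂ) (a : Ell ℂ ν) :
    matOp (R - R') a = matOp R a - matOp R' a := by
  simp only [matOp_def, Matrix.sub_mulVec, map_sub]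

/-- Because of this, a bound of the modes up to `K` with the factor `‖Q‖ ‖Q⁻¹‖` may be combined with one of the
other modes that has the factor one. -/
theorem one_le_opNorm_mul_opNorm_inv {Q : Matrix (Fin (K + 1)) (Fin (K + 1)) ℂ} (hQ : IsUnit Q) :
    1 ≤ opNorm ν Q * opNorm ν Q⁻¹ := by
  have hdet := (Matrix.isUnit_iff_isUnit_det Q).mp hQ
  have h1 : matOp Q (matOp Q⁻¹ (unit 0 : Ell ℂ ν)) = unit 0 := by
    rw [← matOp_mul, Matrix.mul_nonsing_inv Q hdet, matOp_one]
    ext k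
    rw [low_apply, unit_apply]
    split_ifs <;> first | rfl | omega
  have h2 := (norm_matOp_le Q (matOp Q⁻¹ (unit 0 : Ell ℂ ν))).trans
    (mul_le_mul_of_nonneg_left (norm_low_le K _) (opNorm_nonneg _))
  have h3 := mul_le_mul_of_nonneg_left ((norm_matOp_le Q⁻¹ (unit 0 : Ell ℂ ν)).trans
    (mul_le_mul_of_nonneg_left (norm_low_le K _) (opNorm_nonneg _))) (opNorm_nonneg (ν := ν) Q)
  rw [h1] at h2
  rw [norm_unit] at h2 h3
  linarith

/-- The role of `μ₀`: it bounds `1 / (1 - z λ_j)` for all imaginary `z`. -/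
theorem one_le_μ₀_mul_norm {lam : Fin (K + 1) → ℂ} (j : Fin (K + 1)) (hj : (lam j).re ≠ 0) {z : ℂ}
    (hz : z.re = 0) : 1 ≤ μ₀ lam * ‖1 - z * lam j‖ := by
  set a := (lam j).re
  set b := (lam j).im
  set t := z.im
  have h1 : Real.sqrt (1 + (b / a) ^ 2) ≤ μ₀ lam :=
    le_ciSup (f := fun j => Real.sqrt (1 + ((lam j).im / (lam j).re) ^ 2))
      (Set.finite_range _).bddAbove j
  have h2 : ‖1 - z * lam j‖ = Real.sqrt ((1 + t * b) ^ 2 + (t * a) ^ 2) := by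
    rw [Complex.norm_eq_sqrt_sq_add_sq]
    congr 1
    simp only [Complex.sub_re, Complex.sub_im, Complex.mul_re, Complex.mul_im, Complex.one_re,
      Complex.one_im, hz]
    ring
  refine le_trans ?_ (mul_le_mul_of_nonneg_right h1 (norm_nonneg _))
  rw [h2, ← Real.sqrt_mul (by positivity), Real.one_le_sqrt]
  -- Cauchy-Schwarz for the vectors `(1, -b / a)` and `(1 + t b, t a)`, of inner product one
  have h3 : (1 + (b / a) ^ 2) * ((1 + t * b) ^ 2 + (t * a) ^ 2)
      = 1 + ((b / a) * (1 + t * b) + t * a) ^ 2 := by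
    field_simp
    ring
  rw [h3]
  exact le_add_of_nonneg_right (sq_nonneg _)

theorem one_le_μ₀ {lam : Fin (K + 1) → ℂ} (hlam : ∀ j, (lam j).re ≠ 0) : 1 ≤ μ₀ lam := by
  simpa using one_le_μ₀_mul_norm 0 (hlam 0) (z := 0) rfl

/-- The equation `(1 - z A) ξ = f` for imaginary `z`, where `A` is `Q diag(λ) Q⁻¹` on the modes up
to `K` and the real multiplier `d` on the others. Its solution is bounded by
`‖Q‖ ‖Q⁻¹‖ μ₀ ‖f‖`, hence it is zero if `f` is small relative to it. -/
theorem eq_zero_of_resolvent {Q : Matrix (Fin (K + 1)) (Fin (K + 1)) ℂ} (hQ : IsUnit Q)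
    {lam : Fin (K + 1) → ℂ} (hlam : ∀ j, (lam j).re ≠ 0) {ε : ℝ}
    (hQε : opNorm ν Q * opNorm ν Q⁻¹ * μ₀ lam * ε < 1) {z : ℂ} (hz : z.re = 0) {d : ℕ → ℝ}
    {ξ f : Ell ℂ ν} (hf : ‖f‖ ≤ ε * ‖ξ‖)
    (hlow : low K ξ - z • matOp (Q * Matrix.diagonal lam * Q⁻¹) ξ = low K f)
    (htail : ∀ k, K < k → (1 - z * (d k : ℂ)) * ξ k = f k) : ξ = 0 := by
  have hdet := (Matrix.isUnit_iff_isUnit_det Q).mp hQ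
  have hQ1 := one_le_opNorm_mul_opNorm_inv (ν := ν) hQ
  have hμ := one_le_μ₀ hlam
  have hne : ∀ j, 1 - z * lam j ≠ 0 := fun j h => by
    have := one_le_μ₀_mul_norm j (hlam j) hz
    rw [h, norm_zero, mul_zero] at this
    linarith
  set C := opNorm ν Q * opNorm ν Q⁻¹ * μ₀ lam with hC
  have hC1 : 1 ≤ C := one_le_mul_of_one_le_of_one_le hQ1 hμ
  set R : Matrix (Fin (K + 1)) (Fin (K + 1)) ℂ := Matrix.diagonal fun j => (1 - z * lam j)⁻¹ with hR
  have h1 : low K ξ = matOp Q (matOp R (matOp Q⁻¹ (low K f))) := by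
    have e : Q * R * Q⁻¹ * (1 - z • (Q * Matrix.diagonal lam * Q⁻¹)) = 1 := by
      have e1 : (1 : Matrix (Fin (K + 1)) (Fin (K + 1)) ℂ) - z • (Q * Matrix.diagonal lam * Q⁻¹)
          = Q * (1 - z • Matrix.diagonal lam) * Q⁻¹ := by
        rw [Matrix.mul_sub, Matrix.sub_mul, Matrix.mul_one, Matrix.mul_nonsing_inv Q hdet,
          Matrix.mul_smul, Matrix.smul_mul]
      have e2 : R * (1 - z • Matrix.diagonal lam) = 1 := by
        rw [hR, ← Matrix.diagonal_one, ← Matrix.diagonal_smul, Matrix.diagonal_sub,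
          Matrix.diagonal_mul_diagonal]
        congr 1
        funext j
        exact inv_mul_cancel₀ (hne j)
      calc Q * R * Q⁻¹ * (1 - z • (Q * Matrix.diagonal lam * Q⁻¹))
          = Q * R * (Q⁻¹ * Q) * (1 - z • Matrix.diagonal lam) * Q⁻¹ := by
            rw [e1]; simp only [Matrix.mul_assoc]
        _ = Q * (R * (1 - z • Matrix.diagonal lam)) * Q⁻¹ := by
            rw [Matrix.nonsing_inv_mul Q hdet]; simp only [Matrix.mul_assoc, Matrix.one_mul]
        _ = 1 := by rw [e2, Matrix.mul_one, Matrix.mul_nonsing_inv Q hdet]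
    have e3 : low K f = matOp (1 - z • (Q * Matrix.diagonal lam * Q⁻¹)) ξ := by
      rw [← hlow, ← matOp_one]
      simp only [matOp_def, Matrix.sub_mulVec, Matrix.smul_mulVec, map_sub, map_smul]
    rw [e3, ← matOp_mul, ← matOp_mul, ← matOp_mul]
    rw [e, matOp_one]
  have hRn : ∀ j, ‖(1 - z * lam j)⁻¹‖ ≤ μ₀ lam := fun j => by
    rw [norm_inv, inv_le_iff_one_le_mul₀ (norm_pos_iff.mpr (hne j))]
    exact one_le_μ₀_mul_norm j (hlam j) hz
  have h2 : ‖low K ξ‖ ≤ C * ‖low K f‖ := by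
    have k1 := (norm_matOp_le Q⁻¹ (low K f)).trans
      (mul_le_mul_of_nonneg_left (norm_low_le K _) (opNorm_nonneg _))
    have k2 := norm_matOp_diagonal_le hRn (matOp Q⁻¹ (low K f))
    have k3 := (norm_matOp_le Q (matOp R (matOp Q⁻¹ (low K f)))).trans
      (mul_le_mul_of_nonneg_left (norm_low_le K _) (opNorm_nonneg _))
    rw [← h1] at k3
    have k4 := k2.trans (mul_le_mul_of_nonneg_left k1 (zero_le_one.trans hμ))
    have k5 := k3.trans (mul_le_mul_of_nonneg_left k4 (opNorm_nonneg Q))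
    refine k5.trans (le_of_eq ?_)
    rw [hC]; ring
  have h3 : ‖ξ - low K ξ‖ ≤ C * ‖f - low K f‖ := by
    refine norm_le_mul_of_forall_le fun k => ?_
    rw [sub_apply, sub_apply, low_apply, low_apply]
    split_ifs with hk
    · simp
    · have k1 : 1 ≤ ‖1 - z * (d k : ℂ)‖ := by
        have := Complex.re_le_norm (1 - z * (d k : ℂ))
        simpa [hz] using this
      rw [sub_zero, sub_zero, ← htail k (not_le.mp hk), norm_mul]
      have k2 := one_le_mul_of_one_le_of_one_le hC1 k1
      rw [← mul_assoc]
      exact le_mul_of_one_le_left (norm_nonneg _) k2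
  have h4 := norm_low_add K ξ
  have h5 := norm_low_add K f
  have h6 : ‖ξ‖ ≤ C * ε * ‖ξ‖ := by
    have := mul_le_mul_of_nonneg_left hf (zero_le_one.trans hC1)
    rw [← h5] at this
    linarith
  by_contra h
  have h7 := norm_pos_iff.mpr h
  have h8 := mul_lt_mul_of_pos_right hQε h7
  linarith

/-- The action of a matrix on the modes up to `K`, as a bounded operator. -/
noncomputable def matCLM (R : Matrix (Fin (K + 1)) (Fin (K + 1)) ℂ) : Ell ℂ ν →L[ℂ] Ell ℂ ν :=
  (matOp R).mkContinuous (opNorm ν R) fun a => (norm_matOp_le R a).trans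
    (mul_le_mul_of_nonneg_left (norm_low_le K a) (opNorm_nonneg R))

theorem matCLM_apply (R : Matrix (Fin (K + 1)) (Fin (K + 1)) ℂ) (a : Ell ℂ ν) :
    matCLM R a = matOp R a := rfl

/-- The bounded operator `h ↦ 2 α (c ∗ x ∗ h)`. -/
noncomputable def convCLM (α : ℝ) (c x : Ell ℝ ν) : Ell ℂ ν →L[ℂ] Ell ℂ ν :=
  ContinuousLinearMap.mul ℂ (Ell ℂ ν) (((2 * α : ℝ) : ℂ) • cast ℂ (c * x))

theorem convCLM_apply (α : ℝ) (c x : Ell ℝ ν) (h : Ell ℂ ν) :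
    convCLM α c x h = ((2 * α : ℝ) : ℂ) • (cast ℂ (c * x) * h) := by
  rw [convCLM, ContinuousLinearMap.mul_apply', smul_mul_assoc]

/-- The matrix `Λ - (A^K)⁻¹`, where `Λ` is the linear part of `g` on the modes up to `K`:
subtracting it from `Λ` leaves `(A^K)⁻¹`. -/
noncomputable def blockMat (α : ℝ) (AK : Matrix (Fin (K + 1)) (Fin (K + 1)) ℝ) :
    Matrix (Fin (K + 1)) (Fin (K + 1)) ℂ :=
  (lamMat α K).map ((↑) : ℝ → ℂ) - (AK.map ((↑) : ℝ → ℂ))⁻¹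

/-- The segment of bounded perturbations between the one for which the operator is `A⁻¹` and
the one for which it is `Dg(x)`. -/
noncomputable def pathOp (α : ℝ) (AK : Matrix (Fin (K + 1)) (Fin (K + 1)) ℝ) (c x : Ell ℝ ν)
    (s : ℝ) : Ell ℂ ν →L[ℂ] Ell ℂ ν :=
  matCLM (blockMat α AK) + (s : ℂ) • (convCLM α c x - matCLM (blockMat α AK))

/-- Along the segment, no eigenvalue crosses the imaginary axis: multiplied by `A`, the eigenvalue
equation reads `(1 - z A) ξ = s E ξ`, where `E` is the defect. -/
theorem eq_zero_of_pathOp {α : ℝ} (hαK : α < ((K : ℝ) + 1) ^ 2)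
    {AK : Matrix (Fin (K + 1)) (Fin (K + 1)) ℝ}
    {Q : Matrix (Fin (K + 1)) (Fin (K + 1)) ℂ} (hQ : IsUnit Q)
    {lam : Fin (K + 1) → ℂ} (hlam : ∀ j, (lam j).re ≠ 0)
    (hdiag : AK.map ((↑) : ℝ → ℂ) = Q * Matrix.diagonal lam * Q⁻¹)
    (hdet : IsUnit (AK.map ((↑) : ℝ → ℂ)).det) {ε : ℝ}
    (hQε : opNorm ν Q * opNorm ν Q⁻¹ * μ₀ lam * ε < 1) {c x : Ell ℝ ν}
    (hdef : ∀ h : Ell ℂ ν, ‖defect hαK AK c x h‖ ≤ ε * ‖h‖) {s : ℝ} (hs : s ∈ Set.Icc (0 : ℝ) 1)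
    {z : ℂ} (hz : z.re = 0) {ξ : Ell ℂ ν}
    (h : ∀ k : ℕ, ((α : ℂ) - (k : ℂ) ^ 2) * ξ k - pathOp α AK c x s ξ k = z * ξ k) : ξ = 0 := by
  set A := AK.map ((↑) : ℝ → ℂ) with hA
  set Λ := (lamMat α K).map ((↑) : ℝ → ℂ) with hΛ
  set y := convCLM α c x ξ with hy
  have hdefect : defect hαK AK c x ξ = matOp (1 - A * Λ) ξ + approxInv hαK AK y := by
    rw [hy, convCLM_apply, map_smul, defect]
    have h1 := map_sub Complex.ofRealHom.mapMatrix 1 (AK * lamMat α K)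
    rw [map_one, map_mul] at h1
    exact congrArg (fun M => matOp M ξ + _) h1
  have hpath : pathOp α AK c x s ξ
      = matOp (Λ - A⁻¹) ξ + (s : ℂ) • (y - matOp (Λ - A⁻¹) ξ) := rfl
  refine eq_zero_of_resolvent hQ hlam hQε hz (d := fun k => (α - (k : ℝ) ^ 2)⁻¹)
    (f := (s : ℂ) • defect hαK AK c x ξ) ?_ ?_ ?_
  · rw [norm_smul, Complex.norm_real, Real.norm_of_nonneg hs.1]
    exact (mul_le_of_le_one_left (norm_nonneg _) hs.2).trans (hdef ξ)
  · rw [← hdiag]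
    have h1 : matOp Λ ξ - low K (pathOp α AK c x s ξ) = z • low K ξ := by
      ext k
      rw [sub_apply, smul_apply, low_apply, low_apply, matOp_def, ofFin_apply]
      rcases le_or_gt k K with hk | hk
      · rw [if_pos hk, if_pos hk, dif_pos (Nat.lt_succ_iff.mpr hk), ← h k, hΛ, lamMat,
          Matrix.diagonal_map (by simp), Matrix.mulVec_diagonal]
        simp
      · rw [if_neg hk.not_ge, if_neg hk.not_ge, dif_neg (by omega)]
        simp
    have h2 := congrArg (matOp A) h1
    have h3 : matOp A (matOp A⁻¹ ξ) = low K ξ := by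
      rw [← matOp_mul, Matrix.mul_nonsing_inv A hdet, matOp_one]
    rw [hpath, map_sub, map_smul, matOp_low, matOp_low, map_add, map_smul, map_sub, matOp_sub,
      map_sub, h3] at h2
    rw [map_smul, hdefect, map_add, low_approxInv, low_matOp, matOp_sub, matOp_one, matOp_mul,
      ← h2]
    module
  · intro k hk
    have hne : (α : ℂ) - (k : ℂ) ^ 2 ≠ 0 := by
      have h1 : (K : ℝ) + 1 ≤ k := by exact_mod_cast hk
      have h2 : ((K : ℝ) + 1) ^ 2 ≤ (k : ℝ) ^ 2 := pow_le_pow_left₀ (by positivity) h1 2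
      have h3 : α - (k : ℝ) ^ 2 ≠ 0 := by linarith
      exact_mod_cast h3
    have hz0 : ∀ R : Matrix (Fin (K + 1)) (Fin (K + 1)) ℂ, matOp R ξ k = 0 := fun R =>
      ofFin_apply_of_lt _ hk
    have h1 := h k
    rw [hpath, add_apply, smul_apply, sub_apply, hz0] at h1
    rw [smul_apply, hdefect, add_apply, hz0, approxInv, LinearMap.add_apply, add_apply, matOp_def,
      ofFin_apply_of_lt _ hk, tailOp_apply, if_neg hk.not_ge]
    change (1 - z * (((α - (k : ℝ) ^ 2)⁻¹ : ℝ) : ℂ)) * ξ k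
      = s * (0 + (0 + (((α - (k : ℝ) ^ 2)⁻¹ : ℝ) : ℂ) * y k))
    push_cast
    field_simp
    linear_combination h1

/-- An operator that maps into the modes up to `K ≤ n` has the flat invariant graph. -/
theorem isInvGraph_zero {n : ℕ} (hn : K ≤ n) (R : Matrix (Fin (K + 1)) (Fin (K + 1)) ℂ) :
    IsInvGraph (matCLM R : Ell ℂ ν →L[ℂ] Ell ℂ ν) (0 : Fin (n + 1) → Ell ℂ ν) := by
  refine ⟨by rw [norm_zero]; exact zero_le_one, ?_⟩
  funext j
  refine ext fun k => ?_
  rw [riccati, tailOp_apply]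
  split_ifs with hk
  · rfl
  · simp only [Pi.zero_apply, add_zero, smul_zero, Finset.sum_const_zero, sub_zero, matCLM_apply]
    rw [matOp_def, ofFin_apply_of_lt _ (by omega), mul_zero]
    rfl

/-- At the start of the homotopy the operator is block diagonal: `(A^K)⁻¹`, which has the
eigenvalues `λ_j⁻¹`, and the negative numbers `α - k²`, `k > K`. -/
theorem unstableCount_start {α : ℝ} (hαK : α < ((K : ℝ) + 1) ^ 2)
    {AK : Matrix (Fin (K + 1)) (Fin (K + 1)) ℝ}
    {Q : Matrix (Fin (K + 1)) (Fin (K + 1)) ℂ} (hQ : IsUnit Q)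
    {lam : Fin (K + 1) → ℂ} (hlam : ∀ j, (lam j).re ≠ 0)
    (hdiag : AK.map ((↑) : ℝ → ℂ) = Q * Matrix.diagonal lam * Q⁻¹) (p : ℕ) :
    unstableCount (graphMat α (matCLM (blockMat α AK) : Ell ℂ ν →L[ℂ] Ell ℂ ν)
      (0 : Fin (K + p + 1) → Ell ℂ ν)) = Finset.card {j | 0 < (lam j).re} := by
  set B := graphMat α (matCLM (blockMat α AK) : Ell ℂ ν →L[ℂ] Ell ℂ ν)
      (0 : Fin (K + p + 1) → Ell ℂ ν) with hB
  have hdet := (Matrix.isUnit_iff_isUnit_det Q).mp hQ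
  have hl0 : ∀ j, lam j ≠ 0 := fun j h => hlam j (by rw [h, Complex.zero_re])
  let e : Fin (K + 1) ⊕ Fin p ≃ Fin (K + p + 1) :=
    finSumFinEquiv.trans (finCongr (by omega))
  have hel : ∀ i, (e (Sum.inl i) : ℕ) = i := fun i => rfl
  have her : ∀ i, (e (Sum.inr i) : ℕ) = K + 1 + i := fun i => rfl
  let W : Matrix (Fin (K + 1)) (Fin (K + 1)) ℂ := Matrix.diagonal fun i => (weight ν i : ℂ)
  let W' : Matrix (Fin (K + 1)) (Fin (K + 1)) ℂ := Matrix.diagonal fun i => (weight ν i : ℂ)⁻¹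
  let D : Fin p → ℂ := fun i => ((α - ((K + 1 + i : ℕ) : ℝ) ^ 2 : ℝ) : ℂ)
  have hWW : W * W' = 1 := by
    rw [Matrix.diagonal_mul_diagonal, ← Matrix.diagonal_one]
    congr 1
    funext i
    exact mul_inv_cancel₀ (weight_ne _)
  have hinv : (AK.map ((↑) : ℝ → ℂ))⁻¹ = Q * Matrix.diagonal (fun j => (lam j)⁻¹) * Q⁻¹ := by
    refine Matrix.inv_eq_right_inv ?_
    have e2 : Matrix.diagonal lam * Matrix.diagonal (fun j => (lam j)⁻¹) = 1 := by
      rw [Matrix.diagonal_mul_diagonal, ← Matrix.diagonal_one]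
      congr 1
      funext j
      exact mul_inv_cancel₀ (hl0 j)
    calc AK.map ((↑) : ℝ → ℂ) * (Q * Matrix.diagonal (fun j => (lam j)⁻¹) * Q⁻¹)
        = Q * Matrix.diagonal lam * (Q⁻¹ * Q) * Matrix.diagonal (fun j => (lam j)⁻¹) * Q⁻¹ := by
          rw [hdiag]; simp only [Matrix.mul_assoc]
      _ = Q * (Matrix.diagonal lam * Matrix.diagonal (fun j => (lam j)⁻¹)) * Q⁻¹ := by
          rw [Matrix.nonsing_inv_mul Q hdet]; simp only [Matrix.mul_assoc, Matrix.one_mul]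
      _ = 1 := by rw [e2, Matrix.mul_one, Matrix.mul_nonsing_inv Q hdet]
  have hcoef : ∀ i j : Fin (K + p + 1), B i j = (if i = j then (α : ℂ) - (j : ℂ) ^ 2 else 0)
      - weight ν i * matOp (blockMat α AK) (unit j : Ell ℂ ν) i := by
    intro i j
    rw [hB, graphMat, Matrix.of_apply, Pi.zero_apply, add_zero, matCLM_apply, coef_apply]
  -- `B` is written in the normalized basis, whence the conjugation by the weights
  have hblock : Matrix.reindex e.symm e.symm B
      = Matrix.fromBlocks (W * (AK.map ((↑) : ℝ → ℂ))⁻¹ * W') 0 0 (Matrix.diagonal D) := by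
    have hres1 : ∀ j : Fin (K + 1), res K (unit j : Ell ℂ ν) = Pi.single j (weight ν j : ℂ)⁻¹ := by
      intro j
      ext i
      rw [res_apply, unit_apply, Pi.single_apply]
      simp only [Fin.ext_iff]
    have hres2 : ∀ j : Fin p, res K (unit (K + 1 + j) : Ell ℂ ν) = 0 := by
      intro j
      ext i
      rw [res_apply, unit_apply, if_neg (by have := i.2; omega), Pi.zero_apply]
    ext (i | i) (j | j)
    · rw [Matrix.reindex_apply, Matrix.submatrix_apply, Equiv.symm_symm, hcoef, hel, hel, matOp_def,
        ofFin_apply_fin, hres1, Matrix.mulVec_single, Matrix.fromBlocks_apply₁₁,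
        Matrix.mul_diagonal, Matrix.diagonal_mul, blockMat, lamMat]
      have hw := weight_ne (ν := ν) j
      have hap : ∀ R : Matrix (Fin (K + 1)) (Fin (K + 1)) ℂ,
          (MulOpposite.op (weight ν j : ℂ)⁻¹ • R.col j) i = R i j * (weight ν j : ℂ)⁻¹ :=
        fun R => rfl
      simp only [Equiv.apply_eq_iff_eq, Sum.inl.injEq, hap, Matrix.sub_apply, Matrix.map_apply,
        Matrix.diagonal_apply]
      split_ifs with h
      · rw [h]
        push_cast
        field_simp
        ring
      · push_cast
        ring
    · rw [Matrix.reindex_apply, Matrix.submatrix_apply, Equiv.symm_symm, hcoef, her, matOp_def,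
        hres2, Matrix.mulVec_zero, map_zero, if_neg (by simp)]
      simp
    · rw [Matrix.reindex_apply, Matrix.submatrix_apply, Equiv.symm_symm, hcoef, her, matOp_def,
        ofFin_apply_of_lt _ (by omega), if_neg (by simp)]
      simp
    · rw [Matrix.reindex_apply, Matrix.submatrix_apply, Equiv.symm_symm, hcoef, her, her, matOp_def,
        ofFin_apply_of_lt _ (by omega), Matrix.fromBlocks_apply₂₂, Matrix.diagonal_apply]
      simp only [Equiv.apply_eq_iff_eq, Sum.inr.injEq, mul_zero, sub_zero]
      split_ifs with h
      · rw [h]; simp [D]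
      · rfl
  have hchar : B.charpoly = ∏ i : Fin (K + 1) ⊕ Fin p,
      (Polynomial.X - Polynomial.C (Sum.elim (fun j => (lam j)⁻¹) D i)) := by
    rw [← Matrix.charpoly_reindex e.symm, hblock, Matrix.charpoly_fromBlocks_zero₁₂,
      Matrix.charpoly_diagonal, Fintype.prod_sum_type]
    simp only [Sum.elim_inl, Sum.elim_inr]
    congr 1
    have hWQ : (W * Q) * (Q⁻¹ * W') = 1 := by
      rw [Matrix.mul_assoc, ← Matrix.mul_assoc Q, Matrix.mul_nonsing_inv Q hdet, Matrix.one_mul,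
        hWW]
    have h1 : W * (AK.map ((↑) : ℝ → ℂ))⁻¹ * W'
        = (W * Q * Matrix.diagonal (fun j => (lam j)⁻¹)) * (Q⁻¹ * W') := by
      rw [hinv]
      simp only [Matrix.mul_assoc]
    rw [h1, Matrix.charpoly_mul_comm, ← Matrix.mul_assoc, mul_eq_one_comm.mp hWQ, Matrix.one_mul,
      Matrix.charpoly_diagonal]
  rw [unstableCount_of_charpoly_eq hchar]
  have hfilter : (Finset.univ.filter fun i => 0 < (Sum.elim (fun j => (lam j)⁻¹) D i).re)
      = (Finset.univ.filter fun j => 0 < (lam j).re).map Function.Embedding.inl := by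
    ext i
    rw [Finset.mem_filter, Finset.mem_map]
    rcases i with i | i
    · have h1 : 0 < Complex.normSq (lam i) := Complex.normSq_pos.mpr (hl0 i)
      simp [Complex.inv_re, div_pos_iff_of_pos_right h1]
    · have h1 : (K : ℝ) + 1 ≤ K + 1 + i := le_add_of_nonneg_right (Nat.cast_nonneg _)
      have h2 := pow_le_pow_left₀ (by positivity) h1 2
      have h3 : ¬ 0 < (D i).re := by
        rw [Complex.ofReal_re]
        push_cast
        linarith
      simp [h3]
  rw [hfilter, Finset.card_map]

theorem isUnit_det_map {AK : Matrix (Fin (K + 1)) (Fin (K + 1)) ℝ}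
    {Q : Matrix (Fin (K + 1)) (Fin (K + 1)) ℂ} (hQ : IsUnit Q)
    {lam : Fin (K + 1) → ℂ} (hlam : ∀ j, (lam j).re ≠ 0)
    (hdiag : AK.map ((↑) : ℝ → ℂ) = Q * Matrix.diagonal lam * Q⁻¹) :
    IsUnit (AK.map ((↑) : ℝ → ℂ)).det := by
  have hdet := (Matrix.isUnit_iff_isUnit_det Q).mp hQ
  rw [hdiag, Matrix.det_mul, Matrix.det_mul, Matrix.det_diagonal]
  refine (hdet.mul (isUnit_iff_ne_zero.mpr ?_)).mul (Matrix.isUnit_nonsing_inv_det Q hdet)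
  exact Finset.prod_ne_zero_iff.mpr fun j _ h => hlam j (by rw [h, Complex.zero_re])

theorem isUnit_of_isUnit_det_map {AK : Matrix (Fin (K + 1)) (Fin (K + 1)) ℝ}
    (h : IsUnit (AK.map ((↑) : ℝ → ℂ)).det) : IsUnit AK := by
  have h1 : (AK.map ((↑) : ℝ → ℂ)).det = (AK.det : ℂ) := (RingHom.map_det Complex.ofRealHom AK).symm
  rw [h1, isUnit_iff_ne_zero, Complex.ofReal_ne_zero] at h
  exact (Matrix.isUnit_iff_isUnit_det AK).mpr (isUnit_iff_ne_zero.mpr h)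

theorem pathOp_zero (α : ℝ) (AK : Matrix (Fin (K + 1)) (Fin (K + 1)) ℝ) (c x : Ell ℝ ν) :
    pathOp α AK c x 0 = matCLM (blockMat α AK) := by
  rw [pathOp, Complex.ofReal_zero]
  module

theorem pathOp_one (α : ℝ) (AK : Matrix (Fin (K + 1)) (Fin (K + 1)) ℝ) (c x : Ell ℝ ν) :
    pathOp α AK c x 1 = convCLM α c x := by
  rw [pathOp, Complex.ofReal_one, one_smul, add_sub_cancel]

theorem norm_pathOp_le (α : ℝ) (AK : Matrix (Fin (K + 1)) (Fin (K + 1)) ℝ) (c x : Ell ℝ ν) {s : ℝ}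
    (hs : s ∈ Set.Icc (0 : ℝ) 1) :
    ‖pathOp α AK c x s‖
      ≤ ‖(matCLM (blockMat α AK) : Ell ℂ ν →L[ℂ] Ell ℂ ν)‖ + ‖convCLM α c x‖ := by
  have e : pathOp α AK c x s = ((1 - s : ℝ) : ℂ) • matCLM (blockMat α AK)
      + (s : ℂ) • convCLM α c x := by
    rw [pathOp]; push_cast; module
  rw [e]
  refine (norm_add_le _ _).trans ?_
  rw [norm_smul, norm_smul, Complex.norm_real, Complex.norm_real, Real.norm_of_nonneg hs.1,
    Real.norm_of_nonneg (sub_nonneg.mpr hs.2)]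
  exact add_le_add (mul_le_of_le_one_left (norm_nonneg _) (by linarith [hs.1]))
    (mul_le_of_le_one_left (norm_nonneg _) hs.2)

theorem continuous_pathOp (α : ℝ) (AK : Matrix (Fin (K + 1)) (Fin (K + 1)) ℝ) (c x : Ell ℝ ν) :
    Continuous (pathOp α AK c x) :=
  continuous_const.add (Complex.continuous_ofReal.smul continuous_const)

theorem continuous_coef (i : ℕ) : Continuous (coef i : Ell ℂ ν →ₗ[ℂ] ℂ) :=
  AddMonoidHomClass.continuous_of_bound (coef i : Ell ℂ ν →ₗ[ℂ] ℂ) 1 fun x => by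
    rw [norm_coef, one_mul]
    exact weight_mul_norm_le x i

/-- If the defect is small, `Dg(x)` has as many unstable eigenvalues as `A^K`. The number `K + p` of
modes of the invariant graphs is so large that all operators of the segment have one. -/
theorem hasExactlyUnstable_Dg {α : ℝ} (hαK : α < ((K : ℝ) + 1) ^ 2)
    {AK : Matrix (Fin (K + 1)) (Fin (K + 1)) ℝ}
    {Q : Matrix (Fin (K + 1)) (Fin (K + 1)) ℂ} (hQ : IsUnit Q)
    {lam : Fin (K + 1) → ℂ} (hlam : ∀ j, (lam j).re ≠ 0)
    (hdiag : AK.map ((↑) : ℝ → ℂ) = Q * Matrix.diagonal lam * Q⁻¹) {ε : ℝ}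
    (hQε : opNorm ν Q * opNorm ν Q⁻¹ * μ₀ lam * ε < 1) {c x : Ell ℝ ν}
    (hdef : ∀ h : Ell ℂ ν, ‖defect hαK AK c x h‖ ≤ ε * ‖h‖) :
    HasExactlyUnstable (Dg hν.out α c x) (Finset.card {j | 0 < (lam j).re}) := by
  set μ := ‖(matCLM (blockMat α AK) : Ell ℂ ν →L[ℂ] Ell ℂ ν)‖ + ‖convCLM α c x‖ with hμ
  have hμ0 : 0 ≤ μ := by positivity
  obtain ⟨p, hp⟩ := exists_nat_ge (4 * μ + |α|)
  have hM : ∀ s ∈ Set.Icc (0 : ℝ) 1, ‖pathOp α AK c x s‖ ≤ μ := fun s hs =>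
    norm_pathOp_le α AK c x hs
  have hα := le_abs_self α
  have hα0 := abs_nonneg α
  have hK0 : (0 : ℝ) ≤ K := Nat.cast_nonneg K
  have hn : 8 * μ ≤ 2 * ((K + p : ℕ) : ℝ) + 1 := by push_cast; linarith
  have hn' : 2 * μ < (((K + p : ℕ) : ℝ) + 1) ^ 2 - α := by
    push_cast
    have h1 : (1 : ℝ) ≤ K + p + 1 := by linarith
    have h2 := le_mul_of_one_le_left (zero_le_one.trans h1) h1
    rw [pow_two]
    linarith
  have hex : ∀ s : ℝ, ∃ G : Fin (K + p + 1) → Ell ℂ ν,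
      s ∈ Set.Icc (0 : ℝ) 1 → IsInvGraph (pathOp α AK c x s) G := by
    intro s
    by_cases hs : s ∈ Set.Icc (0 : ℝ) 1
    · obtain ⟨G, hG⟩ := exists_isInvGraph (hM s hs) hn
      exact ⟨G, fun _ => hG⟩
    · exact ⟨0, fun h => absurd h hs⟩
  choose G hG using hex
  have h0 : (0 : ℝ) ∈ Set.Icc (0 : ℝ) 1 := ⟨le_rfl, zero_le_one⟩
  have h1 : (1 : ℝ) ∈ Set.Icc (0 : ℝ) 1 := ⟨zero_le_one, le_rfl⟩
  have hGc : ContinuousOn G (Set.Icc 0 1) := by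
    intro s hs
    rw [ContinuousWithinAt, tendsto_iff_norm_sub_tendsto_zero]
    have h2 : Filter.Tendsto (fun t => 8 * ‖pathOp α AK c x t - pathOp α AK c x s‖)
        (nhdsWithin s (Set.Icc 0 1)) (nhds 0) := by
      have h3 := (tendsto_iff_norm_sub_tendsto_zero.mp
        ((continuous_pathOp α AK c x).tendsto s)).const_mul 8
      rw [mul_zero] at h3
      exact h3.mono_left nhdsWithin_le_nhds
    refine squeeze_zero' (Filter.Eventually.of_forall fun _ => norm_nonneg _) ?_ h2
    filter_upwards [self_mem_nhdsWithin] with t ht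
    exact (hG t ht).norm_sub_le (hM s hs) hn (hG s hs)
  have hcount : unstableCount (graphMat α (pathOp α AK c x 0) (G 0))
      = unstableCount (graphMat α (pathOp α AK c x 1) (G 1)) := by
    refine unstableCount_eq_of_path (fun s => graphMat α (pathOp α AK c x s) (G s)) ?_ ?_
    · refine continuousOn_pi.mpr fun i => continuousOn_pi.mpr fun j => ?_
      refine continuousOn_const.sub ((continuous_coef i).comp_continuousOn ?_)
      exact (continuous_pathOp α AK c x).continuousOn.clm_apply
        (continuousOn_const.add (continuousOn_pi.mp hGc j))
    · intro s hs z hz hz0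
      rw [← Matrix.charpoly_toLin', ← Module.End.hasEigenvalue_iff_isRoot_charpoly] at hz
      obtain ⟨v, hv⟩ := hz.exists_hasEigenvector
      have hv1 : (graphMat α (pathOp α AK c x s) (G s)).mulVec v = z • v := hv.apply_eq_smul
      refine hv.2 ((hG s hs).graphMap_injective (Eq.trans ?_ (map_zero (graphMap (G s))).symm))
      refine eq_zero_of_pathOp hαK hQ hlam hdiag (isUnit_det_map hQ hlam hdiag) hQε hdef hs hz0
        fun k => ?_
      rw [(hG s hs).apply_graphMap, hv1, map_smul, smul_apply]
  have hG0 : G 0 = 0 := by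
    have h2 := hG 0 h0
    rw [pathOp_zero] at h2
    have h3 := h2.norm_sub_le (by rw [← pathOp_zero α AK c x]; exact hM 0 h0) hn
      (isInvGraph_zero (Nat.le_add_right K p) (blockMat α AK))
    rw [sub_self, norm_zero, mul_zero] at h3
    exact sub_eq_zero.mp (norm_le_zero_iff.mp h3)
  rw [hG0, pathOp_zero, unstableCount_start hαK hQ hlam hdiag] at hcount
  rw [hcount]
  refine (hG 1 h1).hasExactlyUnstable (hM 1 h1) hn' fun ξ k => ?_
  rw [pathOp_one, convCLM_apply]
  change _ - 2 * (α : ℂ) * (cast ℂ (c * x) * ξ : Ell ℂ ν) k = _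
  rw [smul_apply]
  push_cast
  rfl

end Ell
end Fisher

theorem mainTheorem6 (ν α r : ℝ) (hν : 1 < ν) (hα : 0 < α) (hr : 0 < r)
    (K : ℕ) (hK : 0 < K) (hαK : Real.sqrt α < (K : ℝ) + 1)
    (c : Fisher.ell1 ℝ ν) (abar : Fin (K + 1) → ℝ)
    (AK : Matrix (Fin (K + 1)) (Fin (K + 1)) ℝ)
    (Q : Matrix (Fin (K + 1)) (Fin (K + 1)) ℂ) (lam : Fin (K + 1) → ℂ)
    (hQ : IsUnit Q)
    (hdiag : AK.map (fun x : ℝ => (x : ℂ)) = Q * Matrix.diagonal lam * Q⁻¹)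
    (hlam : ∀ j, (lam j).re ≠ 0)
    (m : ℕ) (hm : (Finset.univ.filter fun j => 0 < (lam j).re).card = m)
    (hrad : Fisher.Z₂ ν α c AK * r ^ 2
      - (1 - Fisher.Z₀ ν α c abar AK - Fisher.Z₁ ν α c abar AK) * r
      + Fisher.Y₀ ν α c abar AK < 0)
    (ε : ℝ)
    (hε : ε = Fisher.Z₂ ν α c AK * r + Fisher.Z₁ ν α c abar AK + Fisher.Z₀ ν α c abar AK)
    (hQε : Fisher.opNorm ν Q * Fisher.opNorm ν Q⁻¹ * Fisher.μ₀ lam * ε < 1) :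
    (1 / (((K : ℝ) + 1) ^ 2 - α) ≤ max (Fisher.opNorm ν AK) 1 →
      ∃! a : Fisher.ell1 ℝ ν, Fisher.IsZeroInBall ν α r c abar a) ∧
    ∀ a : Fisher.ell1 ℝ ν, Fisher.IsZeroInBall ν α r c abar a →
      (∀ b : Fisher.ell1 ℝ ν, Fisher.IsZeroInBall ν α r c abar b → b = a) →
      Fisher.HasExactlyUnstable (Fisher.Dg hν α c a) m := by
  have : Fact (1 < ν) := ⟨hν⟩
  have hαK' : α < ((K : ℝ) + 1) ^ 2 := (Real.sqrt_lt' (by positivity)).mp hαK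
  have hAK : IsUnit AK :=
    Fisher.Ell.isUnit_of_isUnit_det_map (Fisher.Ell.isUnit_det_map hQ hlam hdiag)
  refine ⟨fun hb => Fisher.Ell.exists_unique_zero hα hαK' hr hAK hrad hb, fun a ha huniq => ?_⟩
  subst hm hε
  exact Fisher.Ell.hasExactlyUnstable_Dg hαK' hQ hlam hdiag hQε
    (Fisher.Ell.norm_defect_le_of_unique_zero hα hαK' hr hAK hrad ha.1 ha.2
      fun y hy hgy => huniq y ⟨hy, hgy⟩)
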